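/- Let $A$ and $B$ be Artin algebras, and write $A\text{-mod}$ for the category of finitely generated left $A$-modules. Let $F$ be an additive subbifunctor of $\mathrm{Ext}^1_A(-,-)$ on $A\text{-mod}$. A short exact sequence $0\to X\to Y\to Z\to 0$ is called $F$-exact if its class lies in $F(Z,X)$; a module $P$ (resp. $I$) is $F$-projective (resp. $F$-injective) if $\mathrm{Hom}_A(P,-)$ (resp. $\mathrm{Hom}_A(-,I)$) is exact on $F$-exact sequences. Assume that $F$ has enough projectives and enough injectives, i.e. for every $M$ there are $F$-exact sequences $0\to K\to P\to M\to 0$ and $0\to M\to I\to N\to 0$ with $P$ $F$-projective and $I$ $F$-injective, and that the category $\mathcal P(F)$ of $F$-projective modules equals $\mathrm{add}\,G$ for some $G\in A\text{-mod}$. A complex $X^\bullet$ over $A\text{-mod}$ is $F$-acyclic if all sequences $0\to \mathrm{Im}\,d^{i-1}\to X^i\to \mathrm{Im}\,d^i\to 0$ are $F$-exact, and $D_F^b(A)$ is the Verdier quotient of $K^b(A\text{-mod})$ by the $F$-acyclic complexes; for $F=\mathrm{Ext}^1$ this is the usual $D^b(A)$. A relative tilting complex is a bounded complex $T^\bullet$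 of $F$-projective modules with $\mathrm{Hom}_{K^b(\mathcal P(F))}(T^\bullet,T^\bullet[i])=0$ for $i\neq 0$ and such that $\mathrm{add}\,T^\bullet$ generates $K^b(\mathcal P(F))$ as a triangulated category. Its term length is $t(T^\bullet)=n$ if $T^\bullet$ is isomorphic in the homotopy category to a complex $0\to X^{m-n}\to\cdots\to X^m\to 0$ (for some $m\in\mathbb Z$) whose differentials are radical maps and with $X^{m-n}\neq 0\neq X^m$. Let $K_F(A)$ be the abelian group generated by the isomorphism classes $[M]$ of modules in $A\text{-mod}$, modulo $[N]=[X]+[Y]$ if $N\cong X\oplus Y$ and $[P]=0$ if $P$ is $F$-projective. Let $\Omega_F$ be the endomorphism of $K_F(A)$ sending $[M]$ to $[K]$ for any $F$-exact sequence $0\to K\to P\to M\to 0$ with $P$ $F$-projective, and let $\langle M\rangle\subseteq K_F(A)$ be the subgroup generated by the classes of the indecomposable non-$F$-projective direct summands of $M$. Let $\phi_F(M)$ be the least $k\ge 0$ such that $\Omega_F$ restricts to a bijection $\Omega_F^m\langle M\rangle\to\Omega_F^{m+1}\langle M\rangle$ for all $m\ge k$, and put $\phi\text{-dim}_F(A)=\sup_{M\in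 A\text{-mod}}\phi_F(M)\in\mathbb N\cup\{\infty\}$. Let $\phi\text{-dim}(B)=\phi\text{-dim}_{\mathrm{Ext}^1_B}(B)$. Let $L:D_F^b(A)\to D^b(B)$ be a triangle equivalence (a relative derived equivalence), and let $T^\bullet$ be an associated $F$-tilting complex, i.e. a relative tilting complex with $L(T^\bullet)\cong B$ in $D^b(B)$. Then $$\phi\text{-dim}_F(A)-t(T^\bullet)\le \phi\text{-dim}(B)\le \phi\text{-dim}_F(A)+t(T^\bullet)+2 .$$ -/

import Mathlib

open CategoryTheory Limits

universe w v u

namespace RelDer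

section Ext

variable (C : Type u) [Category.{v} C] [Abelian C] [HasExt.{w} C]

/-- An additive subbifunctor `F` of the bifunctor `Ext¹(-,-)` on an abelian category: a subgroup
of `Ext¹(Z, X)` for all `Z`, `X`, stable under the maps induced by morphisms in both variables. -/
structure ExtSubfunctor where
  /-- The subgroup `F(Z, X)` of `Ext¹(Z, X)`. -/
  obj (Z X : C) : AddSubgroup (Abelian.Ext.{w} Z X 1)
  precomp_mem {Z' Z X : C} (g : Z' ⟶ Z) {e : Abelian.Ext.{w} Z X 1} (he : e ∈ obj Z X) :
    (Abelian.Ext.mk₀ g).comp e (zero_add 1) ∈ obj Z' X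
  postcomp_mem {Z X X' : C} (g : X ⟶ X') {e : Abelian.Ext.{w} Z X 1} (he : e ∈ obj Z X) :
    e.comp (Abelian.Ext.mk₀ g) (add_zero 1) ∈ obj Z X'

/-- The subbifunctor `Ext¹(-,-)` itself. -/
noncomputable def ExtSubfunctor.full : ExtSubfunctor.{w} C where
  obj _ _ := ⊤
  precomp_mem _ _ _ := AddSubgroup.mem_top _
  postcomp_mem _ _ _ := AddSubgroup.mem_top _

end Ext

section Add

variable {C : Type u} [Category.{v} C] [Preadditive C] [HasFiniteBiproducts C]

/-- `add X`: the direct summands of finite direct sums of copies of `X`. -/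
def IsInAdd (X : C) : ObjectProperty C :=
  fun Y => ∃ n : ℕ, Nonempty (Retract Y (⨁ fun _ : Fin n => X))

end Add

section Complexes

variable {C : Type u} [Category.{v} C] [Preadditive C]

/-- Bounded cochain complexes. -/
def IsBoundedCpx (K : CochainComplex C ℤ) : Prop :=
  ∃ a b : ℤ, ∀ i : ℤ, i < a ∨ b < i → IsZero (K.X i)

variable (C) in
/-- The bounded complexes, as objects of the homotopy category `K(C)`. -/
def bounded : ObjectProperty (HomotopyCategory C (ComplexShape.up ℤ)) :=
  fun X => IsBoundedCpx X.as

open ZeroObject in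
instance [HasZeroObject C] : (bounded C).ContainsZero where
  exists_zero := ⟨(HomotopyCategory.quotient _ _).obj 0, Functor.map_isZero _ (isZero_zero _),
    ⟨0, 0, fun i _ => (HomologicalComplex.eval C (ComplexShape.up ℤ) i).map_isZero
      (isZero_zero _)⟩⟩

instance : (bounded C).IsStableUnderShift ℤ where
  isStableUnderShiftBy n :=
    { le_shift X := by
        obtain ⟨K, rfl⟩ := HomotopyCategory.quotient_obj_surjective X
        rintro ⟨a, b, h⟩
        rw [ObjectProperty.prop_shift_iff, HomotopyCategory.shift_quotient_obj]
        exact ⟨a - n, b - n, fun i hi => h (i + n) (by lia)⟩ }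

instance [HasZeroObject C] [HasBinaryBiproducts C] : (bounded C).IsTriangulatedClosed₃ where
  ext₃' T hT h₁ h₂ := by
    obtain ⟨a₁, b₁, h₁⟩ := h₁
    obtain ⟨a₂, b₂, h₂⟩ := h₂
    obtain ⟨f : T.obj₁.as ⟶ T.obj₂.as, hf⟩ :=
      (HomotopyCategory.quotient _ _).map_surjective T.mor₁
    refine ⟨(HomotopyCategory.quotient _ _).obj (CochainComplex.mappingCone f), ?_,
      ⟨Pretriangulated.Triangle.π₃.mapIso (Pretriangulated.isoTriangleOfIso₁₂ T _ hT
        (HomotopyCategory.mappingCone_triangleh_distinguished f)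
        (Iso.refl _) (Iso.refl _) ?_)⟩⟩
    · refine ⟨min (a₁ - 1) a₂, max b₁ b₂, fun i hi => ?_⟩
      refine (CochainComplex.mappingCone.isZero_X_iff f i).2 ⟨h₁ _ ?_, h₂ _ ?_⟩ <;> grind
    · exact (Category.comp_id _).trans (hf.symm.trans (Category.id_comp _).symm)

instance [HasZeroObject C] [HasBinaryBiproducts C] : (bounded C).IsTriangulated where
  toIsTriangulatedClosed₂ := .of_isTriangulatedClosed₃

variable (C) in
/-- The bounded homotopy category `K^b(C)`. -/
abbrev Kb := (bounded C).FullSubcategory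

/-- A radical morphism `f : X ⟶ Y`: `1 - f g` is invertible for every `g : Y ⟶ X`. -/
def IsRadical {X Y : C} (f : X ⟶ Y) : Prop :=
  ∀ g : Y ⟶ X, IsIso (𝟙 X - f ≫ g)

/-- `T` has term length `n`: up to isomorphism in the homotopy category, `T` is a complex
`0 ⟶ X^{m-n} ⟶ ⋯ ⟶ X^m ⟶ 0` with radical differential and nonzero end terms. -/
def HasTermLength (T : CochainComplex C ℤ) (n : ℕ) : Prop :=
  ∃ X : CochainComplex C ℤ, Nonempty (HomotopyEquiv T X) ∧
    (∀ i j : ℤ, IsRadical (X.d i j)) ∧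
    ∃ m : ℤ, ¬ IsZero (X.X (m - n)) ∧ ¬ IsZero (X.X m) ∧
      ∀ i : ℤ, i < m - n ∨ m < i → IsZero (X.X i)

end Complexes

section Abelian

variable {C : Type u} [Category.{v} C] [Abelian C]

lemma isBoundedCpx_single (X : C) :
    IsBoundedCpx ((HomologicalComplex.single C (ComplexShape.up ℤ) 0).obj X) :=
  ⟨0, 0, fun i hi => HomologicalComplex.isZero_single_obj_X _ _ _ _ (by lia)⟩

open CochainComplex.HomComplex in
lemma singleFunctor_map_eq_zero_iff (P : C) (K : CochainComplex C ℤ) (i j : ℤ) (hij : i + 1 = j)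
    (f : P ⟶ K.X j) (φ : (CochainComplex.singleFunctor C j).obj P ⟶ K)
    (hφ : Cochain.ofHom φ = Cochain.fromSingleMk f (add_zero j)) :
    (HomotopyCategory.quotient C (ComplexShape.up ℤ)).map φ = 0 ↔
      ∃ g : P ⟶ K.X i, g ≫ K.d i j = f := by
  constructor
  · intro h
    let z := Cochain.equivHomotopy _ _ (HomotopyCategory.homotopyOfEq φ 0 (by simpa using h))
    obtain ⟨g, hg⟩ := Cochain.fromSingleMk_surjective z.1 i (by lia)
    refine ⟨g, ?_⟩
    have h₁ := z.2
    rw [← hg, Cochain.δ_fromSingleMk g _ 0 j (by lia), hφ, Cochain.ofHom_zero, add_zero] at h₁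
    exact ((Cochain.fromSingleEquiv (add_zero j)).symm.injective h₁).symm
  · rintro ⟨g, rfl⟩
    have : Homotopy φ 0 := (Cochain.equivHomotopy _ _).symm
      ⟨Cochain.fromSingleMk g (n := -1) (by lia), by
        rw [Cochain.δ_fromSingleMk g _ 0 j (by lia), hφ, Cochain.ofHom_zero, add_zero]⟩
    rw [HomotopyCategory.eq_of_homotopy _ _ this, Functor.map_zero]

lemma nonempty_iso_pullback {K P M Q : C} (i : K ⟶ P) (p : P ⟶ M) (w : i ≫ p = 0)
    (h : (ShortComplex.mk i p w).ShortExact) (q : Q ⟶ M) (s : Q ⟶ P) (hs : s ≫ p = q) :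
    Nonempty (pullback q p ≅ K ⊞ Q) := by
  have := h.mono_f
  have hi : Mono i := this
  have hr : (pullback.snd q p - pullback.fst q p ≫ s) ≫ p = 0 := by
    rw [Preadditive.sub_comp, Category.assoc, hs, pullback.condition, sub_self]
  let r : pullback q p ⟶ K := h.exact.lift (pullback.snd q p - pullback.fst q p ≫ s) hr
  have hr' : r ≫ i = pullback.snd q p - pullback.fst q p ≫ s := h.exact.lift_f _ hr
  have hf : (0 : K ⟶ Q) ≫ q = i ≫ p := by simp [w]
  have hs' : 𝟙 Q ≫ q = s ≫ p := by simp [hs]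
  let a : K ⟶ pullback q p := pullback.lift 0 i hf
  let b : Q ⟶ pullback q p := pullback.lift (𝟙 Q) s hs'
  have a₁ : a ≫ pullback.fst q p = 0 := pullback.lift_fst _ _ _
  have a₂ : a ≫ pullback.snd q p = i := pullback.lift_snd _ _ _
  have b₁ : b ≫ pullback.fst q p = 𝟙 Q := pullback.lift_fst _ _ _
  have b₂ : b ≫ pullback.snd q p = s := pullback.lift_snd _ _ _
  have har : a ≫ r = 𝟙 K := by
    rw [← cancel_mono i, Category.assoc, hr', Preadditive.comp_sub, reassoc_of% a₁, a₂]
    simp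
  have hid : r ≫ a + pullback.fst q p ≫ b = 𝟙 _ := by
    apply pullback.hom_ext
    · simp [Preadditive.add_comp, a₁, b₁]
    · simp [Preadditive.add_comp, a₂, b₂, hr']
  let σ : (ShortComplex.mk a (pullback.fst q p) a₁).Splitting :=
    { r := r, s := b, f_r := har, s_g := b₁, id := hid }
  exact ⟨σ.isoBinaryBiproduct⟩

end Abelian

namespace ExtSubfunctor

variable {C : Type u} [Category.{v} C] [Abelian C] [HasExt.{w} C] (F : ExtSubfunctor.{w} C)

/-- The `F`-exact sequences `0 ⟶ X ⟶ Y ⟶ Z ⟶ 0`: the short exact sequences whose class lies in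
`F(Z, X)`. -/
def IsExact (S : ShortComplex C) : Prop :=
  ∃ h : S.ShortExact, h.extClass ∈ F.obj S.X₃ S.X₁

/-- `F`-projective objects: `Hom(P, -)` is exact on `F`-exact sequences. (As `Hom(P, -)` is left
exact, only surjectivity has to be required.) -/
def IsProj : ObjectProperty C :=
  fun P => ∀ S : ShortComplex C, F.IsExact S → ∀ f : P ⟶ S.X₃, ∃ g : P ⟶ S.X₂, g ≫ S.g = f

/-- `F`-injective objects: `Hom(-, I)` is exact on `F`-exact sequences. -/
def IsInj : ObjectProperty C :=
  fun I => ∀ S : ShortComplex C, F.IsExact S → ∀ f : S.X₁ ⟶ I, ∃ g : S.X₂ ⟶ I, S.f ≫ g = f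

/-- `F` has enough projectives: every `M` admits an `F`-exact sequence `0 ⟶ K ⟶ P ⟶ M ⟶ 0` with
`P` an `F`-projective object. -/
class EnoughProj : Prop where
  exists_isExact (M : C) : ∃ (K P : C) (i : K ⟶ P) (p : P ⟶ M) (w : i ≫ p = 0),
    F.IsExact (ShortComplex.mk i p w) ∧ F.IsProj P

/-- `F` has enough injectives: every `M` admits an `F`-exact sequence `0 ⟶ M ⟶ I ⟶ N ⟶ 0` with
`I` an `F`-injective object. -/
class EnoughInj : Prop where
  exists_isExact (M : C) : ∃ (I N : C) (i : M ⟶ I) (p : I ⟶ N) (w : i ≫ p = 0),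
    F.IsExact (ShortComplex.mk i p w) ∧ F.IsInj I

lemma isExact_full_iff (S : ShortComplex C) : (full C).IsExact S ↔ S.ShortExact :=
  ⟨fun h => h.1, fun h => ⟨h, AddSubgroup.mem_top _⟩⟩

lemma isExact_of_lift [F.EnoughProj] (S : ShortComplex C) (hS : S.ShortExact)
    (h : ∀ (P : C), F.IsProj P → ∀ f : P ⟶ S.X₃, ∃ g : P ⟶ S.X₂, g ≫ S.g = f) :
    F.IsExact S := by
  obtain ⟨K, P, i, p, w, ⟨hE, hE'⟩, hP⟩ := EnoughProj.exists_isExact (F := F) S.X₃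
  obtain ⟨g, hg⟩ := h P hP p
  have := hS.mono_f
  let k : K ⟶ S.X₁ := hS.exact.lift (i ≫ g) (by rw [Category.assoc, hg, w])
  let φ : ShortComplex.mk i p w ⟶ S :=
    { τ₁ := k, τ₂ := g, τ₃ := 𝟙 _
      comm₁₂ := hS.exact.lift_f _ _
      comm₂₃ := by simp [hg] }
  refine ⟨hS, ?_⟩
  have e := ShortComplex.ShortExact.extClass_naturality hE hS φ
  have e' : (Abelian.Ext.mk₀ φ.τ₃).comp hS.extClass (zero_add 1) = hS.extClass :=
    Abelian.Ext.mk₀_id_comp _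
  rw [← e', ← e]
  exact F.postcomp_mem _ hE'

attribute [local instance] Abelian.hasFiniteBiproducts in
/-- `P(F) = add G` for some object `G`. -/
def IsOfFiniteType : Prop :=
  ∃ G : C, ∀ M : C, F.IsProj M ↔ IsInAdd G M

/-! ### `F`-acyclic complexes and the relative bounded derived category -/

/-- A complex `K` is `F`-acyclic if for consecutive degrees `i`, `j`, `k` the induced sequence
`0 ⟶ Im d^i ⟶ K^j ⟶ Im d^j ⟶ 0` is `F`-exact. -/
def IsAcyclic (K : CochainComplex C ℤ) : Prop :=
  ∀ i j k : ℤ, i + 1 = j → j + 1 = k →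
    F.IsExact (ShortComplex.mk (image.ι (K.d i j)) (factorThruImage (K.d j k))
      (by simp [← cancel_epi (factorThruImage (K.d i j)), ← cancel_mono (image.ι (K.d j k))]))

/-- The `F`-acyclic complexes, as objects of the homotopy category `K(C)`. -/
def acyclic : ObjectProperty (HomotopyCategory C (ComplexShape.up ℤ)) :=
  fun X => F.IsAcyclic X.as

lemma isAcyclic_iff [F.EnoughProj] (K : CochainComplex C ℤ) :
    F.IsAcyclic K ↔ ∀ (P : C), F.IsProj P → ∀ i j k : ℤ, i + 1 = j → j + 1 = k →
      ∀ f : P ⟶ K.X j, f ≫ K.d j k = 0 → ∃ g : P ⟶ K.X i, g ≫ K.d i j = f := by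
  constructor
  · intro h P hP i j k hij hjk f hf
    obtain ⟨h₁, -⟩ := h i j k hij hjk
    have := h₁.mono_f
    obtain ⟨g, hg⟩ := hP _ (h (i - 1) i j (by lia) hij)
      (h₁.exact.lift f (by rw [← cancel_mono (image.ι (K.d j k))]; simpa using hf))
    refine ⟨g, ?_⟩
    have e := h₁.exact.lift_f f (by rw [← cancel_mono (image.ι (K.d j k))]; simpa using hf)
    rw [← hg] at e
    simpa using e
  · intro h i j k hij hjk
    refine F.isExact_of_lift _ ⟨?_⟩ ?_
    · rw [ShortComplex.exact_iff_exact_up_to_refinements]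
      intro A x hx
      obtain ⟨_, P, _, p, _, ⟨hE, -⟩, hP⟩ := EnoughProj.exists_isExact (F := F) A
      have hp : Epi p := hE.epi_g
      have hx' : x ≫ K.d j k = 0 := by
        have e : x ≫ factorThruImage (K.d j k) = 0 := hx
        simpa using e =≫ image.ι (K.d j k)
      obtain ⟨g, hg⟩ := h P hP i j k hij hjk (p ≫ x) (by simp [hx'])
      exact ⟨P, p, hp, g ≫ factorThruImage _, by simp [hg]⟩
    · intro P hP f
      obtain ⟨g, hg⟩ := h P hP j k (k + 1) hjk rfl (f ≫ image.ι _) (by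
        have : image.ι (K.d j k) ≫ K.d k (k + 1) = 0 := by
          simp [← cancel_epi (factorThruImage (K.d j k))]
        simp [this])
      exact ⟨g, by simpa [← cancel_mono (image.ι (K.d j k))] using hg⟩

/-- The stalk complexes `P[n]` of `F`-projective objects, in the homotopy category. -/
def stalkProj : ObjectProperty (HomotopyCategory C (ComplexShape.up ℤ)) :=
  fun X => ∃ (P : C) (n : ℤ), F.IsProj P ∧
    Nonempty (X ≅ (HomotopyCategory.singleFunctor C n).obj P)

instance : F.stalkProj.IsStableUnderShift ℤ where
  isStableUnderShiftBy m :=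
    { le_shift X := by
        rintro ⟨P, n, hP, ⟨e⟩⟩
        exact ⟨P, n - m, hP, ⟨(shiftFunctor _ m).mapIso e ≪≫
          ((HomotopyCategory.singleFunctors C).shiftIso m (n - m) n (by lia)).app P⟩⟩ }

open CochainComplex.HomComplex in
lemma acyclic_eq_rightOrthogonal [F.EnoughProj] :
    F.acyclic = F.stalkProj.rightOrthogonal := by
  ext X
  obtain ⟨K, rfl⟩ := HomotopyCategory.quotient_obj_surjective X
  refine (F.isAcyclic_iff K).trans ⟨?_, ?_⟩
  · rintro h Y f ⟨P, j, hP, ⟨e⟩⟩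
    rw [← cancel_epi e.inv, comp_zero]
    obtain ⟨φ, hφ⟩ := (HomotopyCategory.quotient C (ComplexShape.up ℤ)).map_surjective
      (X := (CochainComplex.singleFunctor C j).obj P) (Y := K) (e.inv ≫ f)
    obtain ⟨g, hg⟩ := Cochain.fromSingleMk_surjective (Cochain.ofHom φ) j (add_zero j)
    refine hφ.symm.trans ((singleFunctor_map_eq_zero_iff P K (j - 1) j (by lia) g φ hg.symm).2 ?_)
    refine h P hP (j - 1) j (j + 1) (by lia) rfl g ?_
    have e₁ := δ_ofHom φ (p := 1)
    rw [← hg, Cochain.δ_fromSingleMk g (add_zero j) 1 (j + 1) rfl] at e₁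
    exact (Cochain.fromSingleEquiv (K := K) (X := P) (n := 1) (p := j) rfl).symm.injective
      (e₁.trans (map_zero _).symm)
  · intro h P hP i j k hij hjk f hf
    let φ := (Cocycle.fromSingleMk f (add_zero j) k hjk hf).homOf
    exact (singleFunctor_map_eq_zero_iff P K i j hij f φ (by simp [φ])).1
      (h _ ⟨P, j, hP, ⟨Iso.refl _⟩⟩)

instance [F.EnoughProj] : F.acyclic.IsTriangulated := by
  rw [acyclic_eq_rightOrthogonal]; infer_instance

instance [F.EnoughProj] : F.acyclic.IsClosedUnderIsomorphisms := by
  rw [acyclic_eq_rightOrthogonal]; infer_instance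

/-- The relative bounded derived category `D_F^b(C)`: the Verdier quotient of `K^b(C)` by the
subcategory of `F`-acyclic complexes. -/
abbrev Db [F.EnoughProj] :=
  (F.acyclic.inverseImage (bounded C).ι).trW.Localization

/-- A bounded complex, as an object of `D_F^b(C)`. -/
noncomputable def toDb [F.EnoughProj] (K : CochainComplex C ℤ) (hK : IsBoundedCpx K) : F.Db :=
  (F.acyclic.inverseImage (bounded C).ι).trW.Q.obj
    ⟨(HomotopyCategory.quotient C (ComplexShape.up ℤ)).obj K, hK⟩

/-- A relative (`F`-)tilting complex. -/
structure IsTilting (T : CochainComplex C ℤ) : Prop where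
  isBounded : IsBoundedCpx T
  isProj (i : ℤ) : F.IsProj (T.X i)
  hom_shift_eq_zero (i : ℤ) (hi : i ≠ 0)
    (f : (HomotopyCategory.quotient C (ComplexShape.up ℤ)).obj T ⟶
      ((HomotopyCategory.quotient C (ComplexShape.up ℤ)).obj T)⟦i⟧) : f = 0
  /-- Every triangulated subcategory of `K(C)` that contains the objects of `K^b(P(F))` lying in
  `add T` contains `K^b(P(F))`. -/
  generates (Q : ObjectProperty (HomotopyCategory C (ComplexShape.up ℤ))) [Q.IsTriangulated]
    [Q.IsClosedUnderIsomorphisms]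
    (hQ : ∀ K : CochainComplex C ℤ, IsBoundedCpx K → (∀ i, F.IsProj (K.X i)) →
      IsInAdd ((HomotopyCategory.quotient C (ComplexShape.up ℤ)).obj T)
        ((HomotopyCategory.quotient C (ComplexShape.up ℤ)).obj K) →
      Q ((HomotopyCategory.quotient C (ComplexShape.up ℤ)).obj K))
    (K : CochainComplex C ℤ) (hK : IsBoundedCpx K) (hK' : ∀ i, F.IsProj (K.X i)) :
    Q ((HomotopyCategory.quotient C (ComplexShape.up ℤ)).obj K)

/-! ### The relative Igusa-Todorov function -/

/-- The relations defining the group `K_F`: `[N] = [X] + [Y]` if `N ≅ X ⊕ Y`, and `[P] = 0` if `P`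
is `F`-projective. -/
def relations : Set (FreeAbelianGroup C) :=
  {x | ∃ N X Y : C, Nonempty (N ≅ X ⊞ Y) ∧
    x = FreeAbelianGroup.of N - FreeAbelianGroup.of X - FreeAbelianGroup.of Y} ∪
  {x | ∃ P : C, F.IsProj P ∧ x = FreeAbelianGroup.of P}

/-- The abelian group `K_F`. -/
abbrev KGroup := FreeAbelianGroup C ⧸ AddSubgroup.closure F.relations

/-- The class `[M]` in `K_F`. -/
def cls (M : C) : F.KGroup := QuotientAddGroup.mk (FreeAbelianGroup.of M)

lemma cls_eq_add {N X Y : C} (e : N ≅ X ⊞ Y) : F.cls N = F.cls X + F.cls Y := by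
  have h : FreeAbelianGroup.of N - FreeAbelianGroup.of X - FreeAbelianGroup.of Y ∈
      AddSubgroup.closure F.relations :=
    AddSubgroup.subset_closure (Or.inl ⟨N, X, Y, ⟨e⟩, rfl⟩)
  have h' : F.cls N - F.cls X - F.cls Y = 0 := (QuotientAddGroup.eq_zero_iff _).2 h
  rw [← sub_eq_zero, ← h']
  abel

lemma cls_eq_zero {P : C} (hP : F.IsProj P) : F.cls P = 0 :=
  (QuotientAddGroup.eq_zero_iff _).2 (AddSubgroup.subset_closure (Or.inr ⟨P, hP, rfl⟩))

lemma cls_eq_of_isExact {K P K' P' M : C} (i : K ⟶ P) (p : P ⟶ M) (w : i ≫ p = 0)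
    (i' : K' ⟶ P') (p' : P' ⟶ M) (w' : i' ≫ p' = 0)
    (h : F.IsExact (ShortComplex.mk i p w)) (h' : F.IsExact (ShortComplex.mk i' p' w'))
    (hP : F.IsProj P) (hP' : F.IsProj P') : F.cls K = F.cls K' := by
  obtain ⟨s, hs⟩ := hP' _ h p'
  obtain ⟨s', hs'⟩ := hP _ h' p
  obtain ⟨e⟩ := nonempty_iso_pullback i p w h.1 p' s hs
  obtain ⟨e'⟩ := nonempty_iso_pullback i' p' w' h'.1 p s' hs'
  have h₁ := F.cls_eq_add e
  have h₂ := F.cls_eq_add ((pullbackSymmetry p' p) ≪≫ e')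
  rw [F.cls_eq_zero hP', add_zero] at h₁
  rw [F.cls_eq_zero hP, add_zero] at h₂
  rw [← h₁, ← h₂]

lemma isExact_biprod [F.EnoughProj] {K P M K' P' M' N : C} (i : K ⟶ P) (p : P ⟶ M)
    (w : i ≫ p = 0) (i' : K' ⟶ P') (p' : P' ⟶ M') (w' : i' ≫ p' = 0)
    (h : F.IsExact (ShortComplex.mk i p w)) (h' : F.IsExact (ShortComplex.mk i' p' w'))
    (e : M ⊞ M' ≅ N) :
    F.IsExact (ShortComplex.mk (biprod.map i i') (biprod.map p p' ≫ e.hom)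
      (by ext <;> simp [reassoc_of% w, reassoc_of% w'])) := by
  have m : Mono i := h.1.mono_f
  have m' : Mono i' := h'.1.mono_f
  have q : Epi p := h.1.epi_g
  have q' : Epi p' := h'.1.epi_g
  refine F.isExact_of_lift _ (.mk' ?_ inferInstance ?_) ?_
  · rw [ShortComplex.exact_iff_exact_up_to_refinements]
    intro A x hx
    have hx' : x ≫ biprod.map p p' = 0 := by
      exact (cancel_mono e.hom).1 ((Category.assoc _ _ _).trans (hx.trans zero_comp.symm))
    have h₁ : (x ≫ biprod.fst) ≫ p = 0 := by simpa using hx' =≫ biprod.fst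
    have h₂ : (x ≫ biprod.snd) ≫ p' = 0 := by simpa using hx' =≫ biprod.snd
    refine ⟨A, 𝟙 A, inferInstance,
      biprod.lift (h.1.exact.lift _ h₁) (h'.1.exact.lift _ h₂), ?_⟩
    have e₁ := h.1.exact.lift_f _ h₁
    have e₂ := h'.1.exact.lift_f _ h₂
    dsimp at e₁ e₂
    apply biprod.hom_ext
    · simp [e₁]
    · simp [e₂]
  · exact epi_comp _ _
  · intro Q hQ f
    obtain ⟨g, hg⟩ := hQ _ h (f ≫ e.inv ≫ biprod.fst)
    obtain ⟨g', hg'⟩ := hQ _ h' (f ≫ e.inv ≫ biprod.snd)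
    refine ⟨biprod.lift g g', ?_⟩
    dsimp at hg hg'
    rw [← cancel_mono e.inv]
    apply biprod.hom_ext
    · simp [hg]
    · simp [hg']

lemma isProj_biprod {P P' : C} (hP : F.IsProj P) (hP' : F.IsProj P') : F.IsProj (P ⊞ P') := by
  intro S hS f
  obtain ⟨g, hg⟩ := hP S hS (biprod.inl ≫ f)
  obtain ⟨g', hg'⟩ := hP' S hS (biprod.inr ≫ f)
  exact ⟨biprod.desc g g', by ext <;> simp [hg, hg']⟩

/-- A relative syzygy of `M`: the kernel of an `F`-epimorphism onto `M` from an `F`-projective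
object. Its class in `K_F` depends only on `M`, see `omega_cls`. -/
noncomputable def syzygy [F.EnoughProj] (M : C) : C :=
  (EnoughProj.exists_isExact (F := F) M).choose

lemma syzygy_spec [F.EnoughProj] (M : C) :
    ∃ (P : C) (i : F.syzygy M ⟶ P) (p : P ⟶ M) (w : i ≫ p = 0),
      F.IsExact (ShortComplex.mk i p w) ∧ F.IsProj P :=
  (EnoughProj.exists_isExact (F := F) M).choose_spec

lemma cls_syzygy_eq [F.EnoughProj] {K P M : C} (i : K ⟶ P) (p : P ⟶ M) (w : i ≫ p = 0)
    (h : F.IsExact (ShortComplex.mk i p w)) (hP : F.IsProj P) :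
    F.cls (F.syzygy M) = F.cls K := by
  obtain ⟨P', i', p', w', h', hP'⟩ := F.syzygy_spec M
  exact F.cls_eq_of_isExact i' p' w' i p w h' h hP' hP

/-- The endomorphism `Ω_F` of `K_F`, with `Ω_F [M] = [Ω_F M]`. -/
noncomputable def omega [F.EnoughProj] : F.KGroup →+ F.KGroup :=
  QuotientAddGroup.lift _ (FreeAbelianGroup.lift fun M => F.cls (F.syzygy M)) (by
    rw [AddSubgroup.closure_le]
    rintro _ (⟨N, X, Y, ⟨e⟩, rfl⟩ | ⟨Q, hQ, rfl⟩)
    · obtain ⟨P, i, p, w, h, hP⟩ := F.syzygy_spec X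
      obtain ⟨P', i', p', w', h', hP'⟩ := F.syzygy_spec Y
      have h₁ := F.cls_syzygy_eq _ _ _ (F.isExact_biprod i p w i' p' w' h h' e.symm)
        (F.isProj_biprod hP hP')
      rw [F.cls_eq_add (Iso.refl _)] at h₁
      simp [h₁]
    · obtain ⟨P, i, p, w, h, hP⟩ := F.syzygy_spec Q
      obtain ⟨s, hs⟩ := hQ _ h (𝟙 Q)
      obtain ⟨e⟩ := nonempty_iso_pullback i p w h.1 (𝟙 Q) s hs
      have h₁ := F.cls_eq_add ((asIso (pullback.snd (𝟙 Q) p)).symm ≪≫ e)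
      rw [F.cls_eq_zero hP, F.cls_eq_zero hQ, add_zero] at h₁
      simp [← h₁])

lemma omega_cls [F.EnoughProj] {K P M : C} (i : K ⟶ P) (p : P ⟶ M) (w : i ≫ p = 0)
    (h : F.IsExact (ShortComplex.mk i p w)) (hP : F.IsProj P) :
    F.omega (F.cls M) = F.cls K := by
  rw [← F.cls_syzygy_eq i p w h hP]
  exact FreeAbelianGroup.lift_apply_of _ _

/-- The subgroup `⟨M⟩` of `K_F` generated by the classes of the indecomposable non-`F`-projective
direct summands of `M`. -/
def summandSubgroup (M : C) : AddSubgroup F.KGroup :=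
  AddSubgroup.closure {x | ∃ N N' : C, Nonempty (M ≅ N ⊞ N') ∧ Indecomposable N ∧
    ¬ F.IsProj N ∧ x = F.cls N}

/-- The subgroup `Ω_F^m ⟨M⟩` of `K_F`. -/
noncomputable def omegaSubgroup [F.EnoughProj] (M : C) (m : ℕ) : AddSubgroup F.KGroup :=
  (AddSubgroup.map F.omega)^[m] (F.summandSubgroup M)

/-- The relative Igusa-Todorov function `φ_F`: the least `k` such that `Ω_F` restricts to a
bijection `Ω_F^m ⟨M⟩ ⟶ Ω_F^{m+1} ⟨M⟩` for every `m ≥ k` (such a `k` exists whenever `⟨M⟩` is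
finitely generated). -/
noncomputable def phi [F.EnoughProj] (M : C) : ℕ∞ :=
  ⨅ (k : ℕ) (_ : ∀ m : ℕ, k ≤ m →
    Set.BijOn F.omega (F.omegaSubgroup M m) (F.omegaSubgroup M (m + 1))), (k : ℕ∞)

/-- The relative `φ`-dimension: the supremum of `φ_F(M)` over all objects `M`. -/
noncomputable def phiDim [F.EnoughProj] : ℕ∞ := ⨆ M : C, F.phi M

end ExtSubfunctor

section Modules

/-- `A` is an Artin algebra: an algebra over a commutative artinian ring `R` that is finitely
generated as an `R`-module. (One may replace `R` by its image in `A`, so that there is no loss in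
taking `R` in the universe of `A`.) -/
class IsArtinAlgebra (A : Type u) [Ring A] : Prop where
  exists_algebra : ∃ (R : Type u) (_ : CommRing R) (_ : Algebra R A),
    IsArtinianRing R ∧ Module.Finite R A

instance (A : Type u) [Ring A] [IsArtinAlgebra A] : IsNoetherianRing A := by
  obtain ⟨R, _, _, _, _⟩ := IsArtinAlgebra.exists_algebra (A := A)
  have : IsNoetherian R A := isNoetherian_of_isNoetherianRing_of_finite R A
  exact isNoetherian_of_tower R this

/-- The category `A-mod` of finitely generated left `A`-modules. -/
abbrev ModFG (A : Type u) [Ring A] := FGModuleCat.{u} A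

instance (A : Type u) [Ring A] [IsNoetherianRing A] : HasExt.{u + 1} (ModFG A) :=
  HasExt.standard _

instance (A : Type u) [Ring A] [IsNoetherianRing A] :
    (ExtSubfunctor.full (ModFG A)).EnoughProj where
  exists_isExact M := by
    obtain ⟨n, p, hp⟩ := Module.Finite.exists_fin' A M
    let P : ModFG A := FGModuleCat.of A (Fin n → A)
    let p' : P ⟶ M := FGModuleCat.ofHom p
    have : Epi p' := ConcreteCategory.epi_of_surjective p' hp
    refine ⟨kernel p', P, kernel.ι p', p', kernel.condition p',
      (ExtSubfunctor.isExact_full_iff _).2 (.mk' (ShortComplex.exact_kernel p')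
        (inferInstanceAs (Mono (kernel.ι p'))) this), ?_⟩
    intro S hS f
    have : Epi S.g := hS.1.epi_g
    have hg : Function.Surjective S.g.hom.hom :=
      (ModuleCat.epi_iff_surjective _).1
        (inferInstanceAs (Epi ((forget₂ (ModFG A) (ModuleCat A)).map S.g)))
    obtain ⟨g, hg⟩ := Module.projective_lifting_property S.g.hom.hom f.hom.hom hg
    exact ⟨FGModuleCat.ofHom g, FGModuleCat.hom_ext hg⟩

end Modules

end RelDer

/-! A complex `Z` of `F`-projectives determines, in each homological degree `n`, a class in `K_F`:
that of the cokernel of the differential ending in degree `n`. It depends only on `Z` in the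
relative derived category, it is unchanged when a subcomplex of relative projective dimension
less than `n` is divided out, and for the stalk complex of `M` in degree `0` it is `Ω^n [M]` when
`0 ≤ n`. Let `E` be an equivalence that sends the stalks of `F`-projectives to objects of
projective dimension at most `a`, while its inverse has the same property for `b`. If, up to
projectives in smaller degrees, `E` sends the stalk of every `M` to a stalk in degree `a`, then
taking the class of `E M` in degree `a` defines a homomorphism `Φ : K_F ⟶ K_F'` that commutes with
`Ω`, and the homomorphism `Ψ` given by the inverse of `E` in degree `b` satisfies
`Ψ ∘ Φ = Ω^(a + b)`. Hence `φdim F ≤ φdim F' + (a + b)`.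

A tilting complex of term length `t` provides such bounds with `a + b = t`, and the relative
homology of `E M` lives in degrees `≤ a`. Write `E M` as a complex `Z` of projectives. When all
short exact sequences are exact for the target, the terms of `Z` in degrees `≥ a` resolve the
cokernel of `Z_(a+1) ⟶ Z_a`. For a general `F` they need not, since the image of this map need not
give an `F`-exact sequence; but the terms in degrees `≥ a + 2` resolve the kernel of
`Z_(a+1) ⟶ Z_a`, and this accounts for the summand `2`. -/

open scoped ZeroObject

universe v' u'

namespace RelDer

namespace ExtSubfunctor

variable {C : Type u} [Category.{v} C] [Abelian C] [HasExt.{w} C] (F : ExtSubfunctor.{w} C)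

/-- A morphism that factors through an `F`-projective object, i.e. that vanishes in the stable
category of `C` modulo `F`-projectives. -/
def FactorsProj {X Y : C} (f : X ⟶ Y) : Prop :=
  ∃ (Q : C) (a : X ⟶ Q) (b : Q ⟶ Y), F.IsProj Q ∧ a ≫ b = f

variable {F}

namespace FactorsProj

variable {X Y Z : C}

lemma comp_left {f : Y ⟶ Z} (hf : F.FactorsProj f) (g : X ⟶ Y) : F.FactorsProj (g ≫ f) := by
  obtain ⟨Q, a, b, hQ, rfl⟩ := hf
  exact ⟨Q, g ≫ a, b, hQ, by simp⟩

lemma comp_right {f : X ⟶ Y} (hf : F.FactorsProj f) (g : Y ⟶ Z) : F.FactorsProj (f ≫ g) := by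
  obtain ⟨Q, a, b, hQ, rfl⟩ := hf
  exact ⟨Q, a, b ≫ g, hQ, by simp⟩

lemma add {f g : X ⟶ Y} (hf : F.FactorsProj f) (hg : F.FactorsProj g) :
    F.FactorsProj (f + g) := by
  obtain ⟨Q, a, b, hQ, rfl⟩ := hf
  obtain ⟨Q', a', b', hQ', rfl⟩ := hg
  exact ⟨Q ⊞ Q', biprod.lift a a', biprod.desc b b', F.isProj_biprod hQ hQ', by simp⟩

lemma of_src (hX : F.IsProj X) (f : X ⟶ Y) : F.FactorsProj f :=
  ⟨X, 𝟙 X, f, hX, by simp⟩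

lemma of_tgt (hY : F.IsProj Y) (f : X ⟶ Y) : F.FactorsProj f :=
  ⟨Y, f, 𝟙 Y, hY, by simp⟩

end FactorsProj

lemma IsProj.of_retract {X Y : C} (hY : F.IsProj Y) (h : Retract X Y) : F.IsProj X := by
  intro S hS f
  obtain ⟨g, hg⟩ := hY S hS (h.r ≫ f)
  exact ⟨h.i ≫ g, by rw [Category.assoc, hg, h.retract_assoc]⟩

lemma FactorsProj.isProj {X : C} (h : F.FactorsProj (𝟙 X)) : F.IsProj X := by
  obtain ⟨Q, a, b, hQ, h⟩ := h
  exact hQ.of_retract ⟨a, b, h⟩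

lemma isProj_of_isZero {X : C} (h : IsZero X) : F.IsProj X :=
  fun _ _ _ => ⟨0, h.eq_of_src _ _⟩

variable (F) in
lemma cls_biprod (M N : C) : F.cls (M ⊞ N) = F.cls M + F.cls N :=
  F.cls_eq_add (Iso.refl _)

lemma cls_eq_of_retract {M Y : C} (h : Retract M Y) (hs : F.FactorsProj (𝟙 Y - h.r ≫ h.i)) :
    F.cls Y = F.cls M := by
  let σ : (ShortComplex.mk (kernel.ι h.r) h.r (kernel.condition _)).Splitting :=
    .ofExactOfSection _ (ShortComplex.exact_kernel h.r) h.i h.retract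
      (inferInstanceAs (Mono (kernel.ι h.r)))
  have hK : F.IsProj (kernel h.r) := by
    have : kernel.ι h.r ≫ (𝟙 Y - h.r ≫ h.i) ≫ σ.r = 𝟙 _ := by
      simpa using σ.f_r
    exact FactorsProj.isProj (this ▸ (hs.comp_right _).comp_left _)
  rw [F.cls_eq_add σ.isoBinaryBiproduct]
  exact (congrArg (· + _) (F.cls_eq_zero hK)).trans (zero_add _)

lemma cls_eq_of_stable_iso {M N : C} (f : M ⟶ N) (g : N ⟶ M)
    (h₁ : F.FactorsProj (𝟙 M - f ≫ g)) (h₂ : F.FactorsProj (𝟙 N - g ≫ f)) :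
    F.cls M = F.cls N := by
  obtain ⟨Q, a, b, hQ, hab⟩ := h₁
  let ρ : Retract M (N ⊞ Q) := ⟨biprod.lift f a, biprod.desc g b, by simp [hab]⟩
  have hρ : F.FactorsProj (𝟙 (N ⊞ Q) - ρ.r ≫ ρ.i) := by
    have : 𝟙 (N ⊞ Q) - ρ.r ≫ ρ.i =
        biprod.fst ≫ (𝟙 N - g ≫ f) ≫ biprod.inl + (biprod.snd ≫ (biprod.inr - b ≫ ρ.i) +
          (-(biprod.fst ≫ g ≫ a)) ≫ biprod.inr) := by
      ext <;> simp [ρ]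
    rw [this]
    exact ((h₂.comp_right _).comp_left _).add
      (((FactorsProj.of_src hQ _).comp_left _).add ((FactorsProj.of_tgt hQ _).comp_right _))
  rw [← cls_eq_of_retract ρ hρ, F.cls_biprod, F.cls_eq_zero hQ, add_zero]

variable (F) in
lemma factorsProj_zero (X Y : C) : F.FactorsProj (0 : X ⟶ Y) :=
  ⟨0, 0, 0, isProj_of_isZero (isZero_zero C), by simp⟩

lemma exists_eq_cls_sub_cls (x : F.KGroup) : ∃ M N : C, x = F.cls M - F.cls N := by
  obtain ⟨x, rfl⟩ := QuotientAddGroup.mk_surjective x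
  have h0 : F.cls (0 : C) = 0 := F.cls_eq_zero (isProj_of_isZero (isZero_zero C))
  induction x using FreeAbelianGroup.induction_on with
  | zero => exact ⟨0, 0, by simp [h0]⟩
  | of M => exact ⟨M, 0, by rw [h0, sub_zero]; rfl⟩
  | neg M _ => exact ⟨0, M, by rw [h0, zero_sub]; rfl⟩
  | add x y hx hy =>
    obtain ⟨M, N, h⟩ := hx
    obtain ⟨M', N', h'⟩ := hy
    refine ⟨M ⊞ M', N ⊞ N', ?_⟩
    rw [QuotientAddGroup.mk_add, h, h', cls_biprod, cls_biprod]
    abel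

lemma kGroup_hom_ext {G : Type*} [AddCommGroup G] {f g : F.KGroup →+ G}
    (h : ∀ M, f (F.cls M) = g (F.cls M)) : f = g := by
  refine DFunLike.ext _ _ fun x => ?_
  obtain ⟨M, N, rfl⟩ := exists_eq_cls_sub_cls x
  simp [h]

variable (F) in
/-- The homomorphism on `K_F` induced by an additive invariant of objects that vanishes on
`F`-projectives. -/
noncomputable def kGroupLift {G : Type*} [AddCommGroup G] (c : C → G)
    (hadd : ∀ N X Y : C, (N ≅ X ⊞ Y) → c N = c X + c Y) (hproj : ∀ P, F.IsProj P → c P = 0) :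
    F.KGroup →+ G :=
  QuotientAddGroup.lift _ (FreeAbelianGroup.lift c) (by
    rw [AddSubgroup.closure_le]
    rintro _ (⟨N, X, Y, ⟨e⟩, rfl⟩ | ⟨Q, hQ, rfl⟩)
    · simp [hadd _ _ _ e]
    · simp [hproj _ hQ])

lemma kGroupLift_cls {G : Type*} [AddCommGroup G] (c : C → G)
    (hadd : ∀ N X Y : C, (N ≅ X ⊞ Y) → c N = c X + c Y) (hproj : ∀ P, F.IsProj P → c P = 0)
    (M : C) : F.kGroupLift c hadd hproj (F.cls M) = c M :=
  FreeAbelianGroup.lift_apply_of _ _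

section Phi

variable (F) [F.EnoughProj]

lemma mem_omegaSubgroup_iff (M : C) (m : ℕ) (x : F.KGroup) :
    x ∈ F.omegaSubgroup M m ↔ ∃ y ∈ F.summandSubgroup M, F.omega^[m] y = x := by
  induction m generalizing x with
  | zero => simp [omegaSubgroup]
  | succ m ih =>
    rw [omegaSubgroup, Function.iterate_succ_apply']
    simp only [Function.iterate_succ_apply', AddSubgroup.mem_map]
    constructor
    · rintro ⟨z, hz, rfl⟩
      obtain ⟨y, hy, rfl⟩ := (ih z).1 hz
      exact ⟨y, hy, rfl⟩
    · rintro ⟨y, hy, rfl⟩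
      exact ⟨_, (ih _).2 ⟨y, hy, rfl⟩, rfl⟩

lemma bijOn_omegaSubgroup (M : C) {n m : ℕ} (hm : n ≤ m)
    (h : ∀ x : F.KGroup, F.omega^[n + 1] x = 0 → F.omega^[n] x = 0) :
    Set.BijOn F.omega (F.omegaSubgroup M m) (F.omegaSubgroup M (m + 1)) := by
  refine ⟨fun x hx => ?_, fun x hx x' hx' hxx => ?_, fun x hx => ?_⟩
  · obtain ⟨y, hy, rfl⟩ := (F.mem_omegaSubgroup_iff M m x).1 hx
    exact (F.mem_omegaSubgroup_iff M (m + 1) _).2 ⟨y, hy, Function.iterate_succ_apply' _ _ _⟩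
  · obtain ⟨y, -, rfl⟩ := (F.mem_omegaSubgroup_iff M m x).1 hx
    obtain ⟨y', -, rfl⟩ := (F.mem_omegaSubgroup_iff M m x').1 hx'
    obtain ⟨k, rfl⟩ := Nat.exists_eq_add_of_le hm
    rw [← sub_eq_zero, ← iterate_map_sub, Function.iterate_add_apply]
    apply h
    rw [← Function.iterate_add_apply, show n + 1 + k = (n + k) + 1 by ring,
      Function.iterate_succ_apply', iterate_map_sub, map_sub, sub_eq_zero]
    exact hxx
  · obtain ⟨y, hy, rfl⟩ := (F.mem_omegaSubgroup_iff M (m + 1) x).1 hx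
    exact ⟨F.omega^[m] y, (F.mem_omegaSubgroup_iff M m _).2 ⟨y, hy, rfl⟩,
      (Function.iterate_succ_apply' _ _ _).symm⟩

lemma phiDim_le_of_omega_iterate (n : ℕ)
    (h : ∀ x : F.KGroup, F.omega^[n + 1] x = 0 → F.omega^[n] x = 0) : F.phiDim ≤ n :=
  iSup_le fun M => iInf₂_le n fun _ hm => F.bijOn_omegaSubgroup M hm h

lemma omega_iterate_eq_zero_of_phiDim_le {n : ℕ} (h : F.phiDim ≤ n) {M : C} {x : F.KGroup}
    (hM : x ∈ F.summandSubgroup M) (hx : F.omega^[n + 1] x = 0) : F.omega^[n] x = 0 := by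
  have h₁ : F.phi M < (n + 1 : ℕ) :=
    lt_of_le_of_lt ((le_iSup _ M).trans h) (by exact_mod_cast Nat.lt_succ_self n)
  simp only [phi, iInf_lt_iff] at h₁
  obtain ⟨k, hk, hkn⟩ := h₁
  have hkn' : k ≤ n := Nat.lt_succ_iff.1 (by exact_mod_cast hkn)
  refine (hk n hkn').injOn ((F.mem_omegaSubgroup_iff M n _).2 ⟨x, hM, rfl⟩)
    (zero_mem _) ?_
  rw [map_zero, ← Function.iterate_succ_apply' F.omega]
  exact hx

end Phi

end ExtSubfunctor

section Decomposition

variable {C : Type u} [Category.{v} C] [Abelian C]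

lemma subobject_mk_inl_lt {M K N N₁ N₂ : C} (e : M ≅ K ⊞ N) (e' : N ≅ N₁ ⊞ N₂)
    (h : ¬ IsZero N₁) :
    Subobject.mk (biprod.inl ≫ e.inv) < Subobject.mk (biprod.inl ≫
      (e ≪≫ biprod.mapIso (Iso.refl K) e' ≪≫ (biprod.associator K N₁ N₂).symm).inv) := by
  set j := biprod.inl ≫
    (e ≪≫ biprod.mapIso (Iso.refl K) e' ≪≫ (biprod.associator K N₁ N₂).symm).inv with hj
  have hj₁ : biprod.inl ≫ j = biprod.inl ≫ e.inv := by
    rw [← cancel_mono e.hom]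
    ext <;> simp [hj, biprod.lift_eq]
  have hj₂ : biprod.inr ≫ j ≫ e.hom ≫ biprod.snd ≫ e'.hom ≫ biprod.fst = 𝟙 N₁ := by simp [hj]
  refine lt_of_le_not_ge (Subobject.mk_le_mk_of_comm biprod.inl hj₁) fun hle => h ?_
  obtain ⟨g, hg⟩ : ∃ g, g ≫ biprod.inl ≫ e.inv = j := ⟨_, Subobject.ofMkLEMk_comp hle⟩
  rw [IsZero.iff_id_eq_zero, ← hj₂, ← hg]
  simp

namespace ExtSubfunctor

variable [HasExt.{w} C] (F : ExtSubfunctor.{w} C)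

lemma summandSubgroup_le_of_iso {M N N' : C} (e : M ≅ N ⊞ N') :
    F.summandSubgroup N ≤ F.summandSubgroup M := by
  refine AddSubgroup.closure_mono ?_
  rintro _ ⟨X, X', ⟨e'⟩, hX, hX', rfl⟩
  exact ⟨X, X' ⊞ N', ⟨e ≪≫ biprod.mapIso e' (Iso.refl N') ≪≫ biprod.associator _ _ _⟩, hX, hX',
    rfl⟩

lemma cls_mem_summandSubgroup (M : C) [IsNoetherianObject M] :
    F.cls M ∈ F.summandSubgroup M := by
  suffices ∀ (S : Subobject M) (K N : C) (e : M ≅ K ⊞ N),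
      Subobject.mk (biprod.inl ≫ e.inv) = S → F.cls N ∈ F.summandSubgroup M from
    this _ 0 M (isoZeroBiprod (isZero_zero C)) rfl
  intro S
  induction S using WellFoundedGT.induction with
  | _ S ih =>
    rintro K N e rfl
    by_cases hN : F.IsProj N
    · simp only [F.cls_eq_zero hN, zero_mem]
    by_cases hN' : Indecomposable N
    · exact AddSubgroup.subset_closure ⟨N, K, ⟨e ≪≫ biprod.braiding K N⟩, hN', hN, rfl⟩
    have hN₀ : ¬ IsZero N := fun h => hN (isProj_of_isZero h)
    simp only [Indecomposable, not_and, not_forall, not_or] at hN'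
    obtain ⟨N₁, N₂, e', h₁, h₂⟩ := hN' hN₀
    rw [F.cls_eq_add e']
    exact add_mem
      (ih _ (subobject_mk_inl_lt e (e' ≪≫ biprod.braiding N₁ N₂) h₂) _ _ _ rfl)
      (ih _ (subobject_mk_inl_lt e e' h₁) _ _ _ rfl)

lemma exists_mem_summandSubgroup [∀ M : C, IsNoetherianObject M] (x : F.KGroup) :
    ∃ M, x ∈ F.summandSubgroup M := by
  obtain ⟨M, N, rfl⟩ := exists_eq_cls_sub_cls x
  exact ⟨M ⊞ N, sub_mem
    (F.summandSubgroup_le_of_iso (Iso.refl (M ⊞ N)) (F.cls_mem_summandSubgroup M))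
    (F.summandSubgroup_le_of_iso (biprod.braiding M N) (F.cls_mem_summandSubgroup N))⟩

end ExtSubfunctor

end Decomposition

section ModFG

variable {R : Type u} [Ring R] [IsNoetherianRing R]

lemma range_le_range_iff_le {M : ModFG R} (S T : Subobject M) :
    LinearMap.range S.arrow.hom.hom ≤ LinearMap.range T.arrow.hom.hom ↔ S ≤ T := by
  constructor
  · intro h
    have hT : Function.Injective T.arrow.hom.hom :=
      (ModuleCat.mono_iff_injective _).1
        (inferInstanceAs (Mono ((forget₂ (ModFG R) (ModuleCat R)).map T.arrow)))
    let g := (LinearEquiv.ofInjective _ hT).symm.toLinearMap ∘ₗ Submodule.inclusion h ∘ₗ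
      S.arrow.hom.hom.rangeRestrict
    refine Subobject.le_of_comm (FGModuleCat.ofHom g) (FGModuleCat.hom_ext ?_)
    ext x
    exact congr_arg Subtype.val ((LinearEquiv.ofInjective _ hT).apply_symm_apply _)
  · intro h
    rw [← Subobject.ofLE_arrow h]
    exact LinearMap.range_comp_le_range _ _

instance (M : ModFG R) : IsNoetherianObject M where
  prop := StrictMono.wellFoundedGT (f := fun S : Subobject M => LinearMap.range S.arrow.hom.hom)
    fun S T h => lt_of_le_not_ge ((range_le_range_iff_le S T).2 h.le)
      fun h' => h.not_ge ((range_le_range_iff_le T S).1 h')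

end ModFG

open Pretriangulated Triangulated ObjectProperty

section Orth

variable {D : Type u} [Category.{v} D] [Preadditive D]

/-- There is no nonzero morphism `X ⟶ Y`. -/
def Orth (X Y : D) : Prop := ∀ f : X ⟶ Y, f = 0

namespace Orth

variable {X X' Y Y' : D}

lemma of_retract_left (h : Orth X Y) (ρ : Retract X' X) : Orth X' Y := fun f => by
  rw [← Category.id_comp f, ← ρ.retract, Category.assoc, h (ρ.r ≫ f), comp_zero]

lemma of_retract_right (h : Orth X Y) (ρ : Retract Y' Y) : Orth X Y' := fun f => by
  rw [← Category.comp_id f, ← ρ.retract, ← Category.assoc, h (f ≫ ρ.i), zero_comp]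

lemma of_iso_left (h : Orth X Y) (e : X' ≅ X) : Orth X' Y := h.of_retract_left e.retract

lemma of_iso_right (h : Orth X Y) (e : Y' ≅ Y) : Orth X Y' := h.of_retract_right e.retract

variable [HasShift D ℤ] [∀ n : ℤ, (shiftFunctor D n).Additive]

lemma shift (h : Orth X Y) (n : ℤ) : Orth (X⟦n⟧) (Y⟦n⟧) := fun f => by
  obtain ⟨g, rfl⟩ := (shiftFunctor D n).map_surjective f
  rw [h g, Functor.map_zero]

lemma of_shift (n : ℤ) (h : Orth (X⟦n⟧) (Y⟦n⟧)) : Orth X Y := fun f =>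
  (shiftFunctor D n).map_injective (by rw [h (f⟦n⟧'), Functor.map_zero])

lemma shift_iff (X Y : D) (n m k : ℤ) (hk : m = n + k) :
    Orth (X⟦n⟧) (Y⟦m⟧) ↔ Orth X (Y⟦k⟧) := by
  have e : Y⟦m⟧ ≅ (Y⟦k⟧)⟦n⟧ := (shiftFunctorAdd' D k n m (by lia)).app Y
  exact ⟨fun h => .of_shift n (h.of_iso_right e.symm), fun h => (h.shift n).of_iso_right e⟩

lemma shift_left_iff (X Y : D) (n m k : ℤ) (hk : m = n + k) :
    Orth (X⟦m⟧) (Y⟦n⟧) ↔ Orth (X⟦k⟧) Y := by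
  have e : X⟦m⟧ ≅ (X⟦k⟧)⟦n⟧ := (shiftFunctorAdd' D k n m (by lia)).app X
  exact ⟨fun h => .of_shift n (h.of_iso_left e.symm), fun h => (h.shift n).of_iso_left e⟩

end Orth

end Orth

section Triangulated

variable {D : Type u} [Category.{v} D] [Preadditive D] [HasZeroObject D] [HasShift D ℤ]
  [∀ n : ℤ, (shiftFunctor D n).Additive] [Pretriangulated D]

/-- The triangle `X ⟶ Y ⟶ Z ⟶ X⟦1⟧` is distinguished. -/
def DistTriang {X Y Z : D} (f : X ⟶ Y) (g : Y ⟶ Z) (h : Z ⟶ X⟦(1 : ℤ)⟧) : Prop :=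
  Triangle.mk f g h ∈ distTriang D

namespace DistTriang

lemma exists_cone {X Y : D} (f : X ⟶ Y) :
    ∃ (Z : D) (g : Y ⟶ Z) (h : Z ⟶ X⟦(1 : ℤ)⟧), DistTriang f g h :=
  distinguished_cocone_triangle f

lemma of_rotate {X Y Z : D} {f : X ⟶ Y} {g : Y ⟶ Z} {h : Z ⟶ X⟦(1 : ℤ)⟧}
    (hT : DistTriang g h (f⟦(1 : ℤ)⟧')) : DistTriang (-f) g h := by
  refine (rotate_distinguished_triangle _).2 ?_
  change DistTriang g h (-(-f)⟦(1 : ℤ)⟧')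
  rwa [Functor.map_neg, neg_neg]

lemma exists_of_rotate {X Y Z : D} {f : X⟦(1 : ℤ)⟧ ⟶ Y⟦(1 : ℤ)⟧} {g : Y ⟶ Z}
    {h : Z ⟶ X⟦(1 : ℤ)⟧} (hT : DistTriang g h f) : ∃ f' : X ⟶ Y, DistTriang f' g h := by
  obtain ⟨f', rfl⟩ := (shiftFunctor D (1 : ℤ)).map_surjective f
  exact ⟨_, hT.of_rotate⟩

variable {X Y Z W : D} {f : X ⟶ Y} {g : Y ⟶ Z} {h : Z ⟶ X⟦(1 : ℤ)⟧} (hT : DistTriang f g h)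

include hT

lemma of_iso {X' Y' Z' : D} {f' : X' ⟶ Y'} {g' : Y' ⟶ Z'} {h' : Z' ⟶ X'⟦(1 : ℤ)⟧}
    (e₁ : X' ≅ X) (e₂ : Y' ≅ Y) (e₃ : Z' ≅ Z) (c₁ : f' ≫ e₂.hom = e₁.hom ≫ f)
    (c₂ : g' ≫ e₃.hom = e₂.hom ≫ g) (c₃ : h' ≫ e₁.hom⟦(1 : ℤ)⟧' = e₃.hom ≫ h) :
    DistTriang f' g' h' :=
  isomorphic_distinguished _ hT _ (Triangle.isoMk _ _ e₁ e₂ e₃ c₁ c₂ c₃)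

lemma comp₁₂ : f ≫ g = 0 := comp_distTriang_mor_zero₁₂ _ hT

lemma comp₂₃ : g ≫ h = 0 := comp_distTriang_mor_zero₂₃ _ hT

lemma comp₃₁ : h ≫ f⟦(1 : ℤ)⟧' = 0 := comp_distTriang_mor_zero₃₁ _ hT

lemma rotate : DistTriang g h (-f⟦(1 : ℤ)⟧') := rot_of_distTriang _ hT

lemma lift₂ (a : W ⟶ Y) (ha : a ≫ g = 0) : ∃ b : W ⟶ X, b ≫ f = a := by
  obtain ⟨b, hb⟩ := Triangle.coyoneda_exact₂ _ hT a ha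
  exact ⟨b, hb.symm⟩

lemma lift₃ (a : W ⟶ Z) (ha : a ≫ h = 0) : ∃ b : W ⟶ Y, b ≫ g = a := by
  obtain ⟨b, hb⟩ := Triangle.coyoneda_exact₃ _ hT a ha
  exact ⟨b, hb.symm⟩

lemma lift₁ (a : W ⟶ X⟦(1 : ℤ)⟧) (ha : a ≫ f⟦(1 : ℤ)⟧' = 0) : ∃ b : W ⟶ Z, b ≫ h = a := by
  obtain ⟨b, hb⟩ := Triangle.coyoneda_exact₁ _ hT a ha
  exact ⟨b, hb.symm⟩

lemma desc₂ (a : Y ⟶ W) (ha : f ≫ a = 0) : ∃ b : Z ⟶ W, g ≫ b = a := by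
  obtain ⟨b, hb⟩ := Triangle.yoneda_exact₂ _ hT a ha
  exact ⟨b, hb.symm⟩

lemma desc₃ (a : Z ⟶ W) (ha : g ≫ a = 0) : ∃ b : X⟦(1 : ℤ)⟧ ⟶ W, h ≫ b = a := by
  obtain ⟨b, hb⟩ := Triangle.yoneda_exact₃ _ hT a ha
  exact ⟨b, hb.symm⟩

lemma desc₁ (a : X ⟶ W) (ha : h ≫ a⟦(1 : ℤ)⟧' = 0) : ∃ b : Y ⟶ W, f ≫ b = a := by
  obtain ⟨b, hb⟩ := hT.rotate.desc₃ _ ha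
  obtain ⟨b, rfl⟩ := (shiftFunctor D (1 : ℤ)).map_surjective b
  refine ⟨-b, (shiftFunctor D (1 : ℤ)).map_injective ?_⟩
  rw [← hb]
  simp

lemma isIso₁_of_isZero (hZ : IsZero Z) : IsIso f :=
  (Triangle.isZero₃_iff_isIso₁ _ hT).1 hZ

lemma cone_iso {Z' : D} {g' : Y ⟶ Z'} {h' : Z' ⟶ X⟦(1 : ℤ)⟧} (hT' : DistTriang f g' h') :
    Nonempty (Z ≅ Z') :=
  ⟨Triangle.π₃.mapIso (isoTriangleOfIso₁₂ _ _ hT hT' (Iso.refl _) (Iso.refl _)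
    ((Category.comp_id _).trans (Category.id_comp _).symm))⟩

lemma exists_shift (n : ℤ) : ∃ h' : Z⟦n⟧ ⟶ X⟦n⟧⟦(1 : ℤ)⟧, DistTriang (f⟦n⟧') (g⟦n⟧') h' := by
  have hε : n.negOnePow * n.negOnePow = 1 := Int.units_mul_self _
  let e (W : D) : W ≅ W := ⟨n.negOnePow • 𝟙 W, n.negOnePow • 𝟙 W,
    by simp [smul_smul, hε], by simp [smul_smul, hε]⟩
  obtain ⟨k, hk⟩ : ∃ k : Z⟦n⟧ ⟶ X⟦n⟧⟦(1 : ℤ)⟧,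
      DistTriang (n.negOnePow • f⟦n⟧') (n.negOnePow • g⟦n⟧') k :=
    ⟨_, Triangle.shift_distinguished _ hT n⟩
  refine ⟨(e _).hom ≫ k ≫ (e _).inv⟦(1 : ℤ)⟧', hk.of_iso (e _) (Iso.refl _) (e _) ?_ ?_ ?_⟩
  · simp [e, smul_smul, hε]
  · simp [e]
  · simp [← Functor.map_comp]

lemma exists_swap (h₀ : h = 0) :
    ∃ (f' : Z ⟶ Y) (g' : Y ⟶ X) (h' : X ⟶ Z⟦(1 : ℤ)⟧), DistTriang f' g' h' := by
  obtain ⟨e⟩ : Nonempty (Y ≅ X ⊞ Z) :=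
    ⟨(exists_iso_binaryBiproduct_of_distTriang _ hT h₀).choose⟩
  have hT' : DistTriang (biprod.inl : Z ⟶ Z ⊞ X) biprod.snd 0 :=
    binaryBiproductTriangle_distinguished Z X
  refine ⟨biprod.inr ≫ e.inv, e.hom ≫ biprod.fst, 0, hT'.of_iso (Iso.refl _)
    (e ≪≫ biprod.braiding _ _) (Iso.refl _) ?_ ?_ ?_⟩
  · ext <;> simp
  · simp
  · simp

lemma octahedron [IsTriangulated D] {B : D} {u : Y ⟶ W} {u₁ : W ⟶ B} {u₂ : B ⟶ Y⟦(1 : ℤ)⟧}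
    (hu : DistTriang u u₁ u₂) :
    ∃ (E : D) (c : W ⟶ E) (d : E ⟶ X⟦(1 : ℤ)⟧) (a : Z ⟶ E) (b : E ⟶ B),
      DistTriang (f ≫ u) c d ∧ DistTriang a b (u₂ ≫ g⟦(1 : ℤ)⟧') := by
  obtain ⟨E, c, d, hE⟩ := exists_cone (f ≫ u)
  let o := someOctahedron rfl hT hu hE
  exact ⟨E, c, d, o.m₁, o.m₃, hE, o.mem⟩

end DistTriang

variable {S Q : ObjectProperty D}

/-- The extension closure of a class of objects: the smallest class of objects that contains it
and the zero objects and is closed under extensions. -/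
inductive ExtClosure (S : ObjectProperty D) : ObjectProperty D
  | of (X : D) (h : S X) : ExtClosure S X
  | zero (X : D) (h : IsZero X) : ExtClosure S X
  | ext (T : Triangle D) (hT : T ∈ distTriang D) (h₁ : ExtClosure S T.obj₁)
      (h₃ : ExtClosure S T.obj₃) : ExtClosure S T.obj₂

instance : (ExtClosure S).IsClosedUnderIsomorphisms where
  of_iso {X Y} e h := by
    have hT : DistTriang e.hom (0 : Y ⟶ 0) 0 :=
      DistTriang.of_iso (contractible_distinguished X) (Iso.refl _) e.symm (Iso.refl _)
        (by simp) (by simp) (by simp)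
    exact ExtClosure.ext _ hT h (.zero _ (isZero_zero D))

instance : (ExtClosure S).IsTriangulatedClosed₂ := .mk' fun T hT h₁ h₃ => .ext T hT h₁ h₃

instance : (ExtClosure S).ContainsZero := ⟨⟨0, isZero_zero D, .zero _ (isZero_zero D)⟩⟩

lemma extClosure_le [Q.IsClosedUnderIsomorphisms] [Q.IsTriangulatedClosed₂] [Q.ContainsZero]
    (h : S ≤ Q) : ExtClosure S ≤ Q := by
  intro X hX
  induction hX with
  | of X hX => exact h _ hX
  | zero X hX => exact Q.prop_of_isZero hX
  | ext T hT _ _ h₁ h₃ => exact Q.ext_of_isTriangulatedClosed₂ T hT h₁ h₃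

lemma DistTriang.orth_right {X Y Z W : D} {f : X ⟶ Y} {g : Y ⟶ Z} {h : Z ⟶ X⟦(1 : ℤ)⟧}
    (hT : DistTriang f g h) (h₁ : Orth W X) (h₃ : Orth W Z) : Orth W Y := fun a => by
  obtain ⟨b, rfl⟩ := hT.lift₂ a (h₃ _)
  rw [h₁ b, zero_comp]

lemma DistTriang.orth_left {X Y Z W : D} {f : X ⟶ Y} {g : Y ⟶ Z} {h : Z ⟶ X⟦(1 : ℤ)⟧}
    (hT : DistTriang f g h) (h₁ : Orth X W) (h₃ : Orth Z W) : Orth Y W := fun a => by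
  obtain ⟨b, rfl⟩ := hT.desc₂ a (h₁ _)
  rw [h₃ b, comp_zero]

lemma DistTriang.orth_of_bijective {X Y Z A : D} {f : X ⟶ Y} {g : Y ⟶ Z} {h : Z ⟶ X⟦(1 : ℤ)⟧}
    (hT : DistTriang f g h)
    (hf : ∀ k : ℤ, Function.Bijective fun x : A⟦k⟧ ⟶ X => x ≫ f) (k : ℤ) : Orth (A⟦k⟧) Z := by
  intro x
  have e : A⟦k⟧ ≅ A⟦k - 1⟧⟦(1 : ℤ)⟧ := (shiftFunctorAdd' D (k - 1) 1 k (by lia)).app _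
  have hxh : x ≫ h = 0 := by
    obtain ⟨y, hy⟩ := (shiftFunctor D (1 : ℤ)).map_surjective (e.inv ≫ x ≫ h)
    have hyf : y ≫ f = 0 := (shiftFunctor D (1 : ℤ)).map_injective (by simp [hy, hT.comp₃₁])
    have hy₀ : y = 0 := (hf (k - 1)).1 (hyf.trans zero_comp.symm)
    rw [← cancel_epi e.inv, ← hy, hy₀, Functor.map_zero, comp_zero]
  obtain ⟨y, rfl⟩ := hT.lift₃ x hxh
  obtain ⟨z, rfl⟩ := (hf k).2 y
  simp [hT.comp₁₂]

lemma ExtClosure.orth_left {X Y : D} (hX : ExtClosure S X) (h : ∀ X, S X → Orth X Y) :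
    Orth X Y := by
  induction hX with
  | of X hX => exact h _ hX
  | zero X hX => exact fun f => hX.eq_of_src _ _
  | ext T hT _ _ h₁ h₃ => exact DistTriang.orth_left hT h₁ h₃

lemma ExtClosure.orth_right {X Y : D} (hY : ExtClosure S Y) (h : ∀ Y, S Y → Orth X Y) :
    Orth X Y := by
  induction hY with
  | of X hX => exact h _ hX
  | zero X hX => exact fun f => hX.eq_of_tgt _ _
  | ext T hT _ _ h₁ h₃ => exact DistTriang.orth_right hT h₁ h₃

lemma isTriangulatedClosed₂_extensionProduct [IsTriangulated D] (P W : ObjectProperty D)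
    [P.IsClosedUnderIsomorphisms] [P.IsTriangulatedClosed₂]
    [W.IsClosedUnderIsomorphisms] [W.IsTriangulatedClosed₂]
    (h : ∀ X Y, P X → W Y → Orth X (Y⟦(1 : ℤ)⟧)) :
    (extensionProduct P W).IsTriangulatedClosed₂ := by
  have swap : extensionProduct W P ≤ extensionProduct P W := by
    rintro X ⟨A, B, f, g, k, hT, hA, hB⟩
    obtain ⟨f', g', k', hT'⟩ := DistTriang.exists_swap hT (h _ _ hB hA _)
    exact ⟨_, _, f', g', k', hT', hB, hA⟩
  have hP : extensionProduct P P ≤ P :=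
    extensionProduct_le_of_isTriangulatedClosed₂ le_rfl le_rfl
  have hW : extensionProduct W W ≤ W :=
    extensionProduct_le_of_isTriangulatedClosed₂ le_rfl le_rfl
  refine .mk' fun T hT h₁ h₃ => ?_
  -- `(P * W) * (P * W) = P * (W * P) * W ≤ P * (P * W) * W = (P * P) * (W * W) ≤ P * W`
  have h₂ : extensionProduct (extensionProduct P W) (extensionProduct P W) T.obj₂ :=
    ⟨_, _, T.mor₁, T.mor₂, T.mor₃, hT, h₁, h₃⟩
  rw [extensionProduct_assoc, ← extensionProduct_assoc W] at h₂
  have h₄ := monotone_extensionProduct_right P (monotone_extensionProduct_left W swap) _ h₂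
  rw [extensionProduct_assoc, ← extensionProduct_assoc P] at h₄
  exact monotone_extensionProduct_left _ hP _ (monotone_extensionProduct_right _ hW _ h₄)

lemma containsZero_extensionProduct (P W : ObjectProperty D) [P.ContainsZero] [W.ContainsZero] :
    (extensionProduct P W).ContainsZero := by
  obtain ⟨Z, hZ, hPZ⟩ := exists_prop_of_containsZero P
  exact ⟨⟨Z, hZ, le_extensionProduct_left _ _ hPZ⟩⟩

end Triangulated

section Stalks

variable {C : Type u} [Category.{v} C] {D : Type u'} [Category.{v'} D] [HasShift D ℤ]

/-- The objects isomorphic to `s(M)⟦n⟧` for some `M` satisfying `P` and some `n` satisfying `I`;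
for `s` the stalk complex functor, these are stalk complexes. -/
def stalks (s : C ⥤ D) (P : ObjectProperty C) (I : ℤ → Prop) : ObjectProperty D :=
  fun X => ∃ (M : C) (n : ℤ), P M ∧ I n ∧ Nonempty (X ≅ (s.obj M)⟦n⟧)

variable {s : C ⥤ D} {P : ObjectProperty C} {I : ℤ → Prop}

lemma stalks_obj {M : C} {n : ℤ} (hM : P M) (hn : I n) : stalks s P I ((s.obj M)⟦n⟧) :=
  ⟨M, n, hM, hn, ⟨Iso.refl _⟩⟩

instance : (stalks s P I).IsClosedUnderIsomorphisms where
  of_iso := by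
    rintro X Y e ⟨M, n, hM, hn, ⟨e'⟩⟩
    exact ⟨M, n, hM, hn, ⟨e.symm ≪≫ e'⟩⟩

variable [Preadditive D] [HasZeroObject D] [∀ n : ℤ, (shiftFunctor D n).Additive]
  [Pretriangulated D]

namespace ExtClosure

lemma orth_left_of_stalks {X Y : D} (hX : ExtClosure (stalks s P I) X)
    (h : ∀ (M : C) (n : ℤ), P M → I n → Orth ((s.obj M)⟦n⟧) Y) : Orth X Y := by
  refine hX.orth_left ?_
  rintro _ ⟨M, n, hM, hn, ⟨e⟩⟩
  exact (h M n hM hn).of_iso_left e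

lemma orth_right_of_stalks {X Y : D} (hY : ExtClosure (stalks s P I) Y)
    (h : ∀ (M : C) (n : ℤ), P M → I n → Orth X ((s.obj M)⟦n⟧)) : Orth X Y := by
  refine hY.orth_right ?_
  rintro _ ⟨M, n, hM, hn, ⟨e⟩⟩
  exact (h M n hM hn).of_iso_right e

end ExtClosure

end Stalks

section StalkFunctor

variable {C : Type u} [Category.{v} C] [Abelian C] [HasExt.{w} C] (F : ExtSubfunctor.{w} C)
  {D : Type u'} [Category.{v'} D] [Preadditive D] [HasZeroObject D] [HasShift D ℤ]
  [∀ n : ℤ, (shiftFunctor D n).Additive] [Pretriangulated D]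

/-- The properties of the stalk complex functor from `C` to the relative bounded derived category
of `F` from which the comparison of `φ`-dimensions is derived. -/
structure IsStalkFunctor (s : C ⥤ D) : Prop where
  exists_distTriang {X Y Z : C} (i : X ⟶ Y) (p : Y ⟶ Z) (w : i ≫ p = 0)
    (hE : F.IsExact (ShortComplex.mk i p w)) :
    ∃ δ : s.obj Z ⟶ (s.obj X)⟦(1 : ℤ)⟧, DistTriang (s.map i) (s.map p) δ
  map_bijective (Q N : C) (hQ : F.IsProj Q) : Function.Bijective (s.map : (Q ⟶ N) → _)
  orth (Q N : C) (hQ : F.IsProj Q) (n : ℤ) (hn : n ≠ 0) : Orth (s.obj Q) ((s.obj N)⟦n⟧)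
  orth_of_proj (Z : D) (n : ℤ) (h : ∀ Q, F.IsProj Q → ∀ k, n ≤ k → Orth ((s.obj Q)⟦k⟧) Z)
    (M : C) : Orth ((s.obj M)⟦n⟧) Z
  generates (Z : D) : ExtClosure (stalks s ⊤ fun _ => True) Z

namespace IsStalkFunctor

variable {F} {s : C ⥤ D} (h : IsStalkFunctor F s)

include h

lemma proj_orth {Q N : C} (hQ : F.IsProj Q) {k n : ℤ} (hkn : k ≠ n) :
    Orth ((s.obj Q)⟦k⟧) ((s.obj N)⟦n⟧) :=
  (Orth.shift_iff _ _ k n (n - k) (by lia)).2 (h.orth Q N hQ _ (by lia))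

lemma proj_orth_shift {Q N : C} (hQ : F.IsProj Q) {k n : ℤ} (hkn : k ≠ n + 1) :
    Orth ((s.obj Q)⟦k⟧) ((s.obj N)⟦n⟧⟦(1 : ℤ)⟧) :=
  (h.proj_orth hQ hkn).of_iso_right ((shiftFunctorAdd D n 1).app _).symm

lemma stalk_orth (M N : C) {k n : ℤ} (hkn : n < k) : Orth ((s.obj M)⟦k⟧) ((s.obj N)⟦n⟧) :=
  h.orth_of_proj _ _ (fun _ hQ _ hk => h.proj_orth hQ (by lia)) _

section EnoughProj

variable [F.EnoughProj]

lemma faithful : s.Faithful where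
  map_injective {M N} g g' hg := by
    obtain ⟨K, Q, i, p, w, hE, hQ⟩ := ExtSubfunctor.EnoughProj.exists_isExact (F := F) M
    have : Epi p := hE.1.epi_g
    rw [← cancel_epi p]
    apply (h.map_bijective _ _ hQ).1
    rw [s.map_comp, s.map_comp, hg]

lemma full [s.Additive] : s.Full where
  map_surjective {M N} f := by
    have := h.faithful
    obtain ⟨K, Q, i, p, w, hE, hQ⟩ := ExtSubfunctor.EnoughProj.exists_isExact (F := F) M
    have := hE.1.epi_g
    obtain ⟨g₀, hg₀⟩ := (h.map_bijective _ N hQ).2 (s.map p ≫ f)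
    have hi : i ≫ g₀ = 0 := s.map_injective (by
      rw [s.map_comp, hg₀, ← Category.assoc, ← s.map_comp, w, s.map_zero, s.map_zero, zero_comp])
    obtain ⟨g, hg⟩ : ∃ g, p ≫ g = g₀ := ⟨hE.1.exact.desc g₀ hi, hE.1.exact.g_desc g₀ hi⟩
    obtain ⟨δ, hδ⟩ := h.exists_distTriang i p w hE
    obtain ⟨t, ht⟩ := hδ.desc₃ (f - s.map g) (by
      rw [Preadditive.comp_sub, ← s.map_comp, hg, hg₀, sub_self])
    have h₀ : Orth ((s.obj K)⟦(1 : ℤ)⟧) (s.obj N) :=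
      (h.stalk_orth K N zero_lt_one).of_iso_right ((shiftFunctorZero D ℤ).symm.app _)
    exact ⟨g, (sub_eq_zero.1 (by rw [← ht, h₀ t, comp_zero])).symm⟩

lemma exists_cover_distTriang (M : C) (n : ℤ) :
    ∃ (K Q : C) (i : K ⟶ Q) (p : Q ⟶ M) (w : i ≫ p = 0) (δ : (s.obj M)⟦n⟧ ⟶ (s.obj K)⟦n + 1⟧)
      (ε : (s.obj K)⟦n + 1⟧ ⟶ (s.obj Q)⟦n⟧⟦(1 : ℤ)⟧),
      F.IsExact (ShortComplex.mk i p w) ∧ F.IsProj Q ∧ DistTriang ((s.map p)⟦n⟧') δ ε := by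
  obtain ⟨K, Q, i, p, w, hE, hQ⟩ := ExtSubfunctor.EnoughProj.exists_isExact (F := F) M
  obtain ⟨δ, hδ⟩ := h.exists_distTriang i p w hE
  obtain ⟨ε, hε⟩ := hδ.rotate.exists_shift n
  let e : (s.obj K)⟦n + 1⟧ ≅ (s.obj K)⟦(1 : ℤ)⟧⟦n⟧ :=
    (shiftFunctorAdd' D 1 n (n + 1) (by lia)).app _
  refine ⟨K, Q, i, p, w, δ⟦n⟧' ≫ e.inv, e.hom ≫ ε, hE, hQ,
    hε.of_iso (Iso.refl _) (Iso.refl _) e (by simp) (by simp) (by simp)⟩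

lemma exists_truncation [IsTriangulated D] (n : ℤ) (Z : D) :
    ∃ (P W : D) (a : P ⟶ Z) (b : Z ⟶ W) (c : W ⟶ P⟦(1 : ℤ)⟧), DistTriang a b c ∧
      ExtClosure (stalks s F.IsProj (· ≤ n)) P ∧ ExtClosure (stalks s ⊤ (n < ·)) W := by
  let E := extensionProduct (ExtClosure (stalks s F.IsProj (· ≤ n)))
    (ExtClosure (stalks s ⊤ (n < ·)))
  have : E.IsTriangulatedClosed₂ := by
    refine isTriangulatedClosed₂_extensionProduct _ _ fun X Y hX hY => ?_
    refine hX.orth_left_of_stalks fun Q k hQ hk => ?_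
    rw [Orth.shift_left_iff _ _ 1 k (k - 1) (by lia)]
    exact hY.orth_right_of_stalks fun N l _ hl => h.proj_orth hQ (by lia)
  have : E.ContainsZero := containsZero_extensionProduct _ _
  have stalk (d : ℕ) (k : ℤ) (hk : n + 1 ≤ k + d) (M : C) : E ((s.obj M)⟦k⟧) := by
    induction d generalizing k M with
    | zero => exact le_extensionProduct_right _ _ (.of _ (stalks_obj trivial (by lia)))
    | succ d ih =>
      by_cases hkn : n < k
      · exact le_extensionProduct_right _ _ (.of _ (stalks_obj trivial hkn))
      obtain ⟨K, Q, i, p, w, δ, ε, -, hQ, hT⟩ := h.exists_cover_distTriang M k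
      exact ext_of_isTriangulatedClosed₂ _ _ hT
        (le_extensionProduct_left _ _ (.of _ (stalks_obj hQ (not_lt.1 hkn))))
        (ih (k + 1) (by lia) K)
  obtain ⟨P, W, a, b, c, hT, hP, hW⟩ : E Z := by
    refine extClosure_le ?_ _ (h.generates Z)
    rintro _ ⟨M, k, -, -, ⟨e⟩⟩
    exact prop_of_iso _ e.symm (stalk (n + 1 - k).toNat k (by lia) M)
  exact ⟨P, W, a, b, c, hT, hP, hW⟩

end EnoughProj

section Additive

variable [s.Additive]

lemma isTriangulatedClosed₂_stalks (n : ℤ) :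
    (stalks s F.IsProj (· = n)).IsTriangulatedClosed₂ := .mk' <| by
  rintro T hT ⟨Q₁, _, hQ₁, rfl, ⟨e₁⟩⟩ ⟨Q₃, n, hQ₃, rfl, ⟨e₃⟩⟩
  have h₀ : Orth T.obj₃ (T.obj₁⟦(1 : ℤ)⟧) :=
    ((h.proj_orth_shift hQ₃ (by lia)).of_iso_right ((shiftFunctor D 1).mapIso e₁)).of_iso_left e₃
  have := preservesBinaryBiproducts_of_preservesBiproducts (s ⋙ shiftFunctor D n)
  obtain ⟨e, -, -⟩ := exists_iso_binaryBiproduct_of_distTriang T hT (h₀ _)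
  exact ⟨Q₁ ⊞ Q₃, n, F.isProj_biprod hQ₁ hQ₃, rfl,
    ⟨e ≪≫ biprod.mapIso e₁ e₃ ≪≫ ((s ⋙ shiftFunctor D n).mapBiprod Q₁ Q₃).symm⟩⟩

lemma exists_top_term [IsTriangulated D] (n : ℤ) {P : D}
    (hP : ExtClosure (stalks s F.IsProj (· ≤ n)) P) :
    ∃ (P' : D) (Q : C) (a : P' ⟶ P) (e : P ⟶ (s.obj Q)⟦n⟧) (d : (s.obj Q)⟦n⟧ ⟶ P'⟦(1 : ℤ)⟧),
      DistTriang a e d ∧ F.IsProj Q ∧ ExtClosure (stalks s F.IsProj (· ≤ n - 1)) P' := by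
  let E := extensionProduct (ExtClosure (stalks s F.IsProj (· ≤ n - 1)))
    (stalks s F.IsProj (· = n))
  have : (stalks s F.IsProj (· = n)).IsTriangulatedClosed₂ := h.isTriangulatedClosed₂_stalks n
  have : E.IsTriangulatedClosed₂ := by
    refine isTriangulatedClosed₂_extensionProduct _ _ fun X Y hX hY => ?_
    obtain ⟨Q', n, -, rfl, ⟨e'⟩⟩ := hY
    refine hX.orth_left_of_stalks fun Q k hQ hk => ?_
    exact (h.proj_orth_shift hQ (by lia)).of_iso_right ((shiftFunctor D 1).mapIso e')
  have : (stalks s F.IsProj (· = n)).ContainsZero :=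
    ⟨⟨_, (s ⋙ shiftFunctor D n).map_isZero (isZero_zero C),
      stalks_obj (ExtSubfunctor.isProj_of_isZero (isZero_zero C)) rfl⟩⟩
  have : E.ContainsZero := containsZero_extensionProduct _ _
  obtain ⟨P', W, f, g, k, hT, hP', Q, _, hQ, rfl, ⟨e⟩⟩ : E P := by
    refine extClosure_le ?_ _ hP
    rintro X ⟨Q, k, hQ, hk, ⟨e⟩⟩
    by_cases hkn : k = n
    · exact le_extensionProduct_right _ _ ⟨Q, k, hQ, hkn, ⟨e⟩⟩
    · exact le_extensionProduct_left _ _ (.of _ ⟨Q, k, hQ, by lia, ⟨e⟩⟩)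
  replace hT : DistTriang f g k := hT
  exact ⟨P', Q, f, g ≫ e.hom, e.inv ≫ k,
    hT.of_iso (Iso.refl _) (Iso.refl _) e.symm (by simp) (by simp) (by simp), hQ, hP'⟩

end Additive

end IsStalkFunctor

end StalkFunctor

section ProjDim

variable {C : Type u} [Category.{v} C] {D : Type u'} [Category.{v'} D] [Preadditive D]
  [HasShift D ℤ]

/-- `P` has relative projective dimension at most `n`: there are no nonzero morphisms from `P` to
stalk complexes in homological degrees greater than `n`. -/
def ProjDimLE (s : C ⥤ D) (n : ℤ) (P : D) : Prop := ∀ N k, n < k → Orth P ((s.obj N)⟦k⟧)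

variable {s : C ⥤ D} {n m : ℤ} {P P' : D}

namespace ProjDimLE

lemma mono (hP : ProjDimLE s n P) (hnm : n ≤ m) : ProjDimLE s m P :=
  fun N k hk => hP N k (by lia)

lemma of_iso (hP : ProjDimLE s n P) (e : P' ≅ P) : ProjDimLE s n P' :=
  fun N k hk => (hP N k hk).of_iso_left e

lemma shift [∀ n : ℤ, (shiftFunctor D n).Additive] (hP : ProjDimLE s n P) (k m : ℤ)
    (hm : m = n + k) : ProjDimLE s m (P⟦k⟧) :=
  fun N l hl => (Orth.shift_iff _ _ k l (l - k) (by lia)).2 (hP N _ (by lia))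

end ProjDimLE

end ProjDim

section Homology

variable {C : Type u} [Category.{v} C] [Abelian C] [HasExt.{w} C] (F : ExtSubfunctor.{w} C)
  {D : Type u'} [Category.{v'} D] [Preadditive D] [HasShift D ℤ] (s : C ⥤ D)

/-- The relative homology of `W` is concentrated in homological degrees `≥ n`; it is tested by
morphisms from shifts of `F`-projectives. -/
def HomologyGE (n : ℤ) (W : D) : Prop := ∀ Q, F.IsProj Q → ∀ k, k < n → Orth ((s.obj Q)⟦k⟧) W

/-- The relative homology of `Z` is concentrated in homological degrees `≤ n`. -/
def HomologyLE (n : ℤ) (Z : D) : Prop := ∀ Q, F.IsProj Q → ∀ k, n < k → Orth ((s.obj Q)⟦k⟧) Z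

/-- `M`, placed in homological degree `n`, is an approximation of `Z` by a stalk complex:
`Hom(Z, s(-)⟦n⟧)` is a quotient of `Hom(M, -)` by maps that factor through `F`-projectives.
For a complex `Z` of `F`-projectives, `M` is the cokernel of the differential ending in degree
`n`. -/
def IsStalkApprox (n : ℤ) (Z : D) (M : C) : Prop :=
  ∃ q : Z ⟶ (s.obj M)⟦n⟧,
    (∀ (N : C) (f : Z ⟶ (s.obj N)⟦n⟧), ∃ g : M ⟶ N, q ≫ (s.map g)⟦n⟧' = f) ∧
    ∀ (N : C) (g : M ⟶ N), q ≫ (s.map g)⟦n⟧' = 0 → F.FactorsProj g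

variable {F s} {n : ℤ}

lemma HomologyLE.mono {m : ℤ} {Z : D} (hZ : HomologyLE F s n Z) (hnm : n ≤ m) :
    HomologyLE F s m Z :=
  fun Q hQ k hk => hZ Q hQ k (by lia)

namespace IsStalkApprox

variable {Z Z' : D} {M M' : C}

lemma of_iso (h : IsStalkApprox F s n Z M) (e : Z' ≅ Z) : IsStalkApprox F s n Z' M := by
  obtain ⟨q, h₁, h₂⟩ := h
  refine ⟨e.hom ≫ q, fun N f => ?_, fun N g hg => h₂ N g ?_⟩
  · obtain ⟨g, hg⟩ := h₁ N (e.inv ≫ f)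
    exact ⟨g, by rw [Category.assoc, hg, e.hom_inv_id_assoc]⟩
  · rw [Category.assoc] at hg
    rw [← cancel_epi e.hom, hg, comp_zero]

lemma cls_eq [s.Additive] [(shiftFunctor D n).Additive] (h : IsStalkApprox F s n Z M)
    (h' : IsStalkApprox F s n Z M') : F.cls M = F.cls M' := by
  obtain ⟨q, h₁, h₂⟩ := h
  obtain ⟨q', h₁', h₂'⟩ := h'
  obtain ⟨f, rfl⟩ := h₁ _ q'
  obtain ⟨g, hg⟩ := h₁' _ q
  rw [Category.assoc] at hg
  refine ExtSubfunctor.cls_eq_of_stable_iso f g (h₂ _ _ ?_) (h₂' _ _ ?_)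
  · simp [hg]
  · simp [reassoc_of% hg]

lemma biprod [s.Additive] [(shiftFunctor D n).Additive] [HasBinaryBiproducts D]
    (h : IsStalkApprox F s n Z M) (h' : IsStalkApprox F s n Z' M') :
    IsStalkApprox F s n (Z ⊞ Z') (M ⊞ M') := by
  obtain ⟨q, h₁, h₂⟩ := h
  obtain ⟨q', h₁', h₂'⟩ := h'
  let q₀ : Z ⊞ Z' ⟶ (s.obj (M ⊞ M'))⟦n⟧ :=
    biprod.desc (q ≫ (s.map biprod.inl)⟦n⟧') (q' ≫ (s.map biprod.inr)⟦n⟧')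
  have inl_comp {N : C} (g : M ⊞ M' ⟶ N) :
      biprod.inl ≫ q₀ ≫ (s.map g)⟦n⟧' = q ≫ (s.map (biprod.inl ≫ g))⟦n⟧' := by simp [q₀]
  have inr_comp {N : C} (g : M ⊞ M' ⟶ N) :
      biprod.inr ≫ q₀ ≫ (s.map g)⟦n⟧' = q' ≫ (s.map (biprod.inr ≫ g))⟦n⟧' := by simp [q₀]
  refine ⟨q₀, fun N f => ?_, fun N g hg => ?_⟩
  · obtain ⟨g, hg⟩ := h₁ N (biprod.inl ≫ f)
    obtain ⟨g', hg'⟩ := h₁' N (biprod.inr ≫ f)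
    refine ⟨biprod.desc g g', biprod.hom_ext' _ _ ?_ ?_⟩
    · rw [inl_comp, biprod.inl_desc, hg]
    · rw [inr_comp, biprod.inr_desc, hg']
  · have e₁ := h₂ _ (biprod.inl ≫ g) (by rw [← inl_comp, hg, comp_zero])
    have e₂ := h₂' _ (biprod.inr ≫ g) (by rw [← inr_comp, hg, comp_zero])
    rw [← Category.id_comp g, ← biprod.total, Preadditive.add_comp, Category.assoc,
      Category.assoc]
    exact (e₁.comp_left _).add (e₂.comp_left _)

end IsStalkApprox

variable [∀ n : ℤ, (shiftFunctor D n).Additive]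

lemma HomologyLE.shift {Z : D} (hZ : HomologyLE F s n Z) (k m : ℤ) (hm : m = n + k) :
    HomologyLE F s m (Z⟦k⟧) :=
  fun Q hQ l hl => (Orth.shift_left_iff _ _ k l (l - k) (by lia)).2 (hZ Q hQ _ (by lia))

lemma HomologyGE.shift {W : D} (hW : HomologyGE F s n W) (k m : ℤ) (hm : m = n + k) :
    HomologyGE F s m (W⟦k⟧) :=
  fun Q hQ l hl => (Orth.shift_left_iff _ _ k l (l - k) (by lia)).2 (hW Q hQ _ (by lia))

lemma IsStalkApprox.shift {Z : D} {M : C} (h : IsStalkApprox F s n Z M) (k m : ℤ)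
    (hm : m = n + k) : IsStalkApprox F s m (Z⟦k⟧) M := by
  obtain ⟨q, h₁, h₂⟩ := h
  let σ : shiftFunctor D n ⋙ shiftFunctor D k ≅ shiftFunctor D m :=
    (shiftFunctorAdd' D n k m hm.symm).symm
  have comp_map {N : C} (g : M ⟶ N) : (q⟦k⟧' ≫ σ.hom.app _) ≫ (s.map g)⟦m⟧' =
      (q ≫ (s.map g)⟦n⟧')⟦k⟧' ≫ σ.hom.app _ := by
    rw [Category.assoc, Functor.map_comp, Category.assoc, ← σ.hom.naturality]
    rfl
  refine ⟨q⟦k⟧' ≫ σ.hom.app _, fun N f => ?_, fun N g hg => h₂ N g ?_⟩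
  · obtain ⟨f', hf'⟩ := (shiftFunctor D k).map_surjective (f ≫ σ.inv.app _)
    obtain ⟨g, rfl⟩ := h₁ N f'
    exact ⟨g, by rw [comp_map, hf', Category.assoc, σ.inv_hom_id_app, Category.comp_id]⟩
  · rw [comp_map, ← zero_comp (f := σ.hom.app _), cancel_mono] at hg
    exact (shiftFunctor D k).map_injective (hg.trans (Functor.map_zero _ _ _).symm)

variable [HasZeroObject D] [Pretriangulated D]

lemma IsStalkApprox.of_distTriang_of_orth {P Z W : D} {a : P ⟶ Z} {b : Z ⟶ W}
    {c : W ⟶ P⟦(1 : ℤ)⟧} (hT : DistTriang a b c)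
    (hW : ∀ (N : C) (k : ℤ), k ≤ n + 1 → Orth W ((s.obj N)⟦k⟧)) {M : C}
    (hM : IsStalkApprox F s n P M) : IsStalkApprox F s n Z M := by
  obtain ⟨q, h₁, h₂⟩ := hM
  obtain ⟨q, rfl⟩ := hT.desc₁ q
    (((hW M (n + 1) le_rfl).of_iso_right ((shiftFunctorAdd D n 1).symm.app _)) _)
  refine ⟨q, fun N f => ?_, fun N g hg => h₂ N g (by rw [Category.assoc, hg, comp_zero])⟩
  obtain ⟨g, hg⟩ := h₁ N (a ≫ f)
  rw [Category.assoc] at hg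
  obtain ⟨t, ht⟩ := hT.desc₂ (q ≫ (s.map g)⟦n⟧' - f) (by simp [hg])
  exact ⟨g, sub_eq_zero.1 (by rw [← ht, hW N n (by lia) t, comp_zero])⟩

end Homology

namespace IsStalkFunctor

variable {C : Type u} [Category.{v} C] [Abelian C] [HasExt.{w} C] {F : ExtSubfunctor.{w} C}
  {D : Type u'} [Category.{v'} D] [Preadditive D] [HasZeroObject D] [HasShift D ℤ]
  [∀ n : ℤ, (shiftFunctor D n).Additive] [Pretriangulated D] {s : C ⥤ D}
  (h : IsStalkFunctor F s)

include h

lemma projDimLE_stalk {Q : C} (hQ : F.IsProj Q) (n : ℤ) : ProjDimLE s n ((s.obj Q)⟦n⟧) :=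
  fun _ _ hk => h.proj_orth hQ hk.ne

lemma projDimLE_of_extClosure {n : ℤ} {P : D}
    (hP : ExtClosure (stalks s F.IsProj (· ≤ n)) P) : ProjDimLE s n P :=
  fun _ _ hk => hP.orth_left_of_stalks fun _ _ hQ hl => h.proj_orth hQ (by lia)

lemma homologyLE_of_extClosure {n : ℤ} {P : D}
    (hP : ExtClosure (stalks s F.IsProj (· ≤ n)) P) : HomologyLE F s n P :=
  fun _ hQ _ _ => hP.orth_right_of_stalks fun _ _ _ _ => h.proj_orth hQ (by lia)

lemma homologyGE_of_extClosure {n : ℤ} {W : D} (hW : ExtClosure (stalks s ⊤ (n < ·)) W) :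
    HomologyGE F s (n + 1) W :=
  fun _ hQ _ hk => hW.orth_right_of_stalks fun _ _ _ hl => h.proj_orth hQ (by lia)

lemma stalk_orth_of_homologyLE {n k : ℤ} {Z : D} (hZ : HomologyLE F s n Z) (hk : n < k) (M : C) :
    Orth ((s.obj M)⟦k⟧) Z :=
  h.orth_of_proj _ _ (fun Q hQ l hl => hZ Q hQ l (by lia)) M

lemma isZero_of_orth {Z : D} (hZ : ∀ Q, F.IsProj Q → ∀ k : ℤ, Orth ((s.obj Q)⟦k⟧) Z) :
    IsZero Z :=
  (IsZero.iff_id_eq_zero Z).2 <| (h.generates Z).orth_left_of_stalks (fun M _ _ _ =>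
    h.orth_of_proj _ _ (fun Q hQ l _ => hZ Q hQ l) M) _

lemma isIso_of_bijective {X Y : D} (f : X ⟶ Y)
    (hf : ∀ Q, F.IsProj Q → ∀ k : ℤ, Function.Bijective fun x : (s.obj Q)⟦k⟧ ⟶ X => x ≫ f) :
    IsIso f := by
  obtain ⟨E, a, b, hT⟩ := DistTriang.exists_cone f
  exact hT.isIso₁_of_isZero (h.isZero_of_orth fun Q hQ => hT.orth_of_bijective (hf Q hQ))

section EnoughProj

variable [F.EnoughProj] {n : ℤ}

lemma exists_lift_of_projDimLE {P : D} (hP : ProjDimLE s n P) {N : C} (f : P ⟶ (s.obj N)⟦n⟧) :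
    ∃ (Q : C) (p : Q ⟶ N) (g : P ⟶ (s.obj Q)⟦n⟧), F.IsProj Q ∧ g ≫ (s.map p)⟦n⟧' = f := by
  obtain ⟨K, Q, i, p, w, δ, ε, -, hQ, hT⟩ := h.exists_cover_distTriang N n
  obtain ⟨g, hg⟩ := hT.lift₂ f (hP K (n + 1) (by lia) _)
  exact ⟨Q, p, g, hQ, hg⟩

section Additive

variable [s.Additive]

lemma map_shift_bijective (n : ℤ) (M N : C) :
    Function.Bijective fun f : M ⟶ N => (s.map f)⟦n⟧' := by
  have := h.full
  have := h.faithful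
  exact ⟨(s ⋙ shiftFunctor D n).map_injective, (s ⋙ shiftFunctor D n).map_surjective⟩

lemma exists_map_shift_eq {M N : C} (f : (s.obj M)⟦n⟧ ⟶ (s.obj N)⟦n⟧) :
    ∃ g : M ⟶ N, (s.map g)⟦n⟧' = f :=
  (h.map_shift_bijective n M N).2 f

lemma eq_zero_of_map_shift_eq_zero {M N : C} {f : M ⟶ N} (hf : (s.map f)⟦n⟧' = 0) : f = 0 :=
  (h.map_shift_bijective n M N).1 (by simp [hf])

lemma isStalkApprox_stalk (n : ℤ) (M : C) : IsStalkApprox F s n ((s.obj M)⟦n⟧) M := by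
  refine ⟨𝟙 _, fun N f => ?_, fun N g hg => ?_⟩
  · simpa only [Category.id_comp] using h.exists_map_shift_eq f
  · rw [Category.id_comp] at hg
    rw [h.eq_zero_of_map_shift_eq_zero hg]
    exact ExtSubfunctor.factorsProj_zero (F := F) _ _

lemma isStalkApprox_of_distTriang {P Z Z' : D} {a : P ⟶ Z} {b : Z ⟶ Z'}
    {c : Z' ⟶ P⟦(1 : ℤ)⟧} (hT : DistTriang a b c) (hP : ProjDimLE s (n - 1) P) {M : C}
    (hM : IsStalkApprox F s n Z' M) : IsStalkApprox F s n Z M := by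
  obtain ⟨q, h₁, h₂⟩ := hM
  refine ⟨b ≫ q, fun N f => ?_, fun N g hg => ?_⟩
  · obtain ⟨f', rfl⟩ := hT.desc₂ f (hP N n (by lia) _)
    obtain ⟨g, rfl⟩ := h₁ N f'
    exact ⟨g, by simp⟩
  · obtain ⟨v, hv⟩ := hT.desc₃ (q ≫ (s.map g)⟦n⟧') (by simpa using hg)
    obtain ⟨Q, p, u, hQ, rfl⟩ := h.exists_lift_of_projDimLE (hP.shift 1 n (by lia)) v
    obtain ⟨g', hg'⟩ := h₁ Q (c ≫ u)
    have e : F.FactorsProj (g - g' ≫ p) := h₂ _ _ (by simp [← hv, reassoc_of% hg'])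
    simpa using e.add (ExtSubfunctor.FactorsProj.of_tgt hQ g' |>.comp_right p)

lemma isProj_of_isStalkApprox {P : D} (hP : ProjDimLE s n P) {M : C}
    (hM : IsStalkApprox F s n P M) : F.IsProj M := by
  obtain ⟨q, h₁, h₂⟩ := hM
  obtain ⟨Q, p, u, hQ, hu⟩ := h.exists_lift_of_projDimLE hP q
  obtain ⟨g, rfl⟩ := h₁ Q u
  rw [Category.assoc] at hu
  apply ExtSubfunctor.FactorsProj.isProj
  have e : F.FactorsProj (𝟙 M - g ≫ p) := h₂ _ _ (by simp [hu])
  simpa using e.add (ExtSubfunctor.FactorsProj.of_tgt hQ g |>.comp_right p)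

end Additive

variable [IsTriangulated D]

lemma exists_retract_of_homologyGE {W : D} (hW : HomologyGE F s (n + 1) W) :
    ∃ W' : D, Nonempty (Retract W W') ∧ ExtClosure (stalks s ⊤ (n < ·)) W' := by
  obtain ⟨P, W', a, b, c, hT, hP, hW'⟩ := h.exists_truncation n W
  have h₀ : Orth P W := hP.orth_left_of_stalks fun Q l hQ hl => hW Q hQ l (by lia)
  obtain ⟨r, hr⟩ := hT.desc₂ (𝟙 W) (h₀ _)
  exact ⟨W', ⟨⟨b, r, hr⟩⟩, hW'⟩

lemma projDimLE_orth_homologyGE {P W : D} (hP : ProjDimLE s n P)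
    (hW : HomologyGE F s (n + 1) W) : Orth P W := by
  obtain ⟨W', ⟨ρ⟩, hW'⟩ := h.exists_retract_of_homologyGE hW
  exact (hW'.orth_right_of_stalks fun N l _ hl => hP N l hl).of_retract_right ρ

lemma homologyGE_orth_homologyLE {W Z : D} (hW : HomologyGE F s (n + 1) W)
    (hZ : HomologyLE F s n Z) : Orth W Z := by
  obtain ⟨W', ⟨ρ⟩, hW'⟩ := h.exists_retract_of_homologyGE hW
  exact (hW'.orth_left_of_stalks fun N l _ hl =>
    h.stalk_orth_of_homologyLE hZ hl N).of_retract_left ρ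

end EnoughProj

end IsStalkFunctor

section ShiftStalks

variable {C : Type u} [Category.{v} C] {D : Type u'} [Category.{v'} D] [Preadditive D]
  [HasZeroObject D] [HasShift D ℤ] [∀ n : ℤ, (shiftFunctor D n).Additive] [Pretriangulated D]

lemma ExtClosure.shift_stalks {s : C ⥤ D} {P : ObjectProperty C} {n : ℤ} {X : D}
    (hX : ExtClosure (stalks s P (· ≤ n)) X) (k m : ℤ) (hm : m = n + k) :
    ExtClosure (stalks s P (· ≤ m)) (X⟦k⟧) := by
  induction hX with
  | of X hX =>
    obtain ⟨M, l, hM, hl, ⟨e⟩⟩ := hX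
    exact .of _ ⟨M, l + k, hM, by lia,
      ⟨(shiftFunctor D k).mapIso e ≪≫ (shiftFunctorAdd D l k).symm.app _⟩⟩
  | zero X hX => exact .zero _ (Functor.map_isZero _ hX)
  | ext T hT _ _ h₁ h₃ =>
    obtain ⟨ε, hε⟩ := DistTriang.exists_shift hT k
    exact .ext _ hε h₁ h₃

end ShiftStalks

section StalkClass

variable {C : Type u} [Category.{v} C] [Abelian C] [HasExt.{w} C] {F : ExtSubfunctor.{w} C}
  {D : Type u'} [Category.{v'} D] [Preadditive D] [HasZeroObject D] [HasShift D ℤ]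
  [∀ n : ℤ, (shiftFunctor D n).Additive] [Pretriangulated D] {s : C ⥤ D}

variable (F s) in
/-- `Z` becomes a stalk complex in homological degree `n` after replacing all terms in smaller
degrees of a resolution of `Z` by zero, the replaced terms being `F`-projective. -/
def IsStalkUpToProj (n : ℤ) (Z : D) : Prop :=
  ∃ (P : D) (M : C) (a : P ⟶ Z) (b : Z ⟶ (s.obj M)⟦n⟧) (c : (s.obj M)⟦n⟧ ⟶ P⟦(1 : ℤ)⟧),
    DistTriang a b c ∧ ExtClosure (stalks s F.IsProj (· ≤ n - 1)) P

namespace IsStalkFunctor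

variable [s.Additive] (h : IsStalkFunctor F s)

include h

lemma exists_attaching_map [IsTriangulated D] (n : ℤ) {P : D}
    (hP : ExtClosure (stalks s F.IsProj (· ≤ n + 1)) P) :
    ∃ (P' : D) (Q : C) (u : (s.obj Q)⟦n⟧ ⟶ P') (a : P' ⟶ P) (e : P ⟶ (s.obj Q)⟦n⟧⟦(1 : ℤ)⟧),
      DistTriang u a e ∧ ExtClosure (stalks s F.IsProj (· ≤ n)) P' := by
  obtain ⟨P', Q, a, e, d, hT, -, hP'⟩ := h.exists_top_term (n + 1) hP
  let σ : (s.obj Q)⟦n⟧⟦(1 : ℤ)⟧ ≅ (s.obj Q)⟦n + 1⟧ := (shiftFunctorAdd D n 1).symm.app _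
  have hT' : DistTriang a (e ≫ σ.inv) (σ.hom ≫ d) :=
    hT.of_iso (Iso.refl _) (Iso.refl _) σ (by simp) (by simp) (by simp)
  obtain ⟨u, hu⟩ := hT'.exists_of_rotate
  exact ⟨P', Q, u, a, _, hu, by simpa only [add_sub_cancel_right] using hP'⟩

variable [F.EnoughProj]

lemma isStalkApprox_cokernel {n : ℤ} {P₀ P₁ P : D} {Q₀ Q₁ : C} {a₀ : P₀ ⟶ P₁}
    {e₀ : P₁ ⟶ (s.obj Q₀)⟦n⟧} {d₀ : (s.obj Q₀)⟦n⟧ ⟶ P₀⟦(1 : ℤ)⟧} (hT₀ : DistTriang a₀ e₀ d₀)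
    (hP₀ : ProjDimLE s (n - 1) P₀) {u : (s.obj Q₁)⟦n⟧ ⟶ P₁} {a₁ : P₁ ⟶ P}
    {e₁ : P ⟶ (s.obj Q₁)⟦n⟧⟦(1 : ℤ)⟧} (hT₁ : DistTriang u a₁ e₁) {α : Q₁ ⟶ Q₀}
    (hα : (s.map α)⟦n⟧' = u ≫ e₀) : IsStalkApprox F s n P (cokernel α) := by
  have map_comp {X Y Z : C} (f : X ⟶ Y) (g : Y ⟶ Z) :
      (s.map (f ≫ g))⟦n⟧' = (s.map f)⟦n⟧' ≫ (s.map g)⟦n⟧' := by simp only [Functor.map_comp]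
  obtain ⟨q, hq⟩ := hT₁.desc₂ (e₀ ≫ (s.map (cokernel.π α))⟦n⟧') (by
    rw [← Category.assoc, ← hα, ← map_comp, cokernel.condition, s.map_zero, Functor.map_zero])
  have comp_q {N : C} (g : cokernel α ⟶ N) :
      a₁ ≫ q ≫ (s.map g)⟦n⟧' = e₀ ≫ (s.map (cokernel.π α ≫ g))⟦n⟧' := by
    rw [reassoc_of% hq, map_comp]
  refine ⟨q, fun N f => ?_, fun N g hg => ?_⟩
  · obtain ⟨k, hk⟩ := hT₀.desc₂ (a₁ ≫ f) (hP₀ N n (by lia) _)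
    obtain ⟨g, rfl⟩ := h.exists_map_shift_eq k
    have hαg : α ≫ g = 0 := h.eq_zero_of_map_shift_eq_zero (n := n) (by
      rw [map_comp, hα, Category.assoc, hk, reassoc_of% hT₁.comp₁₂, zero_comp])
    refine ⟨cokernel.desc α g hαg, sub_eq_zero.1 ?_⟩
    obtain ⟨t, ht⟩ := hT₁.desc₃ (q ≫ (s.map (cokernel.desc α g hαg))⟦n⟧' - f) (by
      rw [Preadditive.comp_sub, comp_q, cokernel.π_desc, hk, sub_self])
    have ht₀ : t = 0 := ((h.stalk_orth Q₁ N (lt_add_one n)).of_iso_left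
      ((shiftFunctorAdd D n 1).app _).symm) t
    rw [← ht, ht₀, comp_zero]
  · obtain ⟨v, hv⟩ := hT₀.desc₃ ((s.map (cokernel.π α ≫ g))⟦n⟧') (by
      rw [← comp_q, hg, comp_zero])
    obtain ⟨Q, p, y, hQ, rfl⟩ := h.exists_lift_of_projDimLE (hP₀.shift 1 n (by lia)) v
    obtain ⟨x, hx⟩ := h.exists_map_shift_eq (d₀ ≫ y)
    have hαx : α ≫ x = 0 := h.eq_zero_of_map_shift_eq_zero (n := n) (by
      rw [map_comp, hα, hx, Category.assoc, reassoc_of% hT₀.comp₂₃, zero_comp, comp_zero])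
    refine ⟨Q, cokernel.desc α x hαx, p, hQ, ?_⟩
    rw [← cancel_epi (cokernel.π α), cokernel.π_desc_assoc]
    apply (h.map_shift_bijective n _ _).1
    change (s.map _)⟦n⟧' = (s.map _)⟦n⟧'
    rw [← hv, map_comp, hx, Category.assoc]

section StalkCls

variable [IsTriangulated D]

lemma exists_isStalkApprox (n : ℤ) (Z : D) : ∃ M, IsStalkApprox F s n Z M := by
  obtain ⟨P, W, a, b, c, hT, hP, hW⟩ := h.exists_truncation (n + 1) Z
  obtain ⟨P₁, Q₁, u, a₁, e₁, hT₁, hP₁⟩ := h.exists_attaching_map n hP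
  obtain ⟨P₀, Q₀, a₀, e₀, d₀, hT₀, -, hP₀⟩ := h.exists_top_term n hP₁
  obtain ⟨α, hα⟩ := h.exists_map_shift_eq (u ≫ e₀)
  exact ⟨cokernel α, (h.isStalkApprox_cokernel hT₀ (h.projDimLE_of_extClosure hP₀) hT₁
    hα).of_distTriang_of_orth hT fun N k hk =>
      hW.orth_left_of_stalks fun M l _ hl => h.stalk_orth M N (by lia)⟩

/-- The class in the Grothendieck group `K_F` of any approximation of `Z` by a stalk complex in
homological degree `n`. -/
noncomputable def stalkCls (n : ℤ) (Z : D) : F.KGroup := F.cls (h.exists_isStalkApprox n Z).choose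

lemma stalkCls_eq {n : ℤ} {Z : D} {M : C} (hM : IsStalkApprox F s n Z M) :
    h.stalkCls n Z = F.cls M :=
  (h.exists_isStalkApprox n Z).choose_spec.cls_eq hM

lemma stalkCls_eq_of_iso (n : ℤ) {Z Z' : D} (e : Z ≅ Z') : h.stalkCls n Z = h.stalkCls n Z' := by
  obtain ⟨M, hM⟩ := h.exists_isStalkApprox n Z'
  rw [h.stalkCls_eq hM, h.stalkCls_eq (hM.of_iso e)]

lemma stalkCls_shift (n k m : ℤ) (hm : m = n + k) (Z : D) :
    h.stalkCls m (Z⟦k⟧) = h.stalkCls n Z := by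
  obtain ⟨M, hM⟩ := h.exists_isStalkApprox n Z
  rw [h.stalkCls_eq hM, h.stalkCls_eq (hM.shift k m hm)]

lemma stalkCls_biprod (n : ℤ) (Z Z' : D) :
    h.stalkCls n (Z ⊞ Z') = h.stalkCls n Z + h.stalkCls n Z' := by
  obtain ⟨M, hM⟩ := h.exists_isStalkApprox n Z
  obtain ⟨M', hM'⟩ := h.exists_isStalkApprox n Z'
  rw [h.stalkCls_eq hM, h.stalkCls_eq hM', h.stalkCls_eq (hM.biprod hM'),
    F.cls_eq_add (Iso.refl _)]

lemma stalkCls_of_distTriang {n : ℤ} {P Z Z' : D} {a : P ⟶ Z} {b : Z ⟶ Z'}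
    {c : Z' ⟶ P⟦(1 : ℤ)⟧} (hT : DistTriang a b c) (hP : ProjDimLE s (n - 1) P) :
    h.stalkCls n Z = h.stalkCls n Z' := by
  obtain ⟨M, hM⟩ := h.exists_isStalkApprox n Z'
  rw [h.stalkCls_eq hM, h.stalkCls_eq (h.isStalkApprox_of_distTriang hT hP hM)]

lemma stalkCls_eq_zero {n : ℤ} {P : D} (hP : ProjDimLE s n P) : h.stalkCls n P = 0 := by
  obtain ⟨M, hM⟩ := h.exists_isStalkApprox n P
  rw [h.stalkCls_eq hM, F.cls_eq_zero (h.isProj_of_isStalkApprox hP hM)]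

lemma stalkCls_stalk (n : ℤ) (k : ℕ) (M : C) :
    h.stalkCls (n + k) ((s.obj M)⟦n⟧) = F.omega^[k] (F.cls M) := by
  induction k generalizing n M with
  | zero =>
    rw [Nat.cast_zero, add_zero]
    exact h.stalkCls_eq (h.isStalkApprox_stalk n M)
  | succ k ih =>
    obtain ⟨K, Q, i, p, w, δ, ε, hE, hQ, hT⟩ := h.exists_cover_distTriang M n
    rw [h.stalkCls_of_distTriang hT ((h.projDimLE_stalk hQ n).mono (by lia)),
      show n + ((k + 1 : ℕ) : ℤ) = n + 1 + k by lia, ih, Function.iterate_succ_apply,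
      F.omega_cls i p w hE hQ]

end StalkCls

section StalkUpToProj

lemma isIso_of_comp_eq_map_kernel_ι {X Y : C} {α : X ⟶ Y} {n : ℤ} {W : D}
    {μ : (s.obj (kernel α))⟦n⟧ ⟶ W} {j : W ⟶ (s.obj X)⟦n⟧}
    (hμ : μ ≫ j = (s.map (kernel.ι α))⟦n⟧') (hj : j ≫ (s.map α)⟦n⟧' = 0)
    (hinj : ∀ Q, F.IsProj Q → ∀ x : (s.obj Q)⟦n⟧ ⟶ W, x ≫ j = 0 → x = 0)
    (hW : ∀ Q, F.IsProj Q → ∀ k ≠ n, Orth ((s.obj Q)⟦k⟧) W) : IsIso μ := by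
  refine h.isIso_of_bijective μ fun Q hQ k => ?_
  obtain rfl | hk := eq_or_ne k n
  · refine ⟨fun x y hxy => ?_, fun y => ?_⟩
    · obtain ⟨f, rfl⟩ := h.exists_map_shift_eq x
      obtain ⟨g, rfl⟩ := h.exists_map_shift_eq y
      have hfg : f ≫ kernel.ι α = g ≫ kernel.ι α := (h.map_shift_bijective k _ _).1 (by
        simpa [hμ] using hxy =≫ j)
      rw [(cancel_mono _).1 hfg]
    · obtain ⟨f, hf⟩ := h.exists_map_shift_eq (y ≫ j)
      have hfα : f ≫ α = 0 := h.eq_zero_of_map_shift_eq_zero (n := k) (by simp [hf, hj])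
      refine ⟨(s.map (kernel.lift α f hfα))⟦k⟧', sub_eq_zero.1 (hinj Q hQ _ ?_)⟩
      rw [Preadditive.sub_comp, Category.assoc, hμ, ← Functor.map_comp, ← s.map_comp,
        kernel.lift_ι, hf, sub_self]
  · exact ⟨fun x y _ => (h.proj_orth hQ hk x).trans (h.proj_orth hQ hk y).symm,
      fun y => ⟨0, by simp [hW Q hQ k hk y]⟩⟩

lemma mono_of_attaching_map {n : ℤ} {P₀ P Z : D} {L Q : C} {a₀ : P₀ ⟶ P} {e₀ : P ⟶ (s.obj Q)⟦n⟧}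
    {d₀ : (s.obj Q)⟦n⟧ ⟶ P₀⟦(1 : ℤ)⟧} (hT₀ : DistTriang a₀ e₀ d₀)
    (hP₀ : HomologyLE F s (n - 1) P₀) {u : (s.obj L)⟦n⟧ ⟶ P} {a : P ⟶ Z}
    {b : Z ⟶ (s.obj L)⟦n⟧⟦(1 : ℤ)⟧} (hT : DistTriang u a b) (hZ : HomologyLE F s n Z)
    {β : L ⟶ Q} (hβ : (s.map β)⟦n⟧' = u ≫ e₀) : Mono β :=
  Preadditive.mono_of_cancel_zero _ fun {X} x hx => by
    have hxu : (s.map x)⟦n⟧' ≫ u = 0 := by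
      obtain ⟨y, hy⟩ := hT₀.lift₂ ((s.map x)⟦n⟧' ≫ u) (by
        rw [Category.assoc, ← hβ, ← Functor.map_comp, ← s.map_comp, hx, s.map_zero,
          Functor.map_zero])
      rw [← hy, h.stalk_orth_of_homologyLE hP₀ (by lia) _ y, zero_comp]
    obtain ⟨z, hz⟩ := hT.lift₁ ((s.map x)⟦n⟧'⟦(1 : ℤ)⟧') (by
      rw [← Functor.map_comp, hxu, Functor.map_zero])
    have hz₀ : z = 0 := ((h.stalk_orth_of_homologyLE hZ (lt_add_one n) X).of_iso_left
      ((shiftFunctorAdd D n 1).app _).symm) z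
    rw [hz₀, zero_comp] at hz
    exact h.eq_zero_of_map_shift_eq_zero (n := n) ((shiftFunctor D (1 : ℤ)).map_injective (by
      rw [← hz, Functor.map_zero]))

variable [IsTriangulated D]

lemma isStalkUpToProj_of_homologyLE_sub_two {n : ℤ} {Z : D} (hZ : HomologyLE F s (n - 2) Z) :
    IsStalkUpToProj F s n Z := by
  obtain ⟨P, W, a, b, c, hT, hP, hW⟩ := h.exists_truncation (n - 1) Z
  have hP₂ := hP.shift_stalks 1 n (by lia)
  obtain ⟨P₁, Q₁, a₁, e₁, d₁, hT₁, -, hP₁⟩ := h.exists_top_term n hP₂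
  obtain ⟨P₀, Q₀, a₀, e₀, d₀, hT₀, -, hP₀⟩ :=
    h.exists_top_term n (hP₁.shift_stalks 1 n (by lia))
  obtain ⟨α, hα⟩ := h.exists_map_shift_eq (d₁ ≫ e₀)
  have hιd : (s.map (kernel.ι α))⟦n⟧' ≫ d₁ = 0 := by
    obtain ⟨t, ht⟩ := hT₀.lift₂ ((s.map (kernel.ι α))⟦n⟧' ≫ d₁) (by
      rw [Category.assoc, ← hα, ← Functor.map_comp, ← s.map_comp, kernel.condition, s.map_zero,
        Functor.map_zero])
    rw [← ht, h.stalk_orth_of_homologyLE (h.homologyLE_of_extClosure hP₀) (by lia) _ t, zero_comp]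
  obtain ⟨μ₀, hμ₀⟩ := hT₁.lift₃ _ hιd
  obtain ⟨μ, hμ⟩ := hT.lift₁ μ₀
    (h.stalk_orth_of_homologyLE (hZ.shift 1 (n - 1) (by lia)) (by lia) _ _)
  have hjα : (c ≫ e₁) ≫ (s.map α)⟦n⟧' = 0 := by
    rw [hα, Category.assoc, reassoc_of% hT₁.comp₂₃, zero_comp, comp_zero]
  have hinj : ∀ Q, F.IsProj Q → ∀ x : (s.obj Q)⟦n⟧ ⟶ W, x ≫ c ≫ e₁ = 0 → x = 0 :=
    fun Q hQ x hx => by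
      obtain ⟨y, hy⟩ := hT₁.lift₂ (x ≫ c) (by rwa [Category.assoc])
      rw [h.homologyLE_of_extClosure hP₁ Q hQ n (by lia) y, zero_comp] at hy
      obtain ⟨z, rfl⟩ := hT.lift₃ x hy.symm
      rw [hZ Q hQ n (by lia) z, zero_comp]
  have hW₀ : ∀ Q, F.IsProj Q → ∀ k ≠ n, Orth ((s.obj Q)⟦k⟧) W := fun Q hQ k hk => by
    obtain hk | hk := lt_or_gt_of_ne hk
    · exact h.homologyGE_of_extClosure hW Q hQ k (by lia)
    · exact hT.rotate.orth_right (hZ Q hQ k (by lia))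
        (h.homologyLE_of_extClosure hP₂ Q hQ k (by lia))
  have := h.isIso_of_comp_eq_map_kernel_ι (by rw [reassoc_of% hμ, hμ₀]) hjα hinj hW₀
  exact ⟨P, kernel α, a, b ≫ inv μ, μ ≫ c,
    hT.of_iso (Iso.refl _) (Iso.refl _) (asIso μ) (by simp) (by simp) (by simp), hP⟩

lemma isStalkUpToProj_of_succ (hF : ∀ S : ShortComplex C, S.ShortExact → F.IsExact S) {n : ℤ}
    {Z : D} (hZ : HomologyLE F s n Z) (hZ' : IsStalkUpToProj F s (n + 1) Z) :
    IsStalkUpToProj F s n Z := by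
  obtain ⟨P, L, a, b, c, hT, hP⟩ := hZ'
  rw [add_sub_cancel_right] at hP
  let σ : (s.obj L)⟦n⟧⟦(1 : ℤ)⟧ ≅ (s.obj L)⟦n + 1⟧ := (shiftFunctorAdd D n 1).symm.app _
  have hT' : DistTriang a (b ≫ σ.inv) (σ.hom ≫ c) :=
    hT.of_iso (Iso.refl _) (Iso.refl _) σ (by simp) (by simp) (by simp)
  obtain ⟨u, hu⟩ := hT'.exists_of_rotate
  obtain ⟨P₀, Q, a₀, e₀, d₀, hT₀, -, hP₀⟩ := h.exists_top_term n hP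
  obtain ⟨β, hβ⟩ := h.exists_map_shift_eq (u ≫ e₀)
  have hmono := h.mono_of_attaching_map hT₀ (h.homologyLE_of_extClosure hP₀) hu hZ hβ
  obtain ⟨δ, hδ⟩ := h.exists_distTriang β (cokernel.π β) (cokernel.condition β)
    (hF _ (.mk' (ShortComplex.exact_cokernel β) hmono inferInstance))
  obtain ⟨ε, hε⟩ := hδ.exists_shift n
  obtain ⟨E, c', d', x, y, hE, hxy⟩ := hu.octahedron hT₀.rotate
  rw [← hβ] at hE
  obtain ⟨e⟩ := hE.cone_iso hε
  have hxy' : DistTriang (x ≫ e.hom) (e.inv ≫ y) ((-a₀⟦(1 : ℤ)⟧') ≫ a⟦(1 : ℤ)⟧') :=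
    hxy.of_iso (Iso.refl _) e.symm (Iso.refl _) (by simp) (by simp) (by simp)
  obtain ⟨f, hf⟩ := hxy'.exists_of_rotate
  exact ⟨P₀, _, f, _, _, hf, hP₀⟩

lemma isStalkUpToProj_of_homologyLE (hF : ∀ S : ShortComplex C, S.ShortExact → F.IsExact S)
    {n : ℤ} {Z : D} (hZ : HomologyLE F s n Z) : IsStalkUpToProj F s n Z :=
  h.isStalkUpToProj_of_succ hF hZ <| h.isStalkUpToProj_of_succ hF (hZ.mono (by lia)) <|
    h.isStalkUpToProj_of_homologyLE_sub_two (by rwa [show n + 1 + 1 - 2 = n by lia])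

end StalkUpToProj

end IsStalkFunctor

end StalkClass

namespace ExtSubfunctor

variable {C : Type*} [Category* C] [Abelian C] [HasExt.{w} C] {F : ExtSubfunctor.{w} C}
  [F.EnoughProj] {C' : Type*} [Category* C'] [Abelian C'] [HasExt.{v} C']
  {F' : ExtSubfunctor.{v} C'} [F'.EnoughProj]

lemma omega_iterate_eq_zero_of_iterate_add [∀ M : C, IsNoetherianObject M] {n : ℕ}
    (h : F.phiDim ≤ n) (d : ℕ) {x : F.KGroup} (hx : F.omega^[n + d] x = 0) :
    F.omega^[n] x = 0 := by
  induction d generalizing x with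
  | zero => exact hx
  | succ d ih =>
    obtain ⟨M, hM⟩ := F.exists_mem_summandSubgroup x
    refine F.omega_iterate_eq_zero_of_phiDim_le h hM ?_
    rw [Function.iterate_succ_apply]
    refine ih ?_
    rwa [← Function.iterate_succ_apply]

lemma phiDim_le_of_retraction [∀ M : C', IsNoetherianObject M] (Φ : F.KGroup →+ F'.KGroup)
    (Ψ : F'.KGroup →+ F.KGroup) (t : ℕ) (hΦ : ∀ x, Φ (F.omega x) = F'.omega (Φ x))
    (hΨΦ : ∀ x, Ψ (Φ x) = F.omega^[t] x) : F.phiDim ≤ F'.phiDim + t := by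
  have hΦ' (n : ℕ) (x : F.KGroup) : Φ (F.omega^[n] x) = F'.omega^[n] (Φ x) :=
    Function.Semiconj.iterate_right hΦ n x
  induction hn : F'.phiDim using ENat.recTopCoe with
  | top => simp
  | coe n =>
    rw [← Nat.cast_add]
    refine F.phiDim_le_of_omega_iterate _ fun x hx => ?_
    have h : F'.omega^[n] (Φ x) = 0 :=
      omega_iterate_eq_zero_of_iterate_add hn.le (t + 1) (by
        rw [← hΦ', ← add_assoc, hx, map_zero])
    rw [add_comm n, Function.iterate_add_apply, ← hΨΦ, hΦ', h, map_zero]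

end ExtSubfunctor

section Functoriality

variable {D : Type*} [Category* D] [Preadditive D] {D' : Type*} [Category* D'] [Preadditive D']

lemma orth_obj_iff {L : D ⥤ D'} {R : D' ⥤ D} [L.Additive] (adj : L ⊣ R) {X : D} {Y : D'} :
    Orth (L.obj X) Y ↔ Orth X (R.obj Y) :=
  ⟨fun h _ => (adj.homAddEquiv X Y).symm.map_eq_zero_iff.1 (h _),
    fun h _ => (adj.homAddEquiv X Y).map_eq_zero_iff.1 (h _)⟩

variable [HasZeroObject D] [HasShift D ℤ] [∀ n : ℤ, (shiftFunctor D n).Additive]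
  [Pretriangulated D] [HasZeroObject D'] [HasShift D' ℤ]
  [∀ n : ℤ, (shiftFunctor D' n).Additive] [Pretriangulated D']
  (L : D ⥤ D') [L.CommShift ℤ] [L.IsTriangulated]

lemma DistTriang.map {X Y Z : D} {f : X ⟶ Y} {g : Y ⟶ Z} {h : Z ⟶ X⟦(1 : ℤ)⟧}
    (hT : DistTriang f g h) :
    DistTriang (L.map f) (L.map g) (L.map h ≫ (L.commShiftIso (1 : ℤ)).hom.app X) :=
  L.map_distinguished _ hT

lemma ExtClosure.map {S : ObjectProperty D} {S' : ObjectProperty D'}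
    (hS : ∀ X, S X → S' (L.obj X)) {X : D} (hX : ExtClosure S X) : ExtClosure S' (L.obj X) := by
  induction hX with
  | of X hX => exact .of _ (hS X hX)
  | zero X hX => exact .zero _ (L.map_isZero hX)
  | ext _ hT _ _ h₁ h₃ => exact .ext _ (L.map_distinguished _ hT) h₁ h₃

end Functoriality

section Adjunction

variable {C : Type*} [Category* C] [Abelian C] [HasExt.{w} C] {F : ExtSubfunctor.{w} C}
  {D : Type*} [Category* D] [Preadditive D] [HasShift D ℤ] {s : C ⥤ D}
  {C' : Type*} [Category* C'] {D' : Type*} [Category* D'] [Preadditive D'] [HasShift D' ℤ]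
  [∀ n : ℤ, (shiftFunctor D' n).Additive] {s' : C' ⥤ D'}
  {L : D ⥤ D'} {R : D' ⥤ D} [L.CommShift ℤ] [L.Additive] (adj : L ⊣ R) {b : ℤ}
  (hL : ∀ Q, F.IsProj Q → ProjDimLE s' b (L.obj (s.obj Q)))

include adj hL

lemma homologyGE_obj_of_adj (M : C') : HomologyGE F s (-b) (R.obj (s'.obj M)) :=
  fun Q hQ k hk => (orth_obj_iff adj).1 <|
    ((((hL Q hQ).shift k (b + k) rfl) M 0 (by lia)).of_iso_right
      ((shiftFunctorZero D' ℤ).symm.app _)).of_iso_left ((L.commShiftIso k).app _)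

variable [∀ n : ℤ, (shiftFunctor D n).Additive] [HasZeroObject D] [Pretriangulated D]
  [IsTriangulated D] [R.CommShift ℤ]

lemma IsStalkFunctor.projDimLE_obj_of_adj [F.EnoughProj] (h : IsStalkFunctor F s) {n : ℤ} {P : D}
    (hP : ProjDimLE s n P) : ProjDimLE s' (n + b) (L.obj P) := fun N k hk =>
  (orth_obj_iff adj).2 <| (h.projDimLE_orth_homologyGE hP fun Q hQ j hj =>
    ((homologyGE_obj_of_adj adj hL N).shift k (k - b) (by lia)) Q hQ j (by lia)).of_iso_right
      ((R.commShiftIso k).app _)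

end Adjunction

section StalkCls

variable {C : Type*} [Category* C] [Abelian C] [HasExt.{w} C] {F : ExtSubfunctor.{w} C}
  {D : Type*} [Category* D] [Preadditive D] [HasZeroObject D] [HasShift D ℤ]
  [∀ n : ℤ, (shiftFunctor D n).Additive] [Pretriangulated D] {s : C ⥤ D} (h : IsStalkFunctor F s)
  {C' : Type*} [Category* C'] [Abelian C'] [HasExt.{v} C'] {F' : ExtSubfunctor.{v} C'}
  [F'.EnoughProj] {D' : Type*} [Category* D'] [Preadditive D'] [HasZeroObject D'] [HasShift D' ℤ]
  [∀ n : ℤ, (shiftFunctor D' n).Additive] [Pretriangulated D'] [IsTriangulated D'] {s' : C' ⥤ D'}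
  [s'.Additive] (h' : IsStalkFunctor F' s')

namespace IsStalkFunctor

lemma stalkCls_obj_shift {D : Type*} [Category* D] [HasShift D ℤ] (L : D ⥤ D') [L.CommShift ℤ]
    (n k m : ℤ) (hm : m = n + k) (X : D) :
    h'.stalkCls m (L.obj (X⟦k⟧)) = h'.stalkCls n (L.obj X) :=
  (h'.stalkCls_eq_of_iso m ((L.commShiftIso k).app X)).trans (h'.stalkCls_shift n k m hm _)

include h in
lemma stalkCls_succ_obj {L : D ⥤ D'} [L.CommShift ℤ] [L.IsTriangulated] {n : ℤ} {K Q M : C}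
    {i : K ⟶ Q} {p : Q ⟶ M} {w : i ≫ p = 0} (hE : F.IsExact (ShortComplex.mk i p w))
    (hQ : ProjDimLE s' n (L.obj (s.obj Q))) :
    h'.stalkCls (n + 1) (L.obj (s.obj M)) = h'.stalkCls n (L.obj (s.obj K)) := by
  obtain ⟨δ, hT⟩ := h.exists_distTriang i p w hE
  rw [h'.stalkCls_of_distTriang (DistTriang.map L hT.rotate) (by rwa [add_sub_cancel_right]),
    h'.stalkCls_obj_shift L n 1 (n + 1) rfl]

lemma exists_cls_eq_of_isStalkUpToProj {n : ℤ} {Z : D'} (hZ : IsStalkUpToProj F' s' n Z) :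
    ∃ (P : D') (M : C') (a : P ⟶ Z) (b : Z ⟶ (s'.obj M)⟦n⟧) (c : (s'.obj M)⟦n⟧ ⟶ P⟦(1 : ℤ)⟧),
      DistTriang a b c ∧ ProjDimLE s' (n - 1) P ∧ h'.stalkCls n Z = F'.cls M := by
  obtain ⟨P, M, a, b, c, hT, hP⟩ := hZ
  have hP' := h'.projDimLE_of_extClosure hP
  refine ⟨P, M, a, b, c, hT, hP', ?_⟩
  rw [h'.stalkCls_of_distTriang hT hP', h'.stalkCls_eq (h'.isStalkApprox_stalk n M)]

lemma stalkCls_succ {n : ℤ} {Z : D'} (hZ : IsStalkUpToProj F' s' n Z) :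
    h'.stalkCls (n + 1) Z = F'.omega (h'.stalkCls n Z) := by
  obtain ⟨P, M, a, b, c, hT, hP, hM⟩ := h'.exists_cls_eq_of_isStalkUpToProj hZ
  rw [h'.stalkCls_of_distTriang hT (hP.mono (by lia)), hM]
  exact h'.stalkCls_stalk n 1 M

variable (F) in
/-- For a functor `G` to `D'` that sends `F`-projectives to objects of relative projective
dimension at most `n`, the homomorphism `K_F ⟶ K_F'` given by the classes in degree `n`. -/
noncomputable def kGroupMap (n : ℤ) (G : C ⥤ D') [G.Additive]
    (hG : ∀ Q, F.IsProj Q → ProjDimLE s' n (G.obj Q)) : F.KGroup →+ F'.KGroup :=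
  F.kGroupLift (fun M => h'.stalkCls n (G.obj M))
    (fun _ X Y e => by
      have := preservesBinaryBiproducts_of_preservesBiproducts G
      rw [← h'.stalkCls_biprod]
      exact h'.stalkCls_eq_of_iso _ (G.mapIso e ≪≫ G.mapBiprod X Y))
    (fun Q hQ => h'.stalkCls_eq_zero (hG Q hQ))

@[simp]
lemma kGroupMap_cls (n : ℤ) (G : C ⥤ D') [G.Additive]
    (hG : ∀ Q, F.IsProj Q → ProjDimLE s' n (G.obj Q)) (M : C) :
    h'.kGroupMap F n G hG (F.cls M) = h'.stalkCls n (G.obj M) :=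
  ExtSubfunctor.kGroupLift_cls _ _ _ M

variable [F.EnoughProj] [s.Additive]

include h in
lemma kGroupMap_omega (n : ℤ) (L : D ⥤ D') [L.CommShift ℤ] [L.IsTriangulated]
    (hL : ∀ Q, F.IsProj Q → ProjDimLE s' n ((s ⋙ L).obj Q))
    (hL' : ∀ M, IsStalkUpToProj F' s' n (L.obj (s.obj M))) (x : F.KGroup) :
    h'.kGroupMap F n (s ⋙ L) hL (F.omega x) = F'.omega (h'.kGroupMap F n (s ⋙ L) hL x) := by
  have hcls : (h'.kGroupMap F n (s ⋙ L) hL).comp F.omega =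
      F'.omega.comp (h'.kGroupMap F n (s ⋙ L) hL) :=
    ExtSubfunctor.kGroup_hom_ext fun M => by
      obtain ⟨K, Q, i, p, w, hE, hQ⟩ := ExtSubfunctor.EnoughProj.exists_isExact (F := F) M
      simp only [AddMonoidHom.comp_apply, F.omega_cls i p w hE hQ, kGroupMap_cls,
        Functor.comp_obj]
      rw [← h'.stalkCls_succ (hL' M), h.stalkCls_succ_obj h' hE (hL Q hQ)]
  exact DFunLike.congr_fun hcls x

end IsStalkFunctor

end StalkCls

section Comparison

variable {C : Type*} [Category* C] [Abelian C] [HasExt.{w} C] {F : ExtSubfunctor.{w} C}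
  [F.EnoughProj] {D : Type*} [Category* D] [Preadditive D] [HasZeroObject D] [HasShift D ℤ]
  [∀ n : ℤ, (shiftFunctor D n).Additive] [Pretriangulated D] [IsTriangulated D] {s : C ⥤ D}
  (h : IsStalkFunctor F s)
  {C' : Type*} [Category* C'] [Abelian C'] [HasExt.{v} C'] {F' : ExtSubfunctor.{v} C'}
  {D' : Type*} [Category* D'] [Preadditive D'] [HasZeroObject D'] [HasShift D' ℤ]
  [∀ n : ℤ, (shiftFunctor D' n).Additive] [Pretriangulated D'] {s' : C' ⥤ D'}
  (E : D ≌ D') [E.functor.CommShift ℤ] [E.inverse.CommShift ℤ]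
  [E.IsTriangulated] {a b : ℤ}

namespace IsStalkFunctor

include h in
lemma homologyLE_functor_obj (ha : ∀ Q, F.IsProj Q → ProjDimLE s' a (E.functor.obj (s.obj Q)))
    (M : C) : HomologyLE F' s' a (E.functor.obj (s.obj M)) := fun Q _ k hk => by
  have hM : HomologyLE F s 0 (s.obj M) := fun R hR j hj =>
    (h.proj_orth hR hj.ne').of_iso_right ((shiftFunctorZero D ℤ).symm.app _)
  have hQ : HomologyGE F s (0 + 1) ((E.inverse.obj (s'.obj Q))⟦k⟧) := fun R hR j hj =>
    ((homologyGE_obj_of_adj E.toAdjunction ha Q).shift k (k - a) (by lia)) R hR j (by lia)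
  exact (orth_obj_iff E.symm.toAdjunction).1
    ((h.homologyGE_orth_homologyLE hQ hM).of_iso_left ((E.inverse.commShiftIso k).app _))

variable [s.Additive] [F'.EnoughProj] [IsTriangulated D'] [s'.Additive]
  (h' : IsStalkFunctor F' s')

lemma kGroupMap_kGroupMap (ha : ∀ Q, F.IsProj Q → ProjDimLE s' a ((s ⋙ E.functor).obj Q))
    (hb : ∀ Q, F'.IsProj Q → ProjDimLE s b ((s' ⋙ E.inverse).obj Q))
    (hE : ∀ M, IsStalkUpToProj F' s' a (E.functor.obj (s.obj M))) (t : ℕ) (ht : a + b = t)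
    (x : F.KGroup) :
    h.kGroupMap F' b (s' ⋙ E.inverse) hb (h'.kGroupMap F a (s ⋙ E.functor) ha x) =
      F.omega^[t] x := by
  let Ω : AddMonoid.End F.KGroup := F.omega
  suffices (h.kGroupMap F' b (s' ⋙ E.inverse) hb).comp (h'.kGroupMap F a (s ⋙ E.functor) ha) =
    Ω ^ t from DFunLike.congr_fun this x
  refine ExtSubfunctor.kGroup_hom_ext fun M => ?_
  obtain ⟨P, M', f, g, e, hT, hP, hM'⟩ := h'.exists_cls_eq_of_isStalkUpToProj (hE M)
  have hP' : ProjDimLE s (a + b - 1) (E.inverse.obj P) := by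
    rw [show a + b - 1 = a - 1 + b by ring]
    exact h'.projDimLE_obj_of_adj E.symm.toAdjunction hb hP
  calc h.kGroupMap F' b (s' ⋙ E.inverse) hb (h'.kGroupMap F a (s ⋙ E.functor) ha (F.cls M))
    _ = h.stalkCls b (E.inverse.obj (s'.obj M')) := by
      rw [kGroupMap_cls, Functor.comp_obj, hM', kGroupMap_cls, Functor.comp_obj]
    _ = h.stalkCls (a + b) (E.inverse.obj ((s'.obj M')⟦a⟧)) := by
      rw [h.stalkCls_obj_shift E.inverse b a _ (add_comm a b)]
    _ = h.stalkCls (a + b) (E.inverse.obj (E.functor.obj (s.obj M))) :=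
      (h.stalkCls_of_distTriang (DistTriang.map E.inverse hT) hP').symm
    _ = h.stalkCls (0 + t) ((s.obj M)⟦(0 : ℤ)⟧) := by
      rw [ht, zero_add]
      exact h.stalkCls_eq_of_iso _
        ((E.unitIso.symm ≪≫ (shiftFunctorZero D ℤ).symm).app (s.obj M))
    _ = (Ω ^ t) (F.cls M) := h.stalkCls_stalk 0 t M

include h h' in
theorem phiDim_le_add [∀ M : C', IsNoetherianObject M]
    (ha : ∀ Q, F.IsProj Q → ProjDimLE s' a (E.functor.obj (s.obj Q)))
    (hb : ∀ Q, F'.IsProj Q → ProjDimLE s b (E.inverse.obj (s'.obj Q)))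
    (hE : ∀ M, IsStalkUpToProj F' s' a (E.functor.obj (s.obj M))) (t : ℕ) (ht : a + b = t) :
    F.phiDim ≤ F'.phiDim + t :=
  ExtSubfunctor.phiDim_le_of_retraction _ _ t (h.kGroupMap_omega h' a E.functor ha hE)
    (h.kGroupMap_kGroupMap E h' ha hb hE t ht)

end IsStalkFunctor

end Comparison

section SplitStalk

variable {C : Type*} [Category* C] {D : Type*} [Category* D] [Preadditive D] [HasZeroObject D]
  [HasShift D ℤ] [∀ n : ℤ, (shiftFunctor D n).Additive] [Pretriangulated D]

/-- The properties of the functor from `C` to its bounded homotopy category that sends an object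
to the complex concentrated in degree `0`. -/
structure IsSplitStalkFunctor (s : C ⥤ D) : Prop where
  full : s.Full
  faithful : s.Faithful
  orth (M N : C) (n : ℤ) (hn : n ≠ 0) : Orth (s.obj M) ((s.obj N)⟦n⟧)
  generates (Z : D) : ExtClosure (stalks s ⊤ fun _ => True) Z

namespace IsSplitStalkFunctor

variable {s : C ⥤ D} (h : IsSplitStalkFunctor s)

include h

lemma stalk_orth (M N : C) {k n : ℤ} (hkn : k ≠ n) : Orth ((s.obj M)⟦k⟧) ((s.obj N)⟦n⟧) :=
  (Orth.shift_iff _ _ k n (n - k) (by lia)).2 (h.orth M N _ (by lia))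

lemma eq_zero_or_exists_map {Q Z : C} {n : ℤ} (a : (s.obj Q)⟦n⟧ ⟶ s.obj Z) :
    a = 0 ∨ ∃ (σ : (s.obj Q)⟦n⟧ ≅ s.obj Q) (f : Q ⟶ Z), a = σ.hom ≫ s.map f := by
  have := h.full
  obtain rfl | hn := eq_or_ne n 0
  · let σ : (s.obj Q)⟦(0 : ℤ)⟧ ≅ s.obj Q := (shiftFunctorZero D ℤ).app _
    obtain ⟨f, hf⟩ := s.map_surjective (σ.inv ≫ a)
    exact .inr ⟨σ, f, by rw [hf, σ.hom_inv_id_assoc]⟩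
  · exact .inl ((h.stalk_orth Q Z hn).of_iso_right ((shiftFunctorZero D ℤ).symm.app _) a)

lemma exists_orth (U : D) : ∃ n : ℤ, ∀ (M : C) (k : ℤ), n ≤ k → Orth ((s.obj M)⟦k⟧) U := by
  induction h.generates U with
  | of _ hX =>
    obtain ⟨N, n, -, -, ⟨e⟩⟩ := hX
    exact ⟨n + 1, fun M k hk => (h.stalk_orth M N (by lia)).of_iso_right e⟩
  | zero _ hX => exact ⟨0, fun _ _ _ _ => hX.eq_of_tgt _ _⟩
  | ext _ hT _ _ h₁ h₃ =>
    obtain ⟨n₁, h₁⟩ := h₁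
    obtain ⟨n₃, h₃⟩ := h₃
    exact ⟨max n₁ n₃, fun M k hk => DistTriang.orth_right hT (h₁ M k (le_of_max_le_left hk))
      (h₃ M k (le_of_max_le_right hk))⟩

lemma exists_lift {Y Z Q : C} {p : Y ⟶ Z} {E : D} {j : s.obj Y ⟶ E} {e : E ⟶ s.obj Z}
    (he : j ≫ e = s.map p) (hp : ∀ f : Q ⟶ Z, ∃ g, g ≫ p = f) {n : ℤ}
    (a : (s.obj Q)⟦n⟧ ⟶ s.obj Z) : ∃ b, b ≫ e = a := by
  obtain rfl | ⟨σ, f, rfl⟩ := h.eq_zero_or_exists_map a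
  · exact ⟨0, zero_comp⟩
  · obtain ⟨g, rfl⟩ := hp f
    exact ⟨σ.hom ≫ s.map g ≫ j, by simp [he]⟩

end IsSplitStalkFunctor

end SplitStalk

namespace IsSplitStalkFunctor

variable {C : Type*} [Category* C] [Abelian C] {D : Type*} [Category* D] [Preadditive D]
  [HasZeroObject D] [HasShift D ℤ] [∀ n : ℤ, (shiftFunctor D n).Additive] [Pretriangulated D]
  {s : C ⥤ D} [s.Additive] (h : IsSplitStalkFunctor s)

include h

lemma comp_cone_eq_zero {Q X Y : C} {i : X ⟶ Y} [Mono i] {E : D} {j : s.obj Y ⟶ E}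
    {c : E ⟶ (s.obj X)⟦(1 : ℤ)⟧} (hT : DistTriang (s.map i) j c) {n : ℤ}
    (a : (s.obj Q)⟦n⟧ ⟶ E) : a ≫ c = 0 := by
  have := h.full
  have := h.faithful
  obtain rfl | hn := eq_or_ne n 1
  · obtain ⟨u, hu⟩ := (s ⋙ shiftFunctor D (1 : ℤ)).map_surjective (a ≫ c)
    have hui : u ≫ i = 0 := (s ⋙ shiftFunctor D (1 : ℤ)).map_injective (by
      rw [Functor.map_comp, hu, Functor.comp_map, Category.assoc, hT.comp₃₁, comp_zero,
        Functor.map_zero])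
    rw [← hu, zero_of_comp_mono i hui, Functor.map_zero]
  · exact h.stalk_orth Q X hn _

lemma eq_zero_of_comp_eq_zero {S : ShortComplex C} (hS : S.ShortExact) {E : D}
    {j : s.obj S.X₂ ⟶ E} {c : E ⟶ (s.obj S.X₁)⟦(1 : ℤ)⟧} (hT : DistTriang (s.map S.f) j c)
    {e : E ⟶ s.obj S.X₃} (he : j ≫ e = s.map S.g) {Q : C} {n : ℤ} {a : (s.obj Q)⟦n⟧ ⟶ E}
    (ha : a ≫ e = 0) : a = 0 := by
  have := h.faithful
  have := hS.mono_f
  obtain ⟨b, rfl⟩ := hT.lift₃ a (h.comp_cone_eq_zero hT a)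
  obtain rfl | ⟨σ, v, rfl⟩ := h.eq_zero_or_exists_map b
  · exact zero_comp
  · have hv : v ≫ S.g = 0 := s.map_injective (by
      rwa [s.map_comp, s.map_zero, ← he, ← cancel_epi σ.hom, comp_zero, ← Category.assoc,
        ← Category.assoc])
    rw [← hS.exact.lift_f v hv, s.map_comp, Category.assoc, Category.assoc, hT.comp₁₂, comp_zero,
      comp_zero]

variable [HasExt.{w} C] {F : ExtSubfunctor.{w} C} {𝒜 : ObjectProperty D}
  (h𝒜 : ∀ W, 𝒜 W ↔ ∀ Q, F.IsProj Q → ∀ k : ℤ, Orth ((s.obj Q)⟦k⟧) W)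
  {S : ShortComplex C} (hS : F.IsExact S)

include h𝒜 hS

lemma exists_cone_of_isExact : ∃ (E : D) (j : s.obj S.X₂ ⟶ E) (c : E ⟶ (s.obj S.X₁)⟦(1 : ℤ)⟧)
    (e : E ⟶ s.obj S.X₃), DistTriang (s.map S.f) j c ∧ j ≫ e = s.map S.g ∧ 𝒜.trW e := by
  obtain ⟨E, j, c, hT⟩ := DistTriang.exists_cone (s.map S.f)
  obtain ⟨e, he⟩ := hT.desc₂ (s.map S.g) (by rw [← s.map_comp, S.zero, s.map_zero])
  obtain ⟨W, _, _, hW⟩ := DistTriang.exists_cone e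
  refine ⟨E, j, c, e, hT, he, trW.mk 𝒜 hW ((h𝒜 W).2 fun Q hQ => hW.orth_of_bijective fun k => ?_)⟩
  refine ⟨fun a b hab => sub_eq_zero.1 (h.eq_zero_of_comp_eq_zero hS.1 hT he ?_),
    h.exists_lift he (hQ S hS)⟩
  simpa only [Preadditive.sub_comp, sub_eq_zero] using hab

lemma exists_cone_map_g [IsTriangulated D] [𝒜.IsStableUnderShift ℤ] :
    ∃ (V : D) (c : s.obj S.X₃ ⟶ V) (d : V ⟶ (s.obj S.X₂)⟦(1 : ℤ)⟧)
      (a : (s.obj S.X₁)⟦(1 : ℤ)⟧ ⟶ V), DistTriang (s.map S.g) c d ∧ 𝒜.trW a := by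
  obtain ⟨E, j, c, e, hT, he, hW⟩ := h.exists_cone_of_isExact h𝒜 hS
  obtain ⟨W, g, k, hT', hW⟩ := (𝒜.trW_iff e).1 hW
  obtain ⟨V, c', d', a, b, hT₁, hT₂⟩ := hT.rotate.octahedron hT'
  exact ⟨V, c', d', a, he ▸ hT₁, trW.mk 𝒜 hT₂ hW⟩

end IsSplitStalkFunctor

section Localization

variable {C : Type*} [Category* C] [Abelian C] [HasExt.{w} C] {F : ExtSubfunctor.{w} C}
  {D : Type*} [Category* D] [Preadditive D] [HasShift D ℤ] {s : C ⥤ D} {𝒜 : ObjectProperty D}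

lemma leftOrthogonal_shift_obj
    (h𝒜 : ∀ W, 𝒜 W ↔ ∀ Q, F.IsProj Q → ∀ k : ℤ, Orth ((s.obj Q)⟦k⟧) W) {Q : C}
    (hQ : F.IsProj Q) (k : ℤ) : 𝒜.leftOrthogonal ((s.obj Q)⟦k⟧) :=
  fun W f hW => (h𝒜 W).1 hW Q hQ k f

lemma leftOrthogonal_obj
    (h𝒜 : ∀ W, 𝒜 W ↔ ∀ Q, F.IsProj Q → ∀ k : ℤ, Orth ((s.obj Q)⟦k⟧) W) {Q : C}
    (hQ : F.IsProj Q) : 𝒜.leftOrthogonal (s.obj Q) :=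
  𝒜.leftOrthogonal.prop_of_iso ((shiftFunctorZero D ℤ).app _) (leftOrthogonal_shift_obj h𝒜 hQ 0)

namespace IsSplitStalkFunctor

variable [HasZeroObject D] [∀ n : ℤ, (shiftFunctor D n).Additive] [Pretriangulated D]
  {D' : Type*} [Category* D'] [Preadditive D'] [HasZeroObject D'] [HasShift D' ℤ]
  [∀ n : ℤ, (shiftFunctor D' n).Additive] [Pretriangulated D']
  (h : IsSplitStalkFunctor s) [s.Additive]
  (h𝒜 : ∀ W, 𝒜 W ↔ ∀ Q, F.IsProj Q → ∀ k : ℤ, Orth ((s.obj Q)⟦k⟧) W)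
  (q : D ⥤ D') [q.CommShift ℤ] [q.IsTriangulated] [q.IsLocalization 𝒜.trW]

include h h𝒜

lemma localization_exists_distTriang {X Y Z : C} (i : X ⟶ Y) (p : Y ⟶ Z) (w : i ≫ p = 0)
    (hE : F.IsExact (ShortComplex.mk i p w)) :
    ∃ δ : (s ⋙ q).obj Z ⟶ ((s ⋙ q).obj X)⟦(1 : ℤ)⟧,
      DistTriang ((s ⋙ q).map i) ((s ⋙ q).map p) δ := by
  obtain ⟨E, j, c, e, hT, he, hW⟩ := h.exists_cone_of_isExact h𝒜 hE
  have : IsIso (q.map e) := Localization.inverts q 𝒜.trW _ hW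
  exact ⟨inv (q.map e) ≫ q.map c ≫ (q.commShiftIso (1 : ℤ)).hom.app _,
    (hT.map q).of_iso (Iso.refl _) (Iso.refl _) (asIso (q.map e)).symm (by simp) (by simp [← he])
      (by simp)⟩

variable [IsTriangulated D] [𝒜.IsTriangulated]

lemma localization_map_eq_zero [F.EnoughProj] (U : D) (n : ℤ)
    (hU : ∀ Q, F.IsProj Q → ∀ k, n ≤ k → Orth ((s.obj Q)⟦k⟧) U)
    {M : C} (f : (s.obj M)⟦n⟧ ⟶ U) : q.map f = 0 := by
  obtain ⟨m, hm⟩ := h.exists_orth U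
  obtain ⟨d, hd⟩ : ∃ d : ℕ, m ≤ n + d := ⟨(m - n).toNat, by lia⟩
  induction d generalizing n M with
  | zero => rw [hm M n (by simpa using hd) f, q.map_zero]
  | succ d ih =>
    obtain ⟨K, Q, i, p, w, hE, hQ⟩ := ExtSubfunctor.EnoughProj.exists_isExact (F := F) M
    obtain ⟨V, c, d, a, hT, ha⟩ := h.exists_cone_map_g h𝒜 hE
    obtain ⟨_, hTn⟩ := hT.exists_shift n
    obtain ⟨f', rfl⟩ := hTn.desc₂ f (hU Q hQ n le_rfl _)
    have : IsIso (q.map (a⟦n⟧')) := Localization.inverts q 𝒜.trW _ (trW.shift ha n)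
    have σ : (s.obj K)⟦n + 1⟧ ≅ (s.obj K)⟦(1 : ℤ)⟧⟦n⟧ :=
      (shiftFunctorAdd' D 1 n (n + 1) (by lia)).app _
    have hσ : q.map (σ.hom ≫ a⟦n⟧' ≫ f') = 0 :=
      ih (n + 1) (fun Q hQ k hk => hU Q hQ k (by lia)) _ (by push_cast at hd; lia)
    have hf' : q.map f' = 0 := by
      rwa [q.map_comp, q.map_comp, ← comp_zero (f := q.map σ.hom), cancel_epi,
        ← comp_zero (f := q.map (a⟦n⟧')), cancel_epi] at hσ
    rw [q.map_comp, hf', comp_zero]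

lemma localization_orth_of_proj [F.EnoughProj] (Z : D') (n : ℤ)
    (hZ : ∀ Q, F.IsProj Q → ∀ k, n ≤ k → Orth (((s ⋙ q).obj Q)⟦k⟧) Z) (M : C) :
    Orth (((s ⋙ q).obj M)⟦n⟧) Z := by
  refine Orth.of_iso_left ?_ ((q.commShiftIso n).symm.app (s.obj M))
  have := Localization.essSurj q 𝒜.trW
  let e : q.obj (q.objPreimage Z) ≅ Z := q.objObjPreimageIso Z
  refine Orth.of_iso_right (fun f => ?_) e.symm
  obtain ⟨φ, hφ⟩ := Localization.exists_leftFraction q 𝒜.trW f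
  have : IsIso (q.map φ.s) := Localization.inverts q 𝒜.trW _ φ.hs
  rw [hφ, ← cancel_mono (q.map φ.s), MorphismProperty.LeftFraction.map_comp_map_s, zero_comp]
  refine h.localization_map_eq_zero h𝒜 q _ n (fun Q hQ k hk g => ?_) _
  apply (leftOrthogonal.map_bijective_of_isTriangulated
    (leftOrthogonal_shift_obj h𝒜 hQ k) q _).1
  rw [q.map_zero]
  exact ((hZ Q hQ k hk).of_iso_left ((q.commShiftIso k).app (s.obj Q))).of_iso_right
    ((asIso (q.map φ.s)).symm ≪≫ e) _

theorem isStalkFunctor_localization [F.EnoughProj] : IsStalkFunctor F (s ⋙ q) where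
  exists_distTriang := h.localization_exists_distTriang h𝒜 q
  map_bijective Q N hQ := by
    have := h.full
    have := h.faithful
    exact (leftOrthogonal.map_bijective_of_isTriangulated (leftOrthogonal_obj h𝒜 hQ) q _).comp
      ⟨s.map_injective, s.map_surjective⟩
  orth Q N hQ n hn := by
    refine Orth.of_iso_right (fun f => ?_) ((q.commShiftIso n).symm.app (s.obj N))
    obtain ⟨a, rfl⟩ :=
      (leftOrthogonal.map_bijective_of_isTriangulated (leftOrthogonal_obj h𝒜 hQ) q _).2 f
    rw [h.orth Q N n hn a, q.map_zero]
  orth_of_proj := h.localization_orth_of_proj h𝒜 q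
  generates Z := by
    have := Localization.essSurj q 𝒜.trW
    refine (ExtClosure _).prop_of_iso (q.objObjPreimageIso Z)
      (ExtClosure.map q ?_ (h.generates (q.objPreimage Z)))
    rintro _ ⟨M, n, -, -, ⟨e⟩⟩
    exact ⟨M, n, trivial, trivial, ⟨q.mapIso e ≪≫ (q.commShiftIso n).app _⟩⟩

end IsSplitStalkFunctor

end Localization

lemma orth_map_iff {D : Type*} [Category* D] [Preadditive D] {D' : Type*} [Category* D']
    [Preadditive D'] (L : D ⥤ D') [L.Full] [L.Faithful] [L.PreservesZeroMorphisms] {X Y : D} :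
    Orth (L.obj X) (L.obj Y) ↔ Orth X Y := by
  refine ⟨fun h f => L.map_injective ((h _).trans (L.map_zero _ _).symm), fun h f => ?_⟩
  obtain ⟨g, rfl⟩ := L.map_surjective f
  rw [h g, L.map_zero]

lemma DistTriang.exists_of_ι {D : Type*} [Category* D] [Preadditive D] [HasZeroObject D]
    [HasShift D ℤ] [∀ n : ℤ, (shiftFunctor D n).Additive] [Pretriangulated D]
    (P : ObjectProperty D) [P.IsTriangulated] {X Y Z : P.FullSubcategory} {f : X.obj ⟶ Y.obj}
    {g : Y.obj ⟶ Z.obj} {h : Z.obj ⟶ X.obj⟦(1 : ℤ)⟧} (hT : DistTriang f g h) :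
    ∃ (f' : X ⟶ Y) (g' : Y ⟶ Z) (h' : Z ⟶ X⟦(1 : ℤ)⟧), DistTriang f' g' h' := by
  obtain ⟨h', hh'⟩ := P.ι.map_surjective (h ≫ (P.ι.commShiftIso (1 : ℤ)).inv.app X)
  have e : P.ι.map h' ≫ (P.ι.commShiftIso (1 : ℤ)).hom.app X = h := by
    rw [hh', Category.assoc, Iso.inv_hom_id_app]
    exact Category.comp_id h
  have : DistTriang f g (P.ι.map h' ≫ (P.ι.commShiftIso (1 : ℤ)).hom.app X) := by rwa [e]
  exact ⟨homMk f, homMk g, h', this⟩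

section StalkKb

variable {C : Type*} [Category* C] [Abelian C]

section Cokernel

variable {K L : CochainComplex C ℤ} (φ : K ⟶ L) {i : ℤ}

lemma epi_cokernel_π_f (i : ℤ) : Epi ((cokernel.π φ).f i) :=
  inferInstanceAs (Epi ((HomologicalComplex.eval C (.up ℤ) i).map (cokernel.π φ)))

lemma isZero_cokernel_X [Epi (φ.f i)] : IsZero ((cokernel φ).X i) := by
  have hπ : (cokernel.π φ).f i = 0 := by
    rw [← cancel_epi (φ.f i), ← HomologicalComplex.comp_f, cokernel.condition, comp_zero,
      HomologicalComplex.zero_f]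
  have := epi_cokernel_π_f φ i
  rw [IsZero.iff_id_eq_zero, ← cancel_epi ((cokernel.π φ).f i), hπ, zero_comp, zero_comp]

lemma isIso_cokernel_π_f (hi : IsZero (K.X i)) : IsIso ((cokernel.π φ).f i) := by
  have := epi_cokernel_π_f φ i
  have : Mono ((cokernel.π φ).f i) :=
    ((ShortComplex.exact_cokernel φ).map (HomologicalComplex.eval C (.up ℤ) i)).mono_g
      (hi.eq_of_src _ _)
  exact isIso_of_mono_of_epi _

end Cokernel

variable (C) in
/-- The functor sending an object to its stalk complex, in the bounded homotopy category. -/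
noncomputable def stalkKb : C ⥤ Kb C :=
  (bounded C).lift (HomotopyCategory.singleFunctor C 0) isBoundedCpx_single

instance : (stalkKb C).Additive where
  map_add := (bounded C).ι.map_injective (HomotopyCategory.singleFunctor C 0).map_add

instance : (stalkKb C).Full :=
  have : (HomotopyCategory.singleFunctor C 0).Full :=
    inferInstanceAs (CochainComplex.singleFunctor C 0 ⋙ HomotopyCategory.quotient C (.up ℤ)).Full
  Functor.Full.of_comp_faithful_iso
    ((bounded C).liftCompιIso (HomotopyCategory.singleFunctor C 0) isBoundedCpx_single)

instance : (stalkKb C).Faithful :=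
  Functor.Faithful.of_comp_iso (H := 𝟭 C)
    (G := (bounded C).ι ⋙ HomotopyCategory.homologyFunctor C (.up ℤ) 0)
    (Functor.isoWhiskerLeft (CochainComplex.singleFunctor C 0)
      (HomotopyCategory.homologyFunctorFactors C (.up ℤ) 0) ≪≫
        HomologicalComplex.homologyFunctorSingleIso C (.up ℤ) 0)

/-- A bounded complex, as an object of the bounded homotopy category. -/
def toKb (K : CochainComplex C ℤ) (hK : IsBoundedCpx K) : Kb C :=
  ⟨(HomotopyCategory.quotient C (.up ℤ)).obj K, hK⟩

lemma isZero_toKb {K : CochainComplex C ℤ} (h : ∀ i, IsZero (K.X i)) (hK : IsBoundedCpx K) :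
    IsZero (toKb K hK) := by
  have hK₀ : IsZero K := by
    rw [IsZero.iff_id_eq_zero]
    ext i
    exact (h i).eq_of_src _ _
  rw [IsZero.iff_id_eq_zero]
  exact (bounded C).ι.map_injective
    (((HomotopyCategory.quotient C (.up ℤ)).map_isZero hK₀).eq_of_src _ _)

/-- In the homotopy category, the `n`-th shift of a stalk complex is the stalk in degree `-n`. -/
noncomputable def stalkKbShiftIso (M : C) (n m : ℤ) (h : n + m = 0) :
    (((stalkKb C).obj M)⟦n⟧).obj ≅ (HomotopyCategory.singleFunctor C m).obj M :=
  ((bounded C).ι.commShiftIso n).app _ ≪≫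
    ((HomotopyCategory.singleFunctors C).shiftIso n m 0 h).app M

lemma orth_singleFunctor (M N : C) {m n : ℤ} (h : m ≠ n) :
    Orth ((HomotopyCategory.singleFunctor C m).obj M)
      ((HomotopyCategory.singleFunctor C n).obj N) := fun f => by
  obtain ⟨φ, rfl⟩ := (HomotopyCategory.quotient C (.up ℤ)).map_surjective
    (X := (CochainComplex.singleFunctor C m).obj M)
    (Y := (CochainComplex.singleFunctor C n).obj N) f
  have hφ : φ = 0 := HomologicalComplex.from_single_hom_ext
    ((HomologicalComplex.isZero_single_obj_X (.up ℤ) n N m h).eq_of_tgt _ _)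
  rw [hφ, Functor.map_zero]
  rfl

lemma exists_distTriang_toKb {S : ShortComplex (CochainComplex C ℤ)}
    (σ : ∀ n, (S.map (HomologicalComplex.eval C _ n)).Splitting)
    (h₁ : IsBoundedCpx S.X₁) (h₂ : IsBoundedCpx S.X₂) (h₃ : IsBoundedCpx S.X₃) :
    ∃ (f : toKb S.X₁ h₁ ⟶ toKb S.X₂ h₂) (g : toKb S.X₂ h₂ ⟶ toKb S.X₃ h₃)
      (k : toKb S.X₃ h₃ ⟶ (toKb S.X₁ h₁)⟦(1 : ℤ)⟧), DistTriang f g k :=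
  DistTriang.exists_of_ι (bounded C)
    ((HomotopyCategory.distinguished_iff_iso_trianglehOfDegreewiseSplit _).2
      ⟨S, σ, ⟨Iso.refl _⟩⟩)

lemma exists_distTriang_brutal_truncation (K : CochainComplex C ℤ) (hK : IsBoundedCpx K) {b : ℤ}
    (hb : IsZero (K.X (b + 1))) :
    ∃ (K' : CochainComplex C ℤ) (hK' : IsBoundedCpx K')
      (f : ((stalkKb C).obj (K.X b))⟦-b⟧ ⟶ toKb K hK) (g : toKb K hK ⟶ toKb K' hK')
      (k : toKb K' hK' ⟶ ((stalkKb C).obj (K.X b))⟦-b⟧⟦(1 : ℤ)⟧), DistTriang f g k ∧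
      IsZero (K'.X b) ∧ ∀ i, i ≠ b → Nonempty (K.X i ≅ K'.X i) := by
  let φ : (HomologicalComplex.single C (.up ℤ) b).obj (K.X b) ⟶ K :=
    HomologicalComplex.mkHomFromSingle (𝟙 _) fun i hi => by
      obtain rfl : b + 1 = i := hi
      exact hb.eq_of_tgt _ _
  have hφb : IsIso (φ.f b) := by
    rw [HomologicalComplex.mkHomFromSingle_f]
    infer_instance
  have hφ (i : ℤ) (hi : i ≠ b) :
      IsZero (((HomologicalComplex.single C (.up ℤ) b).obj (K.X b)).X i) :=
    HomologicalComplex.isZero_single_obj_X _ _ _ _ hi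
  have hπb : IsZero ((cokernel φ).X b) := isZero_cokernel_X φ
  have hπ (i : ℤ) (hi : i ≠ b) : IsIso ((cokernel.π φ).f i) := isIso_cokernel_π_f φ (hφ i hi)
  let S : ShortComplex (CochainComplex C ℤ) := .mk φ (cokernel.π φ) (cokernel.condition φ)
  let σ (i : ℤ) : (S.map (HomologicalComplex.eval C _ i)).Splitting :=
    if hi : i = b then .ofIsIsoOfIsZero _ (by subst hi; exact hφb) (by subst hi; exact hπb)
    else .ofIsZeroOfIsIso _ (hφ i hi) (hπ i hi)
  have hK' : IsBoundedCpx (cokernel φ) := by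
    obtain ⟨l, r, hlr⟩ := hK
    refine ⟨l, r, fun i hi => ?_⟩
    have : Epi (S.map (HomologicalComplex.eval C _ i)).g := epi_cokernel_π_f φ i
    exact (hlr i hi).of_epi ((cokernel.π φ).f i)
  have hS : IsBoundedCpx S.X₁ := ⟨b, b, fun i hi => hφ i (by lia)⟩
  obtain ⟨f, g, k, hT⟩ := exists_distTriang_toKb σ hS hK hK'
  let e : ((stalkKb C).obj (K.X b))⟦-b⟧ ≅ toKb S.X₁ hS :=
    (bounded C).fullyFaithfulι.preimageIso (stalkKbShiftIso _ _ _ (by lia))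
  refine ⟨cokernel φ, hK', e.hom ≫ f, g, k ≫ e.inv⟦(1 : ℤ)⟧', ?_, hπb, fun i hi => ?_⟩
  · exact hT.of_iso e (.refl _) (.refl _) (Category.comp_id _)
      ((Category.comp_id _).trans (Category.id_comp _).symm) (by simp [← Functor.map_comp])
  · have := hπ i hi
    exact ⟨asIso ((cokernel.π φ).f i)⟩

lemma extClosure_toKb {P : ObjectProperty C} [P.IsClosedUnderIsomorphisms]
    (K : CochainComplex C ℤ) (a : ℤ) (d : ℕ) (hK : ∀ i, i < a ∨ a + d ≤ i → IsZero (K.X i))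
    (hP : ∀ i, a ≤ i → i < a + d → P (K.X i)) (hK' : IsBoundedCpx K) :
    ExtClosure (stalks (stalkKb C) P (fun n => -(a + d) < n ∧ n ≤ -a)) (toKb K hK') := by
  induction d generalizing K with
  | zero => exact .zero _ (isZero_toKb (fun i => hK i (by lia)) hK')
  | succ d ih =>
    obtain ⟨K', hK'', f, g, k, hT, hz, hiso⟩ := exists_distTriang_brutal_truncation K hK'
      (b := a + d) (hK _ (by push_cast; lia))
    refine .ext _ hT (.of _ (stalks_obj (hP _ (by lia) (by lia)) (by lia)))
      (extClosure_le ?_ _ (ih K' (fun i hi => ?_) (fun i hi hi' => ?_) hK''))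
    · rintro _ ⟨M, n, hM, hn, e⟩
      exact .of _ ⟨M, n, hM, by push_cast; lia, e⟩
    · obtain rfl | hib := eq_or_ne i (a + d)
      · exact hz
      · exact (hK i (by push_cast; lia)).of_iso (hiso i hib).some.symm
    · exact P.prop_of_iso (hiso i (by lia)).some (hP i hi (by lia))

variable (C) in
lemma isSplitStalkFunctor_stalkKb : IsSplitStalkFunctor (stalkKb C) where
  full := inferInstance
  faithful := inferInstance
  orth M N n hn := (orth_map_iff (bounded C).ι).1
    ((orth_singleFunctor M N (m := 0) (n := -n) (by lia)).of_iso_right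
      (stalkKbShiftIso N n (-n) (by lia)))
  generates Z := by
    obtain ⟨X, a, b, hX⟩ := Z
    obtain ⟨K, rfl⟩ := HomotopyCategory.quotient_obj_surjective X
    refine extClosure_le ?_ _ (extClosure_toKb (P := ⊤) K a (b + 1 - a).toNat
      (fun i hi => hX i (by lia)) (fun _ _ _ => trivial) ⟨a, b, hX⟩)
    rintro _ ⟨M, n, hM, -, e⟩
    exact .of _ ⟨M, n, hM, trivial, e⟩

variable [HasExt.{w} C] (F : ExtSubfunctor.{w} C)

instance : F.IsProj.IsClosedUnderIsomorphisms where
  of_iso e h := h.of_retract (.ofIso e.symm)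

variable [F.EnoughProj]

lemma acyclic_iff_orth (W : Kb C) : F.acyclic.inverseImage (bounded C).ι W ↔
    ∀ Q, F.IsProj Q → ∀ k : ℤ, Orth (((stalkKb C).obj Q)⟦k⟧) W := by
  rw [prop_inverseImage_iff, F.acyclic_eq_rightOrthogonal]
  constructor
  · exact fun h Q hQ k => (orth_map_iff (bounded C).ι).1 fun f =>
      h f ⟨Q, -k, hQ, ⟨stalkKbShiftIso Q k (-k) (by lia)⟩⟩
  · rintro h X f ⟨Q, n, hQ, ⟨e⟩⟩
    exact ((orth_map_iff (bounded C).ι).2 (h Q hQ (-n))).of_iso_left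
      (e ≪≫ (stalkKbShiftIso Q (-n) n (by lia)).symm) f

/-- The localization functor from `K^b(C)` to the relative bounded derived category. -/
noncomputable abbrev locDb : Kb C ⥤ F.Db := (F.acyclic.inverseImage (bounded C).ι).trW.Q

/-- The functor sending an object to its stalk complex, in the relative bounded derived
category. -/
noncomputable abbrev stalkDb : C ⥤ F.Db := stalkKb C ⋙ locDb F

lemma isStalkFunctor_stalkDb : IsStalkFunctor F (stalkDb F) :=
  (isSplitStalkFunctor_stalkKb C).isStalkFunctor_localization (acyclic_iff_orth F) (locDb F)

lemma extClosure_toDb (K : CochainComplex C ℤ) (hP : ∀ i, F.IsProj (K.X i)) {a b : ℤ}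
    (hK : ∀ i, i < a ∨ b < i → IsZero (K.X i)) :
    ExtClosure (stalks (stalkDb F) F.IsProj (fun n => -b ≤ n ∧ n ≤ -a)) (F.toDb K ⟨a, b, hK⟩) := by
  obtain hab | hab := lt_or_ge b a
  · exact .zero _ ((locDb F).map_isZero (isZero_toKb (fun i => hK i (by lia)) _))
  · refine ExtClosure.map (locDb F) ?_ (extClosure_toKb (P := F.IsProj) K a (b + 1 - a).toNat
      (fun i hi => hK i (by lia)) (fun i _ _ => hP i) ⟨a, b, hK⟩)
    rintro _ ⟨M, n, hM, hn, ⟨e⟩⟩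
    exact ⟨M, n, hM, by lia, ⟨(locDb F).mapIso e ≪≫ ((locDb F).commShiftIso n).app _⟩⟩

end StalkKb

section Add

namespace IsInAdd

variable {C : Type*} [Category* C] [Preadditive C] [HasFiniteBiproducts C] {X Y Z : C}

lemma map {D : Type*} [Category* D] [Preadditive D] [HasFiniteBiproducts D] (G : C ⥤ D)
    [G.Additive] (h : IsInAdd X Y) : IsInAdd (G.obj X) (G.obj Y) := by
  obtain ⟨n, ⟨r⟩⟩ := h
  exact ⟨n, ⟨(r.map G).trans (.ofIso (G.mapBiproduct _))⟩⟩

lemma of_map {D : Type*} [Category* D] [Preadditive D] [HasFiniteBiproducts D] (G : C ⥤ D)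
    [G.Additive] [G.Full] [G.Faithful] (h : IsInAdd (G.obj X) (G.obj Y)) : IsInAdd X Y := by
  obtain ⟨n, ⟨r⟩⟩ := h
  let ρ := r.trans (.ofIso (G.mapBiproduct fun _ => X).symm)
  refine ⟨n, ⟨⟨G.preimage ρ.i, G.preimage ρ.r, G.map_injective ?_⟩⟩⟩
  rw [G.map_comp, G.map_preimage, G.map_preimage, ρ.retract, G.map_id]

lemma orth_left (h : IsInAdd X Y) (hX : Orth X Z) : Orth Y Z := by
  obtain ⟨n, ⟨r⟩⟩ := h
  exact .of_retract_left (fun f => biproduct.hom_ext' _ _ fun i =>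
    (hX _).trans comp_zero.symm) r

lemma orth_right (h : IsInAdd X Y) (hX : Orth Z X) : Orth Z Y := by
  obtain ⟨n, ⟨r⟩⟩ := h
  exact .of_retract_right (fun f => biproduct.hom_ext _ _ fun i =>
    (hX _).trans zero_comp.symm) r

end IsInAdd

end Add

section Radical

variable {C : Type*} [Category* C] [Preadditive C]

lemma IsRadical.isIso_id_sub_comp {X Y : C} {f : X ⟶ Y} (hf : IsRadical f) (g : Y ⟶ X) :
    IsIso (𝟙 Y - g ≫ f) := by
  have := hf g
  let v := inv (𝟙 X - f ≫ g)
  have hv : v - f ≫ g ≫ v = 𝟙 X := by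
    rw [← IsIso.hom_inv_id (𝟙 X - f ≫ g), Preadditive.sub_comp, Category.id_comp, Category.assoc]
  have hv' : v - v ≫ f ≫ g = 𝟙 X := by
    rw [← IsIso.inv_hom_id (𝟙 X - f ≫ g), Preadditive.comp_sub, Category.comp_id]
  refine ⟨𝟙 Y + g ≫ v ≫ f, ?_, ?_⟩
  · calc (𝟙 Y - g ≫ f) ≫ (𝟙 Y + g ≫ v ≫ f)
      _ = 𝟙 Y - g ≫ f + g ≫ (v - f ≫ g ≫ v) ≫ f := by simp
      _ = 𝟙 Y := by simp [hv]
  · calc (𝟙 Y + g ≫ v ≫ f) ≫ (𝟙 Y - g ≫ f)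
      _ = 𝟙 Y - g ≫ f + g ≫ (v - v ≫ f ≫ g) ≫ f := by simp; abel
      _ = 𝟙 Y := by simp [hv']

lemma nonempty_retract_X_of_isRadical {T X : CochainComplex C ℤ} (e : HomotopyEquiv T X)
    (hX : ∀ i j, IsRadical (X.d i j)) (i : ℤ) : Nonempty (Retract (X.X i) (T.X i)) := by
  let σ (j k : ℤ) := e.homotopyInvHomId.hom j k
  have hσ : e.inv.f i ≫ e.hom.f i =
      X.d i (i + 1) ≫ σ (i + 1) i + σ i (i - 1) ≫ X.d (i - 1) i + 𝟙 (X.X i) := by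
    rw [← HomologicalComplex.comp_f, e.homotopyInvHomId.comm i,
      dNext_eq (i := i) (i' := i + 1) _ rfl, prevD_eq (j := i) (j' := i - 1) _ (by simp)]
    rfl
  let u := 𝟙 (X.X i) - X.d i (i + 1) ≫ (-σ (i + 1) i)
  have hu : IsIso u := hX _ _ _
  have := (hX (i - 1) i).isIso_id_sub_comp (inv u ≫ (-σ i (i - 1)))
  have hfac : e.inv.f i ≫ e.hom.f i =
      u ≫ (𝟙 _ - (inv u ≫ (-σ i (i - 1))) ≫ X.d (i - 1) i) := by
    rw [hσ, Preadditive.comp_sub, Category.comp_id, Category.assoc, IsIso.hom_inv_id_assoc]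
    simp only [u, Preadditive.comp_neg, Preadditive.neg_comp]
    abel
  have : IsIso (e.inv.f i ≫ e.hom.f i) := hfac ▸ inferInstance
  exact ⟨⟨e.inv.f i, e.hom.f i ≫ inv (e.inv.f i ≫ e.hom.f i), by
    rw [← Category.assoc, IsIso.hom_inv_id]⟩⟩

end Radical

section ModFG

lemma ExtSubfunctor.nonempty_retract_of_isProj_full {C : Type*} [Category* C] [Abelian C]
    [HasExt.{w} C] {P Q : C} (hQ : (full C).IsProj Q) (p : P ⟶ Q) [Epi p] :
    Nonempty (Retract Q P) := by
  obtain ⟨s, hs⟩ := hQ (.mk (kernel.ι p) p (kernel.condition p))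
    ((isExact_full_iff _).2 (.mk' (ShortComplex.exact_kernel p)
      (inferInstanceAs (Mono (kernel.ι p))) ‹Epi p›)) (𝟙 Q)
  exact ⟨⟨s, p, hs⟩⟩

variable (R : Type u) [Ring R] [IsNoetherianRing R]

lemma isProj_self : (ExtSubfunctor.full (ModFG R)).IsProj (FGModuleCat.of R R) := by
  intro S hS f
  have : Epi S.g := hS.1.epi_g
  have hg : Function.Surjective S.g.hom.hom :=
    (ModuleCat.epi_iff_surjective _).1
      (inferInstanceAs (Epi ((forget₂ (ModFG R) (ModuleCat R)).map S.g)))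
  obtain ⟨g, hg⟩ := Module.projective_lifting_property S.g.hom.hom f.hom.hom hg
  exact ⟨FGModuleCat.ofHom g, FGModuleCat.hom_ext hg⟩

attribute [local instance] Abelian.hasFiniteBiproducts

lemma exists_epi_biproduct_self (M : ModFG R) :
    ∃ (n : ℕ) (p : (⨁ fun _ : Fin n => FGModuleCat.of R R) ⟶ M), Epi p := by
  obtain ⟨n, m, hm⟩ := Module.Finite.exists_fin (R := R) (M := M)
  refine ⟨n, biproduct.desc fun i => FGModuleCat.ofHom (LinearMap.toSpanSingleton R M (m i)),
    Preadditive.epi_of_cancel_zero _ fun {N} g hg => FGModuleCat.hom_ext ?_⟩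
  refine LinearMap.ext_on_range hm fun i => ?_
  have hi : FGModuleCat.ofHom (LinearMap.toSpanSingleton R M (m i)) ≫ g = 0 := by
    rw [← biproduct.ι_desc_assoc (fun i => FGModuleCat.ofHom (.toSpanSingleton R M (m i))) i g,
      hg, comp_zero]
  have hi' := congr_arg (fun φ : FGModuleCat.of R R ⟶ N => φ.hom.hom (1 : R)) hi
  exact (congr_arg g.hom.hom (one_smul R (m i)).symm).trans hi'

variable {R}

lemma isInAdd_self_of_isProj_full {Q : ModFG R}
    (hQ : (ExtSubfunctor.full (ModFG R)).IsProj Q) : IsInAdd (FGModuleCat.of R R) Q := by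
  obtain ⟨n, p, hp⟩ := exists_epi_biproduct_self R Q
  exact ⟨n, ExtSubfunctor.nonempty_retract_of_isProj_full hQ p⟩

end ModFG

section Tilting

lemma ExtSubfunctor.IsTilting.prop_toKb {C : Type u} [Category.{v} C] [Abelian C] [HasExt.{w} C]
    {F : ExtSubfunctor.{w} C} {T : CochainComplex C ℤ} (hT : F.IsTilting T)
    (P : ObjectProperty (Kb C)) [P.IsTriangulated] [P.IsClosedUnderIsomorphisms]
    (hP : ∀ Y, IsInAdd (toKb T hT.isBounded) Y → P Y) {K : CochainComplex C ℤ}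
    (hK : ∀ i, F.IsProj (K.X i)) (hK' : IsBoundedCpx K) : P (toKb K hK') := by
  obtain ⟨Y, hY, ⟨e⟩⟩ := hT.generates (P.map (bounded C).ι)
    (fun X hX _ hTX => P.prop_map_obj (bounded C).ι (X := toKb X hX)
      (hP _ (IsInAdd.of_map (bounded C).ι hTX))) K hK' hK
  exact P.prop_of_iso ((bounded C).fullyFaithfulι.preimageIso (Y := toKb K hK') e) hY

variable {C' : Type*} [Category* C'] {D' : Type*} [Category* D'] [Preadditive D']
  [HasZeroObject D'] [HasShift D' ℤ] [∀ n : ℤ, (shiftFunctor D' n).Additive] [Pretriangulated D']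
  (s' : C' ⥤ D')

/-- The objects of finite projective dimension relative to the stalk complex functor `s'`. -/
def finiteProjDim : ObjectProperty D' := fun P => ∃ n, ProjDimLE s' n P

instance : (finiteProjDim s').IsClosedUnderIsomorphisms where
  of_iso e := fun ⟨n, hn⟩ => ⟨n, hn.of_iso e.symm⟩

instance : (finiteProjDim s').IsTriangulated where
  exists_zero := ⟨0, isZero_zero D', 0, fun _ _ _ _ => (isZero_zero D').eq_of_src _ _⟩
  isStableUnderShiftBy k := ⟨fun _ ⟨n, hn⟩ => ⟨n + k, hn.shift k _ rfl⟩⟩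
  toIsTriangulatedClosed₂ := .mk' fun Θ hΘ ⟨n₁, h₁⟩ ⟨n₃, h₃⟩ =>
    ⟨max n₁ n₃, fun N k hk => DistTriang.orth_left (f := Θ.mor₁) (g := Θ.mor₂) (h := Θ.mor₃) hΘ
      (h₁ N k (by lia)) (h₃ N k (by lia))⟩

lemma ExtSubfunctor.IsTilting.finiteProjDim_obj_toKb {C : Type u} [Category.{v} C] [Abelian C]
    [HasExt.{w} C] {F : ExtSubfunctor.{w} C} {T : CochainComplex C ℤ} (hT : F.IsTilting T)
    {D : Type*} [Category* D] [Preadditive D] [HasZeroObject D] [HasShift D ℤ]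
    [∀ n : ℤ, (shiftFunctor D n).Additive] [Pretriangulated D] (q : Kb C ⥤ D) [q.CommShift ℤ]
    [q.IsTriangulated] (L : D ⥤ D') [L.CommShift ℤ] [L.IsTriangulated]
    (hL : finiteProjDim s' (L.obj (q.obj (toKb T hT.isBounded)))) {K : CochainComplex C ℤ}
    (hK : ∀ i, F.IsProj (K.X i)) (hK' : IsBoundedCpx K) :
    finiteProjDim s' (L.obj (q.obj (toKb K hK'))) := by
  obtain ⟨n, hn⟩ := hL
  exact hT.prop_toKb ((finiteProjDim s').inverseImage (q ⋙ L))
    (fun Y hY => ⟨n, fun N k hk => (hY.map (q ⋙ L)).orth_left (hn N k hk)⟩) hK hK'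

lemma isProj_single_X {C : Type*} [Category* C] [Abelian C] [HasExt.{w} C]
    {F : ExtSubfunctor.{w} C} {Q : C} (hQ : F.IsProj Q) (n i : ℤ) :
    F.IsProj (((HomologicalComplex.single C (.up ℤ) n).obj Q).X i) := by
  obtain rfl | hi := eq_or_ne i n
  · exact F.IsProj.prop_of_iso (HomologicalComplex.singleObjXSelf (.up ℤ) i Q).symm hQ
  · exact ExtSubfunctor.isProj_of_isZero (HomologicalComplex.isZero_single_obj_X _ _ _ _ hi)

end Tilting

lemma projDimLE_inverse_obj_of_isInAdd {C : Type*} [Category* C] {D : Type*} [Category* D]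
    [Preadditive D] [HasZeroObject D] [HasShift D ℤ] [∀ n : ℤ, (shiftFunctor D n).Additive]
    [Pretriangulated D] {s : C ⥤ D} {D' : Type*} [Category* D'] [Preadditive D']
    [HasFiniteBiproducts D'] (E : D ≌ D') [E.inverse.Additive] {T : D} {X Y : D'}
    (e : E.functor.obj T ≅ X) {b : ℤ} (hT : ProjDimLE s b T) (hY : IsInAdd X Y) :
    ProjDimLE s b (E.inverse.obj Y) := fun N k hk =>
  (hY.map E.inverse).orth_left
    ((hT N k hk).of_iso_left (E.inverse.mapIso e.symm ≪≫ (E.unitIso.app T).symm))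

section TiltingBounds

variable {C : Type*} [Category* C] [Abelian C] [HasExt.{w} C] {F : ExtSubfunctor.{w} C}
  {D : Type*} [Category* D] [Preadditive D] [HasZeroObject D] [HasShift D ℤ]
  [∀ n : ℤ, (shiftFunctor D n).Additive] [Pretriangulated D] {s : C ⥤ D}
  {C' : Type*} [Category* C'] [Abelian C'] [HasExt.{v} C'] {F' : ExtSubfunctor.{v} C'}
  {D' : Type*} [Category* D'] [Preadditive D'] [HasZeroObject D'] [HasShift D' ℤ]
  [∀ n : ℤ, (shiftFunctor D' n).Additive] [Pretriangulated D'] {s' : C' ⥤ D'} [s'.Additive]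
  [HasFiniteBiproducts C'] {G : C'} (hG : ∀ Q, F'.IsProj Q → IsInAdd G Q)

include hG

lemma IsStalkFunctor.projDimLE_of_orth [F'.EnoughProj] (h' : IsStalkFunctor F' s') {m n : ℤ}
    {X : D'} (hX : ProjDimLE s' n X) (hXG : ∀ k, m < k → Orth X ((s'.obj G)⟦k⟧)) :
    ProjDimLE s' m X := by
  suffices ∀ (d : ℕ) (N : C') (k : ℤ), m < k → n < k + d → Orth X ((s'.obj N)⟦k⟧) from
    fun N k hk => this (n - k + 1).toNat N k hk (by lia)
  intro d
  induction d with
  | zero => exact fun N k _ hk => hX N k (by lia)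
  | succ d ih =>
    intro N k hm hn
    obtain ⟨K, Q, i, p, w, δ, ε, -, hQ, hT⟩ := h'.exists_cover_distTriang N k
    exact hT.orth_right (((hG Q hQ).map (s' ⋙ shiftFunctor D' k)).orth_right (hXG k hm))
      (ih K (k + 1) (by lia) (by lia))

variable (E : D ≌ D') {T : D} (e : E.functor.obj T ≅ s'.obj G)

include e

lemma projDimLE_functor_obj_stalk [F'.EnoughProj] [E.functor.CommShift ℤ]
    (h : IsStalkFunctor F s) (h' : IsStalkFunctor F' s') {m : ℤ}
    (hT : ExtClosure (stalks s F.IsProj (-m ≤ ·)) T) {Q : C} (hQ : F.IsProj Q)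
    (hfin : finiteProjDim s' (E.functor.obj (s.obj Q))) :
    ProjDimLE s' m (E.functor.obj (s.obj Q)) := by
  obtain ⟨n, hn⟩ := hfin
  refine h'.projDimLE_of_orth hG hn fun k hk => ?_
  have hQT : Orth ((s.obj Q)⟦-k⟧) (T⟦(0 : ℤ)⟧) :=
    (hT.orth_right_of_stalks fun N l _ hl => h.proj_orth hQ (by lia)).of_iso_right
      ((shiftFunctorZero D ℤ).app T)
  exact ((orth_map_iff E.functor).2 ((Orth.shift_iff _ _ (-k) 0 k (by lia)).1 hQT)).of_iso_right
    ((shiftFunctor D' k).mapIso e.symm ≪≫ (E.functor.commShiftIso k).symm.app T)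

end TiltingBounds

section Bounds

variable {C : Type*} [Category* C] [Abelian C] [HasExt.{w} C] {F : ExtSubfunctor.{w} C}
  [F.EnoughProj] [∀ M : C, IsNoetherianObject M] {D : Type*} [Category* D] [Preadditive D]
  [HasZeroObject D] [HasShift D ℤ] [∀ n : ℤ, (shiftFunctor D n).Additive] [Pretriangulated D]
  [IsTriangulated D] {s : C ⥤ D} [s.Additive] {C' : Type*} [Category* C'] [Abelian C']
  [HasExt.{v} C'] {F' : ExtSubfunctor.{v} C'} [F'.EnoughProj] [∀ M : C', IsNoetherianObject M]
  [HasFiniteBiproducts C'] {D' : Type*} [Category* D'] [Preadditive D'] [HasZeroObject D']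
  [HasShift D' ℤ] [∀ n : ℤ, (shiftFunctor D' n).Additive] [Pretriangulated D']
  [IsTriangulated D'] {s' : C' ⥤ D'} [s'.Additive]

theorem IsStalkFunctor.phiDim_le_and_phiDim_le (h : IsStalkFunctor F s)
    (h' : IsStalkFunctor F' s') (hfull : ∀ S : ShortComplex C', S.ShortExact → F'.IsExact S)
    (L : D ⥤ D') [L.CommShift ℤ] [L.IsTriangulated] [L.IsEquivalence] {T : D} {G : C'}
    (hG : ∀ Q, F'.IsProj Q → IsInAdd G Q) (e : L.obj T ≅ s'.obj G) {m b : ℤ} {t : ℕ}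
    (ht : m + b = t) (hT : ExtClosure (stalks s F.IsProj (fun n => -m ≤ n ∧ n ≤ b)) T)
    (hfin : ∀ Q, F.IsProj Q → finiteProjDim s' (L.obj (s.obj Q))) :
    F.phiDim ≤ F'.phiDim + t ∧ F'.phiDim ≤ F.phiDim + t + 2 := by
  let E := L.asEquivalence
  let : E.functor.CommShift ℤ := ‹L.CommShift ℤ›
  let : E.inverse.CommShift ℤ := E.commShiftInverse ℤ
  have : E.CommShift ℤ := E.commShift_of_functor ℤ
  have : E.IsTriangulated := .mk' E ‹L.IsTriangulated›
  have hTm : ExtClosure (stalks s F.IsProj (-m ≤ ·)) T :=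
    extClosure_le (fun _ ⟨M, n, hM, hn, i⟩ => .of _ ⟨M, n, hM, hn.1, i⟩) _ hT
  have hTb : ExtClosure (stalks s F.IsProj (· ≤ b)) T :=
    extClosure_le (fun _ ⟨M, n, hM, hn, i⟩ => .of _ ⟨M, n, hM, hn.2, i⟩) _ hT
  have hm (Q : C) (hQ : F.IsProj Q) : ProjDimLE s' m (E.functor.obj (s.obj Q)) :=
    projDimLE_functor_obj_stalk hG E e h h' hTm hQ (hfin Q hQ)
  have hb (Q : C') (hQ : F'.IsProj Q) : ProjDimLE s b (E.inverse.obj (s'.obj Q)) :=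
    projDimLE_inverse_obj_of_isInAdd E e (h.projDimLE_of_extClosure hTb) ((hG Q hQ).map s')
  constructor
  · exact h.phiDim_le_add E h' hm hb (fun M =>
      h'.isStalkUpToProj_of_homologyLE hfull (h.homologyLE_functor_obj E hm M)) t ht
  · have := h'.phiDim_le_add E.symm h (a := b + 2) (b := m)
      (fun Q hQ => (hb Q hQ).mono (by lia)) hm (fun M => h.isStalkUpToProj_of_homologyLE_sub_two
        ((add_sub_cancel_right b 2).symm ▸ h'.homologyLE_functor_obj E.symm hb M))
      (t + 2) (by lia)
    rwa [Nat.cast_add, ← add_assoc] at this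

end Bounds

end RelDer

open RelDer in
attribute [local instance] Abelian.hasFiniteBiproducts in
theorem theorem5p7_general {C : Type u} [Category.{v} C] [Abelian C] [HasExt.{w} C]
    [∀ M : C, IsNoetherianObject M] {B : Type v'} [Ring B] [IsNoetherianRing B]
    (F : ExtSubfunctor.{w} C) [F.EnoughProj]
    (L : F.Db ⥤ (ExtSubfunctor.full (ModFG B)).Db) [L.CommShift ℤ] [L.IsTriangulated]
    [L.IsEquivalence] (T : CochainComplex C ℤ) (hT : F.IsTilting T)
    (hLT : Nonempty (L.obj (F.toDb T hT.isBounded) ≅ (ExtSubfunctor.full (ModFG B)).toDb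
      ((HomologicalComplex.single (ModFG B) (ComplexShape.up ℤ) 0).obj (FGModuleCat.of B B))
      (isBoundedCpx_single _)))
    (t : ℕ) (ht : HasTermLength T t) :
    F.phiDim ≤ (ExtSubfunctor.full (ModFG B)).phiDim + t ∧
      (ExtSubfunctor.full (ModFG B)).phiDim ≤ F.phiDim + t + 2 := by
  obtain ⟨X, ⟨e⟩, hrad, m, -, -, hX⟩ := ht
  obtain ⟨ε⟩ := hLT
  have h := isStalkFunctor_stalkDb F
  have h' := isStalkFunctor_stalkDb (ExtSubfunctor.full (ModFG B))
  have hXP (i : ℤ) : F.IsProj (X.X i) :=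
    (hT.isProj i).of_retract (nonempty_retract_X_of_isRadical e hrad i).some
  have hTX : ExtClosure (stalks (stalkDb F) F.IsProj (fun n => -m ≤ n ∧ n ≤ -(m - t)))
      (F.toDb T hT.isBounded) :=
    (ExtClosure _).prop_of_iso ((locDb F).mapIso ((bounded C).fullyFaithfulι.preimageIso
      (X := toKb X ⟨m - t, m, hX⟩) (Y := toKb T hT.isBounded)
      (HomotopyCategory.isoOfHomotopyEquiv e.symm))) (extClosure_toDb F X hXP hX)
  have hB : finiteProjDim (stalkDb _) (L.obj (F.toDb T hT.isBounded)) :=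
    ⟨0, .of_iso (fun N _ hk => h'.orth _ N (isProj_self B) _ hk.ne') ε⟩
  exact h.phiDim_le_and_phiDim_le h' (fun S => (ExtSubfunctor.isExact_full_iff S).2) L
    (fun Q => isInAdd_self_of_isProj_full) ε (by lia) hTX
    fun Q hQ => hT.finiteProjDim_obj_toKb _ (locDb F) L hB (isProj_single_X hQ 0)
      (isBoundedCpx_single Q)

theorem theorem5p7 {A : Type u} [Ring A] [RelDer.IsArtinAlgebra A]
    {B : Type v} [Ring B] [RelDer.IsArtinAlgebra B]
    (F : RelDer.ExtSubfunctor (RelDer.ModFG A)) [F.EnoughProj] [F.EnoughInj]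
    (hF : F.IsOfFiniteType)
    (L : F.Db ⥤ (RelDer.ExtSubfunctor.full (RelDer.ModFG B)).Db) [L.CommShift ℤ]
    [L.IsTriangulated] [L.IsEquivalence]
    (T : CochainComplex (RelDer.ModFG A) ℤ) (hT : F.IsTilting T)
    (hLT : Nonempty (L.obj (F.toDb T hT.isBounded) ≅
      (RelDer.ExtSubfunctor.full (RelDer.ModFG B)).toDb
        ((HomologicalComplex.single (RelDer.ModFG B) (ComplexShape.up ℤ) 0).obj
          (FGModuleCat.of B B))
        (RelDer.isBoundedCpx_single _)))
    (t : ℕ) (ht : RelDer.HasTermLength T t) :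
    F.phiDim ≤ (RelDer.ExtSubfunctor.full (RelDer.ModFG B)).phiDim + t ∧
      (RelDer.ExtSubfunctor.full (RelDer.ModFG B)).phiDim ≤ F.phiDim + t + 2 :=
  theorem5p7_general F L T hT hLT t ht
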